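/- **Setting.** Types and terms are taken up to renaming of bound variables. *System F types*: $T::=\alpha\mid T\to T\mid\forall\alpha.T$; system F terms are the usual Church-style ones, built from typed variables $x^T$ by $\lambda x^T.M$, $(M)N$, $\Lambda\alpha.M$ (where $\alpha$ must not be free in the types of the free term variables of $M$: the eigenvariable condition) and $(M)T$. *DLAL types*: $A::=\alpha\mid A\multimap A\mid A\Rightarrow A\mid \S A\mid\forall\alpha.A$. The erasure $A^-$ deletes $\S$ and replaces $\multimap,\Rightarrow$ by $\to$. A judgement $\Gamma;\Delta\vdash M:A$ consists of a system F term $M$, a DLAL type $A$ and finite sets $\Gamma,\Delta$ of declarations $x^T:B$ with $B^-=T$, all declared variables being distinct. The rules of DLAL are: - (Id) $;x:A\vdash x:A$. - ($\multimap$i) from $\Gamma;x:A,\Delta\vdash M:B$ infer $\Gamma;\Delta\vdash\lambda x^{A^-}.M:A\multimap B$. - ($\multimap$e) from $\Gamma_1;\Delta_1\vdash M:A\multimap B$ and $\Gamma_2;\Delta_2\vdash N:A$ infer $\Gamma_1,\Gamma_2;\Delta_1,\Delta_2\vdash (M)N:B$. - ($\Rightarrow$i) from $x:A,\Gamma;\Delta\vdash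 M:B$ infer $\Gamma;\Delta\vdash\lambda x^{A^-}.M:A\Rightarrow B$. - ($\Rightarrow$e) from $\Gamma;\Delta\vdash M:A\Rightarrow B$ and $;z:C\vdash N:A$ infer $\Gamma,z:C;\Delta\vdash (M)N:B$ (here $z:C$ can be absent). - (Weak) from $\Gamma_1;\Delta_1\vdash M:A$ infer $\Gamma_1,\Gamma_2;\Delta_1,\Delta_2\vdash M:A$. - (Cntr) from $x_1:A,x_2:A,\Gamma;\Delta\vdash M:B$ infer $x:A,\Gamma;\Delta\vdash M[x/x_1,x/x_2]:B$. - ($\S$i) from $;\Gamma,\Delta\vdash M:A$ infer $\Gamma;\S\Delta\vdash M:\S A$. - ($\S$e) from $\Gamma_1;\Delta_1\vdash N:\S A$ and $\Gamma_2;x:\S A,\Delta_2\vdash M:B$ infer $\Gamma_1,\Gamma_2;\Delta_1,\Delta_2\vdash M[N/x]:B$ (capture-free substitution). - ($\forall$i) from $\Gamma;\Delta\vdash M:A$ infer $\Gamma;\Delta\vdash\Lambda\alpha.M:\forall\alpha.A$, if $\alpha$ is not free in $\Gamma,\Delta$. - ($\forall$e) from $\Gamma;\Delta\vdash M:\forall\alpha.A$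 infer $\Gamma;\Delta\vdash (M)B^-:A[B/\alpha]$. *DLAL$^\star$ types*: linear types $A::=\alpha\mid D\multimap A\mid\forall\alpha.A\mid\S A$ and arbitrary types $D::=A\mid {!A}$; ${!A}$ is a bang type. Put $(A\Rightarrow B)^\star={!A^\star}\multimap B^\star$, with $(\cdot)^\star$ commuting with the other connectives, $({!A})^\circ=\S A$ and $A^\circ=A$ for linear $A$; erasure deletes $!$ and $\S$. *Pseudo-terms*: $t::=x^D\mid\lambda x^D.t\mid(t)t\mid\Lambda\alpha.t\mid(t)A\mid\S t\mid\bar\S t$, with $A$ linear. The erasure $t^-$ deletes all $\S,\bar\S$ and erases all types; $t$ is a *decoration* of $M$ if $t^-=M$; $t$ is *regular* if it has no subterm $\S\bar\S u$ or $\bar\S\S u$. For an occurrence of a subterm $u$ of $t$, $t\langle u\rangle$ is the word of the symbols $\S,\bar\S$ on the path from the root of $t$ to (and excluding) $u$. For a word $l$, $s(l)$ is the number of $\S$ minus the number of $\bar\S$ in $l$; $l$ is *weakly well-bracketed* if $s(l')\ge0$ for all prefixes $l'$ of $l$, and *well-bracketed* if moreover $s(l)=0$. *Local typing condition.* (i)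 Linear output types can be assigned to all subterms by: $x^D$ has type $D^\circ$; if $t:A$ then $\S t:\S A$; if $t:\S A$ then $\bar\S t:A$; if $t:B$ then $\lambda x^D.t:D\multimap B$; if $t:D\multimap B$ and $u:D^\circ$ then $(t)u:B$; if $t:A$ then $\Lambda\alpha.t:\forall\alpha.A$; if $t:\forall\alpha.A$ then $(t)B:A[B/\alpha]$. (ii) Every variable, free or bound, that occurs more than once has a bang type. (iii) The eigenvariable condition holds. The type of $t$ is its output type. *Bracketing condition.* (i) $t\langle x\rangle$ is well-bracketed for each occurrence of a free variable $x$ of $t$; and for each occurrence of a subterm $\lambda x.v$, (ii) $t\langle\lambda x.v\rangle$ is weakly well-bracketed and (iii) $v\langle x\rangle$ is well-bracketed for each occurrence of $x$ in $v$. *Bang condition.* For each bang subterm $u$ of $t$, i.e. one that occurs as an argument $(t'_{!A\multimap B})u_{\S A}$: (i) $u$ contains at most one occurrence of a free variable, and this variable $x$, if any, has a bang type; (ii) $s(u\langle v\rangle)\ge1$ for each occurrence of a subterm $v$ of $u$ other than $u$ itself and the occurrence of $x$; (iii) $u$ is not of the form $\bar\S w$. *$\Lambda$-scope condition.* For each subterm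 $\Lambda\alpha.u$ of $t$ and each occurrence of a subterm $v$ of $u$ that depends on $\alpha$, the word $u\langle v\rangle$ is weakly well-bracketed. Here $v$ *depends on* $\alpha$ if $\alpha$ is free in the output type of $v$, or $v$ is a type application $(w)B$ with $\alpha$ free in $B$. **Theorem.** Let $M$ be a system F term, let $x_1:A_1,\dots,x_m:A_m$ and $y_1:B_1,\dots,y_n:B_n$ ($m,n\ge0$) be declarations of pairwise distinct variables, and let $C$ be a DLAL type. Then $x_1:A_1,\dots,x_m:A_m;\,y_1:B_1,\dots,y_n:B_n\vdash M:C$ is derivable in DLAL if and only if there is a decoration $t$ of $M$ of type $C^\star$, with free variables among $x_1^{!A_1^\star},\dots,x_m^{!A_m^\star},y_1^{B_1^\star},\dots,y_n^{B_n^\star}$, which is regular and satisfies the local typing, bracketing, bang and $\Lambda$-scope conditions. -/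

import Mathlib

/-!
Types and terms are taken up to renaming of bound variables and are written with de Bruijn indices,
separately for type variables and for term variables.  An index that points outside of all binders
is (the name of) a free variable.
-/

namespace DLAL

/-- `scons a f` is the sequence `a, f 0, f 1, …`. -/
def scons {X : Type} (a : X) (f : ℕ → X) : ℕ → X
  | 0 => a
  | n + 1 => f n

/-- A renaming of indices, pushed under one binder. -/
def upRen (r : ℕ → ℕ) : ℕ → ℕ := scons 0 (fun n => r n + 1)

/-! ### System F -/

/-- System F types: `α`, `T → U`, `∀ α. T`. -/
inductive FType : Type
  | var (n : ℕ)
  | arrow (T U : FType)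
  | all (T : FType)
  deriving DecidableEq

namespace FType

def rename (r : ℕ → ℕ) : FType → FType
  | var n => var (r n)
  | arrow T U => arrow (rename r T) (rename r U)
  | all T => all (rename (upRen r) T)

/-- Weakening by one type variable. -/
def shift (T : FType) : FType := T.rename Nat.succ

/-- Simultaneous capture-avoiding substitution. -/
def subst (s : ℕ → FType) : FType → FType
  | var n => s n
  | arrow T U => arrow (subst s T) (subst s U)
  | all T => all (subst (scons (var 0) (fun n => (s n).shift)) T)

/-- `T.inst U` is `T[U/α]`, with `α` the variable of index `0` of `T`. -/
def inst (T U : FType) : FType := T.subst (scons U var)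

end FType

/-- Terms of system F before typing: `x`, `λ x^T. M`, `(M) N`, `Λ α. M`, `(M) T`. -/
inductive FTerm : Type
  | var (x : ℕ)
  | lam (T : FType) (M : FTerm)
  | app (M N : FTerm)
  | tlam (M : FTerm)
  | tapp (M : FTerm) (T : FType)
  deriving DecidableEq

namespace FTerm

/-- Renaming of the free term variables. -/
def rename (r : ℕ → ℕ) : FTerm → FTerm
  | var x => var (r x)
  | lam T M => lam T (rename (upRen r) M)
  | app M N => app (rename r M) (rename r N)
  | tlam M => tlam (rename r M)
  | tapp M T => tapp (rename r M) T

/-- Renaming of the free type variables. -/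
def renameTy (r : ℕ → ℕ) : FTerm → FTerm
  | var x => var x
  | lam T M => lam (T.rename r) (renameTy r M)
  | app M N => app (renameTy r M) (renameTy r N)
  | tlam M => tlam (renameTy (upRen r) M)
  | tapp M T => tapp (renameTy r M) (T.rename r)

/-- Simultaneous substitution of terms for the free term variables; it captures neither term
variables nor type variables. -/
def subst (s : ℕ → FTerm) : FTerm → FTerm
  | var x => s x
  | lam T M => lam T (subst (scons (var 0) (fun n => (s n).rename Nat.succ)) M)
  | app M N => app (subst s M) (subst s N)
  | tlam M => tlam (subst (fun n => (s n).renameTy Nat.succ) M)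
  | tapp M T => tapp (subst s M) T

/-- `M[N/x]`, for a free variable `x`. -/
def substVar (M : FTerm) (x : ℕ) (N : FTerm) : FTerm :=
  M.subst (fun y => if y = x then N else var y)

/-- `M[x/x₁, x/x₂]`. -/
def merge (M : FTerm) (x₁ x₂ x : ℕ) : FTerm :=
  M.rename (fun y => if y = x₁ ∨ y = x₂ then x else y)

/-- `HasType S M T`: `M` is a term of system F of type `T`, where each free term variable `x` is
the variable `x^(S x)`.  In the rule for `Λ` the types of the free term variables are weakened by
the new type variable; this is the eigenvariable condition. -/
inductive HasType : (ℕ → FType) → FTerm → FType → Prop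
  | var (S : ℕ → FType) (x : ℕ) : HasType S (var x) (S x)
  | lam {S : ℕ → FType} {T U : FType} {M : FTerm} :
      HasType (scons T S) M U → HasType S (lam T M) (T.arrow U)
  | app {S : ℕ → FType} {T U : FType} {M N : FTerm} :
      HasType S M (T.arrow U) → HasType S N T → HasType S (app M N) U
  | tlam {S : ℕ → FType} {U : FType} {M : FTerm} :
      HasType (fun x => (S x).shift) M U → HasType S (tlam M) U.all
  | tapp {S : ℕ → FType} {U : FType} {M : FTerm} (T : FType) :
      HasType S M U.all → HasType S (tapp M T) (U.inst T)

end FTerm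

/-! ### DLAL -/

/-- DLAL types: `α`, `A ⊸ B`, `A ⇒ B`, `§ A`, `∀ α. A`. -/
inductive DType : Type
  | var (n : ℕ)
  | lolli (A B : DType)
  | impl (A B : DType)
  | par (A : DType)
  | all (A : DType)
  deriving DecidableEq

namespace DType

def rename (r : ℕ → ℕ) : DType → DType
  | var n => var (r n)
  | lolli A B => lolli (rename r A) (rename r B)
  | impl A B => impl (rename r A) (rename r B)
  | par A => par (rename r A)
  | all A => all (rename (upRen r) A)

def shift (A : DType) : DType := A.rename Nat.succ

def subst (s : ℕ → DType) : DType → DType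
  | var n => s n
  | lolli A B => lolli (subst s A) (subst s B)
  | impl A B => impl (subst s A) (subst s B)
  | par A => par (subst s A)
  | all A => all (subst (scons (var 0) (fun n => (s n).shift)) A)

/-- `A.inst B` is `A[B/α]`, with `α` the variable of index `0` of `A`. -/
def inst (A B : DType) : DType := A.subst (scons B var)

/-- The erasure `A⁻`. -/
def erase : DType → FType
  | var n => FType.var n
  | lolli A B => FType.arrow (erase A) (erase B)
  | impl A B => FType.arrow (erase A) (erase B)
  | par A => erase A
  | all A => FType.all (erase A)

end DType

/-- A finite collection of declarations `x : A`. -/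
abbrev Ctx : Type := Multiset (ℕ × DType)

namespace Ctx

/-- The variables declared in `Γ` and `Δ` are pairwise distinct. -/
def Distinct (Γ Δ : Ctx) : Prop := ((Γ + Δ).map Prod.fst).Nodup

/-- The declarations, seen under one more term binder. -/
def lift (Γ : Ctx) : Ctx := Γ.map (fun p => (p.1 + 1, p.2))

/-- The declarations, seen under one more type binder. -/
def liftTy (Γ : Ctx) : Ctx := Γ.map (fun p => (p.1, p.2.shift))

/-- `§ Δ`. -/
def par (Δ : Ctx) : Ctx := Δ.map (fun p => (p.1, p.2.par))

end Ctx

/-- `Derives Γ Δ M A`: the judgement `Γ; Δ ⊢ M : A` is derivable in DLAL.  A comma between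
contexts is only written if the declared variables are distinct.  A rule that binds a variable
binds index `0`; the weakening of the context in `allI` says that the bound type variable does not
occur free in the context. -/
inductive Derives : Ctx → Ctx → FTerm → DType → Prop
  | id (x : ℕ) (A : DType) : Derives 0 {(x, A)} (.var x) A
  | lolliI {Γ Δ : Ctx} {M : FTerm} {A B : DType} :
      Derives Γ.lift ((0, A) ::ₘ Δ.lift) M B →
      Derives Γ Δ (.lam A.erase M) (A.lolli B)
  | lolliE {Γ₁ Γ₂ Δ₁ Δ₂ : Ctx} {M N : FTerm} {A B : DType} :
      Ctx.Distinct (Γ₁ + Γ₂) (Δ₁ + Δ₂) →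
      Derives Γ₁ Δ₁ M (A.lolli B) → Derives Γ₂ Δ₂ N A →
      Derives (Γ₁ + Γ₂) (Δ₁ + Δ₂) (.app M N) B
  | implI {Γ Δ : Ctx} {M : FTerm} {A B : DType} :
      Derives ((0, A) ::ₘ Γ.lift) Δ.lift M B →
      Derives Γ Δ (.lam A.erase M) (A.impl B)
  | implE {Γ Δ : Ctx} {M N : FTerm} {A B C : DType} {z : ℕ} :
      Ctx.Distinct ((z, C) ::ₘ Γ) Δ →
      Derives Γ Δ M (A.impl B) → Derives 0 {(z, C)} N A →
      Derives ((z, C) ::ₘ Γ) Δ (.app M N) B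
  | implE_closed {Γ Δ : Ctx} {M N : FTerm} {A B : DType} :
      Derives Γ Δ M (A.impl B) → Derives 0 0 N A →
      Derives Γ Δ (.app M N) B
  | weak {Γ₁ Γ₂ Δ₁ Δ₂ : Ctx} {M : FTerm} {A : DType} :
      Ctx.Distinct (Γ₁ + Γ₂) (Δ₁ + Δ₂) →
      Derives Γ₁ Δ₁ M A → Derives (Γ₁ + Γ₂) (Δ₁ + Δ₂) M A
  | cntr {Γ Δ : Ctx} {M : FTerm} {A B : DType} {x₁ x₂ x : ℕ} :
      Ctx.Distinct ((x, A) ::ₘ Γ) Δ →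
      Derives ((x₁, A) ::ₘ (x₂, A) ::ₘ Γ) Δ M B →
      Derives ((x, A) ::ₘ Γ) Δ (M.merge x₁ x₂ x) B
  | parI {Γ Δ : Ctx} {M : FTerm} {A : DType} :
      Derives 0 (Γ + Δ) M A → Derives Γ Δ.par M A.par
  | parE {Γ₁ Γ₂ Δ₁ Δ₂ : Ctx} {M N : FTerm} {A B : DType} {x : ℕ} :
      Ctx.Distinct (Γ₁ + Γ₂) (Δ₁ + Δ₂) →
      Derives Γ₁ Δ₁ N A.par → Derives Γ₂ ((x, A.par) ::ₘ Δ₂) M B →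
      Derives (Γ₁ + Γ₂) (Δ₁ + Δ₂) (M.substVar x N) B
  | allI {Γ Δ : Ctx} {M : FTerm} {A : DType} :
      Derives Γ.liftTy Δ.liftTy M A → Derives Γ Δ (.tlam M) A.all
  | allE {Γ Δ : Ctx} {M : FTerm} {A : DType} (B : DType) :
      Derives Γ Δ M A.all → Derives Γ Δ (.tapp M B.erase) (A.inst B)

/-! ### DLAL⋆ types and pseudo-terms -/

/-- Linear DLAL⋆ types: `α`, `D ⊸ A`, `§ A`, `∀ α. A`.  The domain `D` of `arrow b A B` is `!A`
if `b = true`, and `A` if `b = false`. -/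
inductive LinTy : Type
  | var (n : ℕ)
  | arrow (b : Bool) (A B : LinTy)
  | par (A : LinTy)
  | all (A : LinTy)
  deriving DecidableEq

namespace LinTy

def rename (r : ℕ → ℕ) : LinTy → LinTy
  | var n => var (r n)
  | arrow b A B => arrow b (rename r A) (rename r B)
  | par A => par (rename r A)
  | all A => all (rename (upRen r) A)

def shift (A : LinTy) : LinTy := A.rename Nat.succ

def subst (s : ℕ → LinTy) : LinTy → LinTy
  | var n => s n
  | arrow b A B => arrow b (subst s A) (subst s B)
  | par A => par (subst s A)
  | all A => all (subst (scons (var 0) (fun n => (s n).shift)) A)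

/-- `A.inst B` is `A[B/α]`, with `α` the variable of index `0` of `A`. -/
def inst (A B : LinTy) : LinTy := A.subst (scons B var)

def erase : LinTy → FType
  | var n => FType.var n
  | arrow _ A B => FType.arrow (erase A) (erase B)
  | par A => erase A
  | all A => FType.all (erase A)

/-- The type variable `j` occurs free in the type. -/
def HasFree : LinTy → ℕ → Prop
  | var n, j => n = j
  | arrow _ A B, j => HasFree A j ∨ HasFree B j
  | par A, j => HasFree A j
  | all A, j => HasFree A (j + 1)

end LinTy

/-- Arbitrary DLAL⋆ types `D`: the bang type `!A` (`bang = true`) or the linear type `A`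
(`bang = false`), where `A` is the field `ty`. -/
structure StarTy : Type where
  bang : Bool
  ty : LinTy
  deriving DecidableEq

namespace StarTy

def shift (D : StarTy) : StarTy := ⟨D.bang, D.ty.shift⟩

def erase (D : StarTy) : FType := D.ty.erase

/-- `D ⊸ B`. -/
def lolli (D : StarTy) (B : LinTy) : LinTy := .arrow D.bang D.ty B

/-- `D°`: it is `§ A` for `D = !A`, and `D` for a linear type `D`. -/
def out (D : StarTy) : LinTy := if D.bang then D.ty.par else D.ty

end StarTy

/-- The map `A ↦ A⋆`, with `(A ⇒ B)⋆ = !A⋆ ⊸ B⋆`. -/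
def DType.star : DType → LinTy
  | .var n => .var n
  | .lolli A B => .arrow false A.star B.star
  | .impl A B => .arrow true A.star B.star
  | .par A => .par A.star
  | .all A => .all A.star

/-- Pseudo-terms: `x`, `λ x^D. t`, `(t) u`, `Λ α. t`, `(t) A`, `§ t` and `§̄ t`. -/
inductive PTerm : Type
  | var (x : ℕ)
  | lam (D : StarTy) (t : PTerm)
  | app (t u : PTerm)
  | tlam (t : PTerm)
  | tapp (t : PTerm) (A : LinTy)
  | par (t : PTerm)
  | dpar (t : PTerm)
  deriving DecidableEq

/-- The erasure `t⁻`; a pseudo-term `t` is a decoration of `M` if `t⁻ = M`. -/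
def PTerm.erase : PTerm → FTerm
  | .var x => .var x
  | .lam D t => .lam D.erase t.erase
  | .app t u => .app t.erase u.erase
  | .tlam t => .tlam t.erase
  | .tapp t A => .tapp t.erase A.erase
  | .par t => t.erase
  | .dpar t => t.erase

/-- An assignment of types to the free term variables of a pseudo-term: `x` is `x^(E x)`. -/
abbrev Env : Type := ℕ → StarTy

def Env.liftTy (E : Env) : Env := fun x => (E x).shift

/-- `OutTy E t A`: the pseudo-term `t`, with free variables `x^(E x)`, has the output type `A`.
The weakening of `E` in the rule for `Λ` is the eigenvariable condition. -/
inductive OutTy : Env → PTerm → LinTy → Prop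
  | var (E : Env) (x : ℕ) : OutTy E (.var x) (E x).out
  | par {E : Env} {t : PTerm} {A : LinTy} : OutTy E t A → OutTy E (.par t) A.par
  | dpar {E : Env} {t : PTerm} {A : LinTy} : OutTy E t A.par → OutTy E (.dpar t) A
  | lam {E : Env} {D : StarTy} {t : PTerm} {B : LinTy} :
      OutTy (scons D E) t B → OutTy E (.lam D t) (D.lolli B)
  | app {E : Env} {t u : PTerm} {D : StarTy} {B : LinTy} :
      OutTy E t (D.lolli B) → OutTy E u D.out → OutTy E (.app t u) B
  | tlam {E : Env} {t : PTerm} {A : LinTy} : OutTy E.liftTy t A → OutTy E (.tlam t) A.all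
  | tapp {E : Env} {t : PTerm} {A : LinTy} (B : LinTy) :
      OutTy E t A.all → OutTy E (.tapp t B) (A.inst B)

/-! ### Occurrences of subterms -/

/-- One step from a pseudo-term down to an immediate subterm. -/
inductive Step : Type
  | lam (D : StarTy)
  | fn
  | arg
  | tlam
  | tapp
  | par
  | dpar
  deriving DecidableEq

/-- `Occ t p u`: the subterm of `t` at the end of the path `p` is `u`.  Paths from the root of
`t` identify the occurrences of subterms of `t`. -/
inductive Occ : PTerm → List Step → PTerm → Prop
  | here (t : PTerm) : Occ t [] t
  | lam {t u : PTerm} {p : List Step} (D : StarTy) : Occ t p u → Occ (.lam D t) (.lam D :: p) u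
  | fn {t u : PTerm} {p : List Step} (s : PTerm) : Occ t p u → Occ (.app t s) (.fn :: p) u
  | arg {t u : PTerm} {p : List Step} (s : PTerm) : Occ t p u → Occ (.app s t) (.arg :: p) u
  | tlam {t u : PTerm} {p : List Step} : Occ t p u → Occ (.tlam t) (.tlam :: p) u
  | tapp {t u : PTerm} {p : List Step} (A : LinTy) : Occ t p u → Occ (.tapp t A) (.tapp :: p) u
  | par {t u : PTerm} {p : List Step} : Occ t p u → Occ (.par t) (.par :: p) u
  | dpar {t u : PTerm} {p : List Step} : Occ t p u → Occ (.dpar t) (.dpar :: p) u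

/-- The two modal symbols `§` and `§̄`. -/
inductive Modal : Type
  | par
  | dpar
  deriving DecidableEq

/-- The modal symbols met along a path: if `u` is the subterm of `t` at the end of `p`, this is
the word `t⟨u⟩`. -/
def word : List Step → List Modal
  | [] => []
  | .par :: p => .par :: word p
  | .dpar :: p => .dpar :: word p
  | .lam _ :: p => word p
  | .fn :: p => word p
  | .arg :: p => word p
  | .tlam :: p => word p
  | .tapp :: p => word p

/-- The number of term binders along a path. -/
def lamDepth : List Step → ℕ
  | [] => 0
  | .lam _ :: p => lamDepth p + 1
  | .par :: p => lamDepth p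
  | .dpar :: p => lamDepth p
  | .fn :: p => lamDepth p
  | .arg :: p => lamDepth p
  | .tlam :: p => lamDepth p
  | .tapp :: p => lamDepth p

/-- The number of type binders along a path. -/
def tlamDepth : List Step → ℕ
  | [] => 0
  | .tlam :: p => tlamDepth p + 1
  | .lam _ :: p => tlamDepth p
  | .par :: p => tlamDepth p
  | .dpar :: p => tlamDepth p
  | .fn :: p => tlamDepth p
  | .arg :: p => tlamDepth p
  | .tapp :: p => tlamDepth p

/-- The types of the term variables at the end of a path. -/
def envAt (E : Env) : List Step → Env
  | [] => E
  | .lam D :: p => envAt (scons D E) p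
  | .tlam :: p => envAt E.liftTy p
  | .par :: p => envAt E p
  | .dpar :: p => envAt E p
  | .fn :: p => envAt E p
  | .arg :: p => envAt E p
  | .tapp :: p => envAt E p

/-- There is an occurrence of the free variable `x` of `t` at the end of the path `p`. -/
def FreeAt (t : PTerm) (p : List Step) (x : ℕ) : Prop := Occ t p (.var (x + lamDepth p))

/-- The sum `s` of a word: `§` counts `1`, and `§̄` counts `-1`. -/
def sum : List Modal → ℤ
  | [] => 0
  | .par :: l => 1 + sum l
  | .dpar :: l => -1 + sum l

def WeaklyWellBracketed (l : List Modal) : Prop := ∀ l', l' <+: l → 0 ≤ sum l'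

def WellBracketed (l : List Modal) : Prop := WeaklyWellBracketed l ∧ sum l = 0

/-! ### The conditions -/

/-- No subterm has the form `§ §̄ u` or `§̄ § u`. -/
def Regular (t : PTerm) : Prop :=
  ∀ p u, ¬ Occ t p (.par (.dpar u)) ∧ ¬ Occ t p (.dpar (.par u))

/-- The local typing condition for `t`, with free variables `x^(E x)` and output type `A`: output
types can be assigned, and each variable, free or bound, that occurs more than once has a bang
type. -/
def LocalTyping (E : Env) (t : PTerm) (A : LinTy) : Prop :=
  OutTy E t A ∧
  (∀ p q x, FreeAt t p x → FreeAt t q x → p ≠ q → (E x).bang = true) ∧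
  (∀ r D v, Occ t r (.lam D v) →
    ∀ p q, FreeAt v p 0 → FreeAt v q 0 → p ≠ q → D.bang = true)

def Bracketing (t : PTerm) : Prop :=
  (∀ p x, FreeAt t p x → WellBracketed (word p)) ∧
  (∀ p D v, Occ t p (.lam D v) →
    WeaklyWellBracketed (word p) ∧
    ∀ q, FreeAt v q 0 → WellBracketed (word q))

/-- `u` is a bang subterm of `t`, that is, it occurs as `(r : !A ⊸ B) (u : § A)`; here `E'` gives
the types of its free variables. -/
def BangSubterm (E : Env) (t : PTerm) (E' : Env) (u : PTerm) : Prop :=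
  ∃ p r A B, Occ t p (.app r u) ∧ E' = envAt E p ∧
    OutTy E' r (.arrow true A B) ∧ OutTy E' u A.par

/-- The bang condition.  Each bang subterm `u`
* contains at most one occurrence of a free variable, and that variable has a bang type;
* satisfies `1 ≤ s (u⟨v⟩)` for all occurrences of subterms `v` of `u` other than `u` itself and
  the occurrence of that free variable;
* does not begin with `§̄`. -/
def BangCondition (E : Env) (t : PTerm) : Prop :=
  ∀ E' u, BangSubterm E t E' u →
    (∀ p q x y, FreeAt u p x → FreeAt u q y → p = q) ∧
    (∀ p x, FreeAt u p x → (E' x).bang = true) ∧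
    (∀ p v, Occ u p v → p ≠ [] → (¬ ∃ x, FreeAt u p x) → 1 ≤ sum (word p)) ∧
    (∀ w, u ≠ .dpar w)

/-- The pseudo-term `v`, with free variables `x^(E x)`, depends on the type variable `j`: this
variable occurs free in the type of `v`, or in `B` if `v` is a type application `(w) B`. -/
def DependsOn (E : Env) (v : PTerm) (j : ℕ) : Prop :=
  (∃ A, OutTy E v A ∧ A.HasFree j) ∨ (∃ w B, v = .tapp w B ∧ B.HasFree j)

/-- The `Λ`-scope condition: for each subterm `Λ α. u`, and each subterm `v` of `u` that depends
on `α`, the word `u⟨v⟩` is weakly well-bracketed.  At `v` the index of `α` is the number of type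
binders between `u` and `v`. -/
def ScopeCondition (E : Env) (t : PTerm) : Prop :=
  ∀ p u, Occ t p (.tlam u) →
    ∀ q v, Occ u q v → DependsOn (envAt (envAt E p).liftTy q) v (tlamDepth q) →
      WeaklyWellBracketed (word q)

/-- The declarations `x : !A⋆` for `x : A` in `Γ`, and `y : B⋆` for `y : B` in `Δ`. -/
def starCtx (Γ Δ : Ctx) : Multiset (ℕ × StarTy) :=
  Γ.map (fun p => (p.1, ⟨true, p.2.star⟩)) + Δ.map (fun p => (p.1, ⟨false, p.2.star⟩))

end DLAL

/-! The conditions on a decoration speak of words along paths. They become a syntax-directed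
predicate once every position carries its level, the sum of the word above it. A variable bound at
level `n` may occur only at level `n`, and only as long as the level has not fallen below `n` in
between; a subterm may depend on a type variable only under the second of these restrictions. Hence
a `§̄` leading from level `k + 1` to `k` forgets all term and type variables bound above `k`. This
predicate is `Leveled`, and both directions pass through it.

From a decoration to a derivation. The bang condition forces a bang argument to be a variable, or `§
u` where `u` is closed or contains one free variable below a `§̄` that undoes the outer `§`; this
turns the conditions into a leveling (`Decorated.leveled`). A term leveled at 0 is then derived by
induction on its size (`Leveled.der`). The essential case is `§ t`. There `t` is cut at all places
where the level falls from 1 to 0 (`Leveled.cut`). The pieces cut off use no variable bound between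
the root of `t` and the cut: bracketing says so for term variables, the Λ-scope condition for type
variables. So `t` is `t'[§̄ v₁/x₁, …]` without capture, where `t'` is leveled at 0 and each `xᵢ` is
linear of some type `Cᵢ`, while `vᵢ` has type `§ Cᵢ`. By induction `t'` and all `vᵢ` are derivable;
rule (`§`i) for `t'`, followed by one (`§`e) for each `xᵢ`, derives `§ t`. Binary rules require
disjoint contexts although bang variables may be shared. The statement `Der` therefore leaves the
names of the free variables open: a shared bang variable gets a second name in one premise, and the
two names are contracted afterwards.

From a derivation to a decoration. By induction on the derivation (`Derives.exists_leveled`), (`§`i)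
puts `§` outside and `§̄` at each free variable, (`§`e) is substitution for a linear variable
(`Leveled.subst`), and (`⇒`e) boxes its argument in the same way as (`§`i). Deleting adjacent pairs
`§ §̄` and `§̄ §` keeps the leveling and makes the term regular (`Leveled.exists_reg`), and
`Leveled.conditions` recovers the four conditions from the leveling. -/

namespace DLAL

/-! ### Renaming and substitution of types, and the bijection between DLAL types and linear types -/

@[simp] theorem scons_zero {X : Type} (a : X) (f : ℕ → X) : scons a f 0 = a := rfl

@[simp] theorem scons_succ {X : Type} (a : X) (f : ℕ → X) (n : ℕ) : scons a f (n + 1) = f n := rfl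

@[simp] theorem upRen_zero (r : ℕ → ℕ) : upRen r 0 = 0 := rfl

@[simp] theorem upRen_succ (r : ℕ → ℕ) (n : ℕ) : upRen r (n + 1) = r n + 1 := rfl

theorem comp_scons {X Y : Type} (g : X → Y) (a : X) (f : ℕ → X) :
    (fun n => g (scons a f n)) = scons (g a) (fun n => g (f n)) := by
  funext n; cases n <;> rfl

theorem upRen_comp (r s : ℕ → ℕ) : (fun n => upRen s (upRen r n)) = upRen (fun n => s (r n)) := by
  funext n; cases n <;> rfl

theorem upRen_id : upRen (fun n => n) = fun n => n := by
  funext n; cases n <;> rfl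

namespace LinTy

theorem rename_congr {A : LinTy} {r s : ℕ → ℕ} (h : ∀ j, A.HasFree j → r j = s j) :
    A.rename r = A.rename s := by
  induction A generalizing r s with
  | var n => simp [rename, h n rfl]
  | arrow b A B ihA ihB =>
    simp only [rename, ihA fun j hj => h j (Or.inl hj), ihB fun j hj => h j (Or.inr hj)]
  | par A ih => simp only [rename, ih h]
  | all A ih =>
    simp only [rename]
    rw [ih]
    rintro (_ | j) hj
    · rfl
    · simp [h j hj]

theorem rename_id (A : LinTy) : A.rename (fun n => n) = A := by
  induction A with
  | var n => rfl
  | arrow b A B ihA ihB => simp only [rename, ihA, ihB]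
  | par A ih => simp only [rename, ih]
  | all A ih => simp only [rename, upRen_id, ih]

theorem rename_rename (A : LinTy) (r s : ℕ → ℕ) :
    (A.rename r).rename s = A.rename (fun n => s (r n)) := by
  induction A generalizing r s with
  | var n => rfl
  | arrow b A B ihA ihB => simp only [rename, ihA, ihB]
  | par A ih => simp only [rename, ih]
  | all A ih => simp only [rename, ih, upRen_comp]

theorem shift_rename (A : LinTy) (r : ℕ → ℕ) :
    A.shift.rename (upRen r) = (A.rename r).shift := by
  simp only [shift, rename_rename, upRen_succ]

theorem subst_rename (A : LinTy) (s : ℕ → LinTy) (r : ℕ → ℕ) :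
    (A.subst s).rename r = A.subst (fun n => (s n).rename r) := by
  induction A generalizing r s with
  | var n => rfl
  | arrow b A B ihA ihB => simp only [rename, subst, ihA, ihB]
  | par A ih => simp only [rename, subst, ih]
  | all A ih =>
    simp only [rename, subst, ih, comp_scons (fun B : LinTy => B.rename (upRen r)), shift_rename,
      upRen_zero]

theorem rename_subst (A : LinTy) (r : ℕ → ℕ) (s : ℕ → LinTy) :
    (A.rename r).subst s = A.subst (fun n => s (r n)) := by
  induction A generalizing r s with
  | var n => rfl
  | arrow b A B ihA ihB => simp only [rename, subst, ihA, ihB]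
  | par A ih => simp only [rename, subst, ih]
  | all A ih =>
    simp only [rename, subst, ih]
    congr 2
    funext n; cases n <;> rfl

theorem inst_rename (A B : LinTy) (r : ℕ → ℕ) :
    (A.inst B).rename r = (A.rename (upRen r)).inst (B.rename r) := by
  simp only [inst, subst_rename, rename_subst]
  congr 1
  funext n; cases n <;> rfl

theorem hasFree_rename {A : LinTy} {r : ℕ → ℕ} {j : ℕ} :
    (A.rename r).HasFree j ↔ ∃ i, A.HasFree i ∧ r i = j := by
  induction A generalizing r j with
  | var n => simp [rename, HasFree]
  | arrow b A B ihA ihB =>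
    simp only [rename, HasFree, ihA, ihB]
    constructor
    · rintro (⟨i, h, e⟩ | ⟨i, h, e⟩)
      exacts [⟨i, Or.inl h, e⟩, ⟨i, Or.inr h, e⟩]
    · rintro ⟨i, h | h, e⟩
      exacts [Or.inl ⟨i, h, e⟩, Or.inr ⟨i, h, e⟩]
  | par A ih => exact ih
  | all A ih =>
    simp only [rename, HasFree, ih]
    constructor
    · rintro ⟨_ | i, h, e⟩
      · simp at e
      · exact ⟨i, h, by simpa using e⟩
    · rintro ⟨i, h, e⟩
      exact ⟨i + 1, h, by simp [e]⟩

theorem hasFree_shift {A : LinTy} {j : ℕ} : A.shift.HasFree (j + 1) ↔ A.HasFree j := by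
  simp [shift, hasFree_rename]

theorem HasFree.of_subst {A : LinTy} {s : ℕ → LinTy} {j : ℕ} (h : (A.subst s).HasFree j) :
    ∃ i, A.HasFree i ∧ (s i).HasFree j := by
  induction A generalizing s j with
  | var n => exact ⟨n, rfl, h⟩
  | arrow b A B ihA ihB =>
    rcases h with h | h
    · obtain ⟨i, h1, h2⟩ := ihA h
      exact ⟨i, Or.inl h1, h2⟩
    · obtain ⟨i, h1, h2⟩ := ihB h
      exact ⟨i, Or.inr h1, h2⟩
  | par A ih => exact ih h
  | all A ih =>
    obtain ⟨_ | i, h1, h2⟩ := ih (show (A.subst _).HasFree (j + 1) from h)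
    · simp [HasFree] at h2
    · exact ⟨i, h1, hasFree_shift.1 h2⟩

theorem erase_rename (A : LinTy) (r : ℕ → ℕ) : (A.rename r).erase = A.erase.rename r := by
  induction A generalizing r with
  | var n => rfl
  | arrow b A B ihA ihB => simp only [rename, erase, FType.rename, ihA, ihB]
  | par A ih => simp only [rename, erase, ih]
  | all A ih => simp only [rename, erase, FType.rename, ih]

/-- The inverse of `DType.star`. -/
def unstar : LinTy → DType
  | var n => .var n
  | arrow false A B => .lolli A.unstar B.unstar
  | arrow true A B => .impl A.unstar B.unstar
  | par A => .par A.unstar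
  | all A => .all A.unstar

@[simp] theorem star_unstar (A : LinTy) : A.unstar.star = A := by
  induction A with
  | var n => rfl
  | arrow b A B ihA ihB => cases b <;> simp [unstar, DType.star, ihA, ihB]
  | par A ih => simp [unstar, DType.star, ih]
  | all A ih => simp [unstar, DType.star, ih]

end LinTy

namespace DType

@[simp] theorem unstar_star (A : DType) : A.star.unstar = A := by
  induction A with
  | var n => rfl
  | lolli A B ihA ihB => simp [LinTy.unstar, star, ihA, ihB]
  | impl A B ihA ihB => simp [LinTy.unstar, star, ihA, ihB]
  | par A ih => simp [LinTy.unstar, star, ih]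
  | all A ih => simp [LinTy.unstar, star, ih]

@[simp] theorem erase_star (A : DType) : A.star.erase = A.erase := by
  induction A with
  | var n => rfl
  | lolli A B ihA ihB => simp [LinTy.erase, erase, star, ihA, ihB]
  | impl A B ihA ihB => simp [LinTy.erase, erase, star, ihA, ihB]
  | par A ih => simp [LinTy.erase, erase, star, ih]
  | all A ih => simp [LinTy.erase, erase, star, ih]

theorem star_rename (A : DType) (r : ℕ → ℕ) : (A.rename r).star = A.star.rename r := by
  induction A generalizing r with
  | var n => rfl
  | lolli A B ihA ihB => simp [rename, LinTy.rename, star, ihA, ihB]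
  | impl A B ihA ihB => simp [rename, LinTy.rename, star, ihA, ihB]
  | par A ih => simp [rename, LinTy.rename, star, ih]
  | all A ih => simp [rename, LinTy.rename, star, ih]

theorem star_shift (A : DType) : A.shift.star = A.star.shift := star_rename A _

theorem star_subst (A : DType) (s : ℕ → DType) :
    (A.subst s).star = A.star.subst (fun n => (s n).star) := by
  induction A generalizing s with
  | var n => rfl
  | lolli A B ihA ihB => simp [subst, LinTy.subst, star, ihA, ihB]
  | impl A B ihA ihB => simp [subst, LinTy.subst, star, ihA, ihB]
  | par A ih => simp [subst, LinTy.subst, star, ih]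
  | all A ih => simp [subst, LinTy.subst, star, ih, comp_scons star, star_shift]

theorem star_inst (A B : DType) : (A.inst B).star = A.star.inst B.star := by
  simp only [inst, LinTy.inst, star_subst, comp_scons star]
  rfl

end DType

theorem LinTy.unstar_inst (A B : LinTy) : (A.inst B).unstar = A.unstar.inst B.unstar := by
  rw [← DType.unstar_star (A.unstar.inst B.unstar), DType.star_inst, star_unstar, star_unstar]

theorem LinTy.erase_unstar (A : LinTy) : A.unstar.erase = A.erase := by
  rw [← DType.erase_star, star_unstar]

theorem LinTy.unstar_shift (A : LinTy) : A.shift.unstar = A.unstar.shift := by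
  rw [← DType.unstar_star A.unstar.shift, DType.star_shift, star_unstar]

namespace StarTy

def rename (r : ℕ → ℕ) (D : StarTy) : StarTy := ⟨D.bang, D.ty.rename r⟩

theorem shift_rename (D : StarTy) (r : ℕ → ℕ) :
    D.shift.rename (upRen r) = (D.rename r).shift := by
  simp only [shift, rename, LinTy.shift_rename]

theorem out_rename (D : StarTy) (r : ℕ → ℕ) : (D.rename r).out = D.out.rename r := by
  rcases D with ⟨_ | _, A⟩ <;> rfl

theorem rename_rename (D : StarTy) (r s : ℕ → ℕ) :
    (D.rename r).rename s = D.rename (fun n => s (r n)) := by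
  simp only [rename, LinTy.rename_rename]

theorem rename_id (D : StarTy) : D.rename (fun n => n) = D := by
  simp only [rename, LinTy.rename_id]

theorem hasFree_out {D : StarTy} {j : ℕ} : D.out.HasFree j ↔ D.ty.HasFree j := by
  rcases D with ⟨_ | _, A⟩ <;> rfl

end StarTy

/-! ### Pseudo-terms: substitution, number of occurrences, size -/

namespace PTerm

def rename (r : ℕ → ℕ) : PTerm → PTerm
  | var x => var (r x)
  | lam D t => lam D (rename (upRen r) t)
  | app t u => app (rename r t) (rename r u)
  | tlam t => tlam (rename r t)
  | tapp t A => tapp (rename r t) A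
  | par t => par (rename r t)
  | dpar t => dpar (rename r t)

def renameTy (r : ℕ → ℕ) : PTerm → PTerm
  | var x => var x
  | lam D t => lam (D.rename r) (renameTy r t)
  | app t u => app (renameTy r t) (renameTy r u)
  | tlam t => tlam (renameTy (upRen r) t)
  | tapp t A => tapp (renameTy r t) (A.rename r)
  | par t => par (renameTy r t)
  | dpar t => dpar (renameTy r t)

/-- Simultaneous capture-avoiding substitution for the free term variables. -/
def subst (s : ℕ → PTerm) : PTerm → PTerm
  | var x => s x
  | lam D t => lam D (subst (scons (var 0) (fun n => (s n).rename Nat.succ)) t)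
  | app t u => app (subst s t) (subst s u)
  | tlam t => tlam (subst (fun n => (s n).renameTy Nat.succ) t)
  | tapp t A => tapp (subst s t) A
  | par t => par (subst s t)
  | dpar t => dpar (subst s t)

/-- The number of occurrences of the free variable `x`. -/
def count : PTerm → ℕ → ℕ
  | var y, x => if y = x then 1 else 0
  | lam _ t, x => count t (x + 1)
  | app t u, x => count t x + count u x
  | tlam t, x => count t x
  | tapp t _, x => count t x
  | par t, x => count t x
  | dpar t, x => count t x

def size : PTerm → ℕ
  | var _ => 1
  | lam _ t => size t + 1
  | app t u => size t + size u + 1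
  | tlam t => size t + 1
  | tapp t _ => size t + 1
  | par t => size t + 1
  | dpar t => size t + 1

theorem rename_congr {t : PTerm} {r s : ℕ → ℕ} (h : ∀ x, 0 < t.count x → r x = s x) :
    t.rename r = t.rename s := by
  induction t generalizing r s with
  | var x => simp [rename, h x (by simp [count])]
  | lam D t ih =>
    simp only [rename]
    rw [ih]
    rintro (_ | x) hx
    · rfl
    · simp [h x hx]
  | app t u iht ihu =>
    simp only [rename]
    rw [iht fun x hx => h x (by simp only [count]; omega),
      ihu fun x hx => h x (by simp only [count]; omega)]
  | tlam t ih => simp only [rename, ih h]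
  | tapp t A ih => simp only [rename, ih h]
  | par t ih => simp only [rename, ih h]
  | dpar t ih => simp only [rename, ih h]

theorem rename_id (t : PTerm) : t.rename (fun n => n) = t := by
  induction t with
  | var x => rfl
  | lam D t ih => simp only [rename, upRen_id, ih]
  | app t u iht ihu => simp only [rename, iht, ihu]
  | tlam t ih => simp only [rename, ih]
  | tapp t A ih => simp only [rename, ih]
  | par t ih => simp only [rename, ih]
  | dpar t ih => simp only [rename, ih]

theorem rename_rename (t : PTerm) (r s : ℕ → ℕ) :
    (t.rename r).rename s = t.rename (fun n => s (r n)) := by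
  induction t generalizing r s with
  | var x => rfl
  | lam D t ih => simp only [rename, ih, upRen_comp]
  | app t u iht ihu => simp only [rename, iht, ihu]
  | tlam t ih => simp only [rename, ih]
  | tapp t A ih => simp only [rename, ih]
  | par t ih => simp only [rename, ih]
  | dpar t ih => simp only [rename, ih]

theorem renameTy_renameTy (t : PTerm) (r s : ℕ → ℕ) :
    (t.renameTy r).renameTy s = t.renameTy (fun n => s (r n)) := by
  induction t generalizing r s with
  | var x => rfl
  | lam D t ih => simp only [renameTy, ih, StarTy.rename_rename]
  | app t u iht ihu => simp only [renameTy, iht, ihu]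
  | tlam t ih => simp only [renameTy, ih, upRen_comp]
  | tapp t A ih => simp only [renameTy, ih, LinTy.rename_rename]
  | par t ih => simp only [renameTy, ih]
  | dpar t ih => simp only [renameTy, ih]

theorem renameTy_id (t : PTerm) : t.renameTy (fun n => n) = t := by
  induction t with
  | var x => rfl
  | lam D t ih => simp only [renameTy, ih, StarTy.rename_id]
  | app t u iht ihu => simp only [renameTy, iht, ihu]
  | tlam t ih => simp only [renameTy, upRen_id, ih]
  | tapp t A ih => simp only [renameTy, ih, LinTy.rename_id]
  | par t ih => simp only [renameTy, ih]
  | dpar t ih => simp only [renameTy, ih]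

theorem rename_renameTy (t : PTerm) (r s : ℕ → ℕ) :
    (t.rename r).renameTy s = (t.renameTy s).rename r := by
  induction t generalizing r s with
  | var x => rfl
  | lam D t ih => simp only [rename, renameTy, ih]
  | app t u iht ihu => simp only [rename, renameTy, iht, ihu]
  | tlam t ih => simp only [rename, renameTy, ih]
  | tapp t A ih => simp only [rename, renameTy, ih]
  | par t ih => simp only [rename, renameTy, ih]
  | dpar t ih => simp only [rename, renameTy, ih]

theorem subst_congr {t : PTerm} {r s : ℕ → PTerm} (h : ∀ x, 0 < t.count x → r x = s x) :
    t.subst r = t.subst s := by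
  induction t generalizing r s with
  | var x => exact h x (by simp [count])
  | lam D t ih =>
    simp only [subst]
    rw [ih]
    rintro (_ | x) hx
    · rfl
    · simp [h x hx]
  | app t u iht ihu =>
    simp only [subst]
    rw [iht fun x hx => h x (by simp only [count]; omega),
      ihu fun x hx => h x (by simp only [count]; omega)]
  | tlam t ih =>
    simp only [subst]
    rw [ih]
    intro x hx
    rw [h x hx]
  | tapp t A ih => simp only [subst, ih h]
  | par t ih => simp only [subst, ih h]
  | dpar t ih => simp only [subst, ih h]

theorem rename_subst (t : PTerm) (r : ℕ → ℕ) (s : ℕ → PTerm) :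
    (t.rename r).subst s = t.subst (fun n => s (r n)) := by
  induction t generalizing r s with
  | var x => rfl
  | lam D t ih =>
    simp only [rename, subst, ih]
    congr 2
    funext n; cases n <;> rfl
  | app t u iht ihu => simp only [rename, subst, iht, ihu]
  | tlam t ih => simp only [rename, subst, ih]
  | tapp t A ih => simp only [rename, subst, ih]
  | par t ih => simp only [rename, subst, ih]
  | dpar t ih => simp only [rename, subst, ih]

theorem subst_rename (t : PTerm) (s : ℕ → PTerm) (r : ℕ → ℕ) :
    (t.subst s).rename r = t.subst (fun n => (s n).rename r) := by
  induction t generalizing r s with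
  | var x => rfl
  | lam D t ih =>
    simp only [rename, subst, ih, comp_scons (fun u : PTerm => u.rename (upRen r)), upRen_zero,
      rename_rename, upRen_succ]
  | app t u iht ihu => simp only [rename, subst, iht, ihu]
  | tlam t ih => simp only [rename, subst, ih, rename_renameTy]
  | tapp t A ih => simp only [rename, subst, ih]
  | par t ih => simp only [rename, subst, ih]
  | dpar t ih => simp only [rename, subst, ih]

theorem subst_renameTy (t : PTerm) (s : ℕ → PTerm) (r : ℕ → ℕ) :
    (t.subst s).renameTy r = (t.renameTy r).subst (fun n => (s n).renameTy r) := by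
  induction t generalizing r s with
  | var x => rfl
  | lam D t ih =>
    simp only [renameTy, subst, ih, comp_scons (fun u : PTerm => u.renameTy r), rename_renameTy]
  | app t u iht ihu => simp only [renameTy, subst, iht, ihu]
  | tlam t ih => simp only [renameTy, subst, ih, renameTy_renameTy, upRen_succ]
  | tapp t A ih => simp only [renameTy, subst, ih]
  | par t ih => simp only [renameTy, subst, ih]
  | dpar t ih => simp only [renameTy, subst, ih]

theorem subst_subst (t : PTerm) (s u : ℕ → PTerm) :
    (t.subst s).subst u = t.subst (fun n => (s n).subst u) := by
  induction t generalizing s u with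
  | var x => rfl
  | lam D t ih =>
    simp only [subst, ih,
      comp_scons (fun v : PTerm => v.subst (scons (var 0) fun n => (u n).rename Nat.succ)),
      rename_subst, subst_rename, scons_zero, Nat.succ_eq_add_one, scons_succ]
  | app t u iht ihu => simp only [subst, iht, ihu]
  | tlam t ih => simp only [subst, ih, subst_renameTy]
  | tapp t A ih => simp only [subst, ih]
  | par t ih => simp only [subst, ih]
  | dpar t ih => simp only [subst, ih]

theorem subst_var (t : PTerm) (r : ℕ → ℕ) : t.subst (fun n => var (r n)) = t.rename r := by
  induction t generalizing r with
  | var x => rfl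
  | lam D t ih =>
    simp only [subst, rename, ← ih]
    congr 2
    funext n; cases n <;> rfl
  | app t u iht ihu => simp only [subst, rename, iht, ihu]
  | tlam t ih => simp only [subst, rename, renameTy, ih]
  | tapp t A ih => simp only [subst, rename, ih]
  | par t ih => simp only [subst, rename, ih]
  | dpar t ih => simp only [subst, rename, ih]

theorem erase_rename (t : PTerm) (r : ℕ → ℕ) : (t.rename r).erase = t.erase.rename r := by
  induction t generalizing r with
  | var x => rfl
  | lam D t ih => simp only [rename, erase, FTerm.rename, ih]
  | app t u iht ihu => simp only [rename, erase, FTerm.rename, iht, ihu]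
  | tlam t ih => simp only [rename, erase, FTerm.rename, ih]
  | tapp t A ih => simp only [rename, erase, FTerm.rename, ih]
  | par t ih => simp only [rename, erase, ih]
  | dpar t ih => simp only [rename, erase, ih]

theorem erase_renameTy (t : PTerm) (r : ℕ → ℕ) : (t.renameTy r).erase = t.erase.renameTy r := by
  induction t generalizing r with
  | var x => rfl
  | lam D t ih =>
    simp only [renameTy, erase, FTerm.renameTy, ih, StarTy.erase, StarTy.rename,
      LinTy.erase_rename]
  | app t u iht ihu => simp only [renameTy, erase, FTerm.renameTy, iht, ihu]
  | tlam t ih => simp only [renameTy, erase, FTerm.renameTy, ih]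
  | tapp t A ih => simp only [renameTy, erase, FTerm.renameTy, ih, LinTy.erase_rename]
  | par t ih => simp only [renameTy, erase, ih]
  | dpar t ih => simp only [renameTy, erase, ih]

theorem erase_subst (t : PTerm) (s : ℕ → PTerm) :
    (t.subst s).erase = t.erase.subst (fun n => (s n).erase) := by
  induction t generalizing s with
  | var x => rfl
  | lam D t ih =>
    simp only [subst, erase, FTerm.subst, ih, comp_scons erase, erase_rename]
  | app t u iht ihu => simp only [subst, erase, FTerm.subst, iht, ihu]
  | tlam t ih => simp only [subst, erase, FTerm.subst, ih, erase_renameTy]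
  | tapp t A ih => simp only [subst, erase, FTerm.subst, ih]
  | par t ih => simp only [subst, erase, ih]
  | dpar t ih => simp only [subst, erase, ih]

theorem count_var_pos {x y : ℕ} : 0 < (var y).count x ↔ y = x := by
  simp only [count]; split_ifs <;> simp_all

@[simp] theorem count_renameTy (t : PTerm) (r : ℕ → ℕ) (x : ℕ) :
    (t.renameTy r).count x = t.count x := by
  induction t generalizing r x <;> simp_all [renameTy, count]

theorem count_rename {t : PTerm} {r : ℕ → ℕ} {x y : ℕ}
    (h : ∀ z, 0 < t.count z → (r z = x ↔ z = y)) : (t.rename r).count x = t.count y := by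
  induction t generalizing r x y with
  | var z =>
    have := h z (by simp [count])
    simp only [rename, count, this]
  | lam D t ih =>
    refine ih ?_
    rintro (_ | z) hz
    · simp
    · simpa using h z hz
  | app t u iht ihu =>
    simp only [rename, count]
    rw [iht fun x hx => h x (by simp only [count]; omega),
      ihu fun x hx => h x (by simp only [count]; omega)]
  | tlam t ih => exact ih h
  | tapp t A ih => exact ih h
  | par t ih => exact ih h
  | dpar t ih => exact ih h

@[simp] theorem count_rename_succ (t : PTerm) (x : ℕ) :
    (t.rename Nat.succ).count (x + 1) = t.count x :=
  count_rename fun z _ => by simp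

theorem count_rename_pos {t : PTerm} {r : ℕ → ℕ} {x : ℕ} :
    0 < (t.rename r).count x ↔ ∃ z, 0 < t.count z ∧ r z = x := by
  induction t generalizing r x with
  | var z => simp [rename, count_var_pos]
  | lam D t ih =>
    refine (ih (r := upRen r) (x := x + 1)).trans ⟨?_, ?_⟩
    · rintro ⟨_ | z, hz, e⟩
      · simp at e
      · exact ⟨z, hz, by simpa using e⟩
    · rintro ⟨z, hz, e⟩
      exact ⟨z + 1, hz, by simp [e]⟩
  | app t u iht ihu =>
    simp only [rename, count, Nat.add_pos_iff_pos_or_pos, iht, ihu]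
    constructor
    · rintro (⟨i, h, e⟩ | ⟨i, h, e⟩)
      exacts [⟨i, Or.inl h, e⟩, ⟨i, Or.inr h, e⟩]
    · rintro ⟨i, h | h, e⟩
      exacts [Or.inl ⟨i, h, e⟩, Or.inr ⟨i, h, e⟩]
  | tlam t ih => exact ih
  | tapp t A ih => exact ih
  | par t ih => exact ih
  | dpar t ih => exact ih

theorem count_rename_eq_zero {t : PTerm} {r : ℕ → ℕ} {x : ℕ}
    (h : ∀ z, 0 < t.count z → r z ≠ x) : (t.rename r).count x = 0 := by
  by_contra hc
  obtain ⟨z, hz, e⟩ := count_rename_pos.1 (Nat.pos_of_ne_zero hc)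
  exact h z hz e

@[simp] theorem count_rename_succ_zero (t : PTerm) : (t.rename Nat.succ).count 0 = 0 :=
  count_rename_eq_zero fun z _ => by simp

/-- Two sources are what a cut `t[u/p]` requires: a variable can come from `t` itself, with weight
1, and from the copies of `u` put in place of `p`, with weight its number of occurrences in `u`. -/
theorem count_subst_two {t : PTerm} {s : ℕ → PTerm} {x p q a b : ℕ}
    (h : ∀ z, 0 < t.count z →
      (s z).count x = (if z = p then a else 0) + (if z = q then b else 0)) :
    (t.subst s).count x = t.count p * a + t.count q * b := by
  induction t generalizing s x p q with
  | var z =>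
    have := h z (by simp [count])
    simp only [subst, count, this]
    split_ifs <;> simp
  | lam D t ih =>
    refine ih ?_
    rintro (_ | z) hz
    · simp [count]
    · simpa using h z hz
  | app t u iht ihu =>
    simp only [subst, count]
    rw [iht fun x hx => h x (by simp only [count]; omega),
      ihu fun x hx => h x (by simp only [count]; omega)]
    ring
  | tlam t ih =>
    refine ih ?_
    intro z hz
    simpa using h z hz
  | tapp t A ih => exact ih h
  | par t ih => exact ih h
  | dpar t ih => exact ih h

theorem count_subst {t : PTerm} {s : ℕ → PTerm} {x p : ℕ}
    (h : ∀ z, 0 < t.count z → (s z).count x = if z = p then 1 else 0) :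
    (t.subst s).count x = t.count p := by
  rw [count_subst_two (p := p) (q := p) (a := 1) (b := 0)] <;> simp
  exact h

theorem count_subst_pos {t : PTerm} {s : ℕ → PTerm} {x : ℕ} :
    0 < (t.subst s).count x ↔ ∃ z, 0 < t.count z ∧ 0 < (s z).count x := by
  induction t generalizing s x with
  | var z => simp [subst, count_var_pos]
  | lam D t ih =>
    refine (ih (x := x + 1)).trans ⟨?_, ?_⟩
    · rintro ⟨_ | z, hz, e⟩
      · simp [count] at e
      · exact ⟨z, hz, by simpa using e⟩
    · rintro ⟨z, hz, e⟩
      exact ⟨z + 1, hz, by simpa using e⟩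
  | app t u iht ihu =>
    simp only [subst, count, Nat.add_pos_iff_pos_or_pos, iht, ihu]
    constructor
    · rintro (⟨i, h, e⟩ | ⟨i, h, e⟩)
      exacts [⟨i, Or.inl h, e⟩, ⟨i, Or.inr h, e⟩]
    · rintro ⟨i, h | h, e⟩
      exacts [Or.inl ⟨i, h, e⟩, Or.inr ⟨i, h, e⟩]
  | tlam t ih => exact (ih (x := x)).trans (by simp [count])
  | tapp t A ih => exact ih
  | par t ih => exact ih
  | dpar t ih => exact ih

/-- Carries linearity from a full substitution to a partial one, when the holes of a box are filled
one after the other. -/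
theorem count_subst_mono {t : PTerm} {s u : ℕ → PTerm} {x y : ℕ}
    (h : ∀ z, (s z).count x ≤ (u z).count y) : (t.subst s).count x ≤ (t.subst u).count y := by
  induction t generalizing s u x y with
  | var z => exact h z
  | lam D t ih =>
    refine ih ?_
    rintro (_ | z)
    · simp [count]
    · simpa using h z
  | app t u iht ihu => exact Nat.add_le_add (iht h) (ihu h)
  | tlam t ih => exact ih fun z => by simpa using h z
  | tapp t A ih => exact ih h
  | par t ih => exact ih h
  | dpar t ih => exact ih h

theorem count_le_count_subst {t : PTerm} {s : ℕ → PTerm} {x y : ℕ} (h : 0 < t.count y) :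
    (s y).count x ≤ (t.subst s).count x := by
  induction t generalizing s x y with
  | var z => rw [count_var_pos.1 h]; rfl
  | lam D t ih =>
    have := ih (s := scons (var 0) fun n => (s n).rename Nat.succ) (x := x + 1) h
    rwa [scons_succ, count_rename_succ] at this
  | app t u iht ihu =>
    simp only [subst, count]
    rcases Nat.add_pos_iff_pos_or_pos.1 h with h | h
    exacts [(iht h).trans (Nat.le_add_right _ _), (ihu h).trans (Nat.le_add_left _ _)]
  | tlam t ih =>
    have := ih (s := fun n => (s n).renameTy Nat.succ) (x := x) h
    rwa [count_renameTy] at this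
  | tapp t A ih => exact ih h
  | par t ih => exact ih h
  | dpar t ih => exact ih h

theorem exists_finset_count_pos (t : PTerm) : ∃ R : Finset ℕ, ∀ x, x ∈ R ↔ 0 < t.count x := by
  induction t with
  | var y => exact ⟨{y}, fun x => by simp [count_var_pos, eq_comm]⟩
  | lam D t ih =>
    obtain ⟨R, hR⟩ := ih
    refine ⟨(R.filter (0 < ·)).image Nat.pred, fun x => ?_⟩
    simp only [Finset.mem_image, Finset.mem_filter, hR, count]
    constructor
    · rintro ⟨_ | y, ⟨h1, h2⟩, rfl⟩
      · exact absurd h2 (lt_irrefl 0)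
      · exact h1
    · exact fun h => ⟨x + 1, ⟨h, Nat.succ_pos x⟩, rfl⟩
  | app t u iht ihu =>
    obtain ⟨R, hR⟩ := iht
    obtain ⟨R', hR'⟩ := ihu
    exact ⟨R ∪ R', fun x => by simp [hR, hR', count]⟩
  | tlam t ih => exact ih
  | tapp t A ih => exact ih
  | par t ih => exact ih
  | dpar t ih => exact ih

@[simp] theorem count_rename_upRen_zero (t : PTerm) (r : ℕ → ℕ) :
    (t.rename (upRen r)).count 0 = t.count 0 :=
  count_rename fun z _ => by cases z <;> simp

theorem count_subst_lift_zero (t : PTerm) (s : ℕ → PTerm) :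
    (t.subst (scons (var 0) fun n => (s n).rename Nat.succ)).count 0 = t.count 0 :=
  count_subst fun z _ => by cases z <;> simp [count]

@[simp] theorem size_rename (t : PTerm) (r : ℕ → ℕ) : (t.rename r).size = t.size := by
  induction t generalizing r <;> simp_all [rename, size]

@[simp] theorem size_renameTy (t : PTerm) (r : ℕ → ℕ) : (t.renameTy r).size = t.size := by
  induction t generalizing r <;> simp_all [renameTy, size]

theorem size_pos (t : PTerm) : 0 < t.size := by
  cases t <;> simp [size]

/-- Cutting writes a term as `t'[s]`. This bound and `size_le_size_subst_of_count` make `t'` and the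
pieces `s y` accessible to induction on the size, although `t'` is not a subterm. -/
theorem size_le_size_subst (t : PTerm) (s : ℕ → PTerm) : t.size ≤ (t.subst s).size := by
  induction t generalizing s with
  | var z => exact size_pos _
  | app t u iht ihu =>
    have := iht s
    have := ihu s
    simp only [size, subst]; omega
  | _ => simp_all [size, subst]

theorem size_le_size_subst_of_count {t : PTerm} {s : ℕ → PTerm} {x : ℕ} (h : 0 < t.count x) :
    (s x).size ≤ (t.subst s).size := by
  induction t generalizing s x with
  | var z => rw [count_var_pos.1 h]; rfl
  | lam D t ih =>
    have := ih (s := scons (var 0) fun n => (s n).rename Nat.succ) (x := x + 1) h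
    simp only [scons_succ, size_rename] at this
    simp only [size, subst]; omega
  | app t u iht ihu =>
    simp only [count, Nat.add_pos_iff_pos_or_pos] at h
    simp only [size, subst]
    rcases h with h | h
    · have := iht (s := s) h
      omega
    · have := ihu (s := s) h
      omega
  | tlam t ih =>
    have := ih (s := fun n => (s n).renameTy Nat.succ) (x := x) h
    simp only [size_renameTy] at this
    simp only [size, subst]; omega
  | tapp t A ih => exact (ih h).trans (Nat.le_succ _)
  | par t ih => exact (ih h).trans (Nat.le_succ _)
  | dpar t ih => exact (ih h).trans (Nat.le_succ _)

end PTerm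

/-! ### Levels and leveled pseudo-terms -/

/-- The variables of level at most `k`; a level is forgotten by replacing it with `none`. -/
def kill (k : ℕ) (l : ℕ → Option ℕ) : ℕ → Option ℕ := fun x => (l x).filter (fun n => n ≤ k)

/-- Every variable with a level gets the level `0`. -/
def resetLevels (l : ℕ → Option ℕ) : ℕ → Option ℕ := fun x => (l x).map (fun _ => 0)

theorem kill_eq_some {k : ℕ} {l : ℕ → Option ℕ} {x n : ℕ} :
    kill k l x = some n ↔ l x = some n ∧ n ≤ k := by
  simp [kill, Option.filter_eq_some_iff]

theorem resetLevels_eq_some {l : ℕ → Option ℕ} {x n : ℕ} :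
    resetLevels l x = some n ↔ n = 0 ∧ ∃ m, l x = some m := by
  simp only [resetLevels, Option.map_eq_some_iff]
  constructor
  · rintro ⟨m, h, rfl⟩
    exact ⟨rfl, m, h⟩
  · rintro ⟨rfl, m, h⟩
    exact ⟨m, h, rfl⟩

theorem kill_kill {k n : ℕ} (h : k ≤ n) (l : ℕ → Option ℕ) : kill k (kill n l) = kill k l := by
  funext x
  refine Option.ext fun m => ?_
  simp only [kill_eq_some]
  constructor
  · rintro ⟨⟨h1, _⟩, h2⟩
    exact ⟨h1, h2⟩
  · rintro ⟨h1, h2⟩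
    exact ⟨⟨h1, h2.trans h⟩, h2⟩

/-- Every free type variable of `A` has a level. -/
def Scoped (rho : ℕ → Option ℕ) (A : LinTy) : Prop := ∀ j, A.HasFree j → ∃ n, rho j = some n

theorem Scoped.mono {rho rho' : ℕ → Option ℕ} {A : LinTy} (h : Scoped rho A)
    (hr : ∀ j n, rho j = some n → ∃ m, rho' j = some m) : Scoped rho' A := fun j hj =>
  let ⟨n, hn⟩ := h j hj
  hr j n hn

theorem Scoped.rename {rho rho' : ℕ → Option ℕ} {A : LinTy} {r : ℕ → ℕ} (h : Scoped rho A)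
    (hr : ∀ j n, rho j = some n → ∃ m, rho' (r j) = some m) : Scoped rho' (A.rename r) := by
  intro j hj
  obtain ⟨i, hi, rfl⟩ := LinTy.hasFree_rename.1 hj
  obtain ⟨n, hn⟩ := h i hi
  exact hr i n hn

theorem Scoped.of_kill {rho : ℕ → Option ℕ} {k : ℕ} {A : LinTy} (h : Scoped (kill k rho) A) :
    Scoped rho A :=
  h.mono fun _ n hn => ⟨n, (kill_eq_some.1 hn).1⟩

theorem Scoped.out {rho : ℕ → Option ℕ} {D : StarTy} (h : Scoped rho D.ty) : Scoped rho D.out :=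
  fun j hj => h j (StarTy.hasFree_out.1 hj)

theorem Scoped.inst {rho : ℕ → Option ℕ} {A B : LinTy} (hA : Scoped rho A.all)
    (hB : Scoped rho B) : Scoped rho (A.inst B) := by
  intro j hj
  obtain ⟨_ | i, hi, h⟩ := LinTy.HasFree.of_subst hj
  · exact hB j h
  · have : i = j := h
    exact this ▸ hA i hi

/-- `Leveled E l rho k t A`: the pseudo-term `t` has type `A` and stands below a path whose word has
sum `k`.  The word from the binder of a variable to each of its occurrences must be well-bracketed:
`l x` is the sum at the binder of the term variable `x`, or `none` if `x` may not occur any more.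
In the same way `rho j` is the sum at the binder of the type variable `j`, or `none` if no subterm
may depend on it any more. -/
inductive Leveled : Env → (ℕ → Option ℕ) → (ℕ → Option ℕ) → ℕ → PTerm → LinTy → Prop
  | var {E : Env} {l rho : ℕ → Option ℕ} {k x : ℕ} :
      l x = some k → Scoped rho (E x).ty → Leveled E l rho k (.var x) (E x).out
  | lam {E : Env} {l rho : ℕ → Option ℕ} {k : ℕ} {D : StarTy} {t : PTerm} {B : LinTy} :
      Scoped rho D.ty → (D.bang = false → t.count 0 ≤ 1) →
      Leveled (scons D E) (scons (some k) l) rho k t B → Leveled E l rho k (.lam D t) (D.lolli B)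
  | app {E : Env} {l rho : ℕ → Option ℕ} {k : ℕ} {t u : PTerm} {A B : LinTy} :
      Leveled E l rho k t (.arrow false A B) → Leveled E l rho k u A →
      Leveled E l rho k (.app t u) B
  | appVar {E : Env} {l rho : ℕ → Option ℕ} {k x : ℕ} {t : PTerm} {A B : LinTy} :
      Leveled E l rho k t (.arrow true A B) → E x = ⟨true, A⟩ →
      Leveled E l rho k (.var x) A.par → Leveled E l rho k (.app t (.var x)) B
  -- A boxed argument is a body `w` over one linear variable, put under `§` with a `§̄` at that
  -- variable. The body is leveled on its own, from level 0 and with all type levels reset to 0: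
  -- this is the form in which the argument of (`⇒`e) has to be derived. The last argument premise
  -- levels the box in place, so that inductions can treat it like any other subterm.
  | appBox {E : Env} {l rho : ℕ → Option ℕ} {k x : ℕ} {t w : PTerm} {A B C : LinTy} :
      Leveled E l rho k t (.arrow true A B) → (∀ y, 0 < w.count y → y = 0) → w.count 0 ≤ 1 →
      (0 < w.count 0 → l x = some k ∧ E x = ⟨true, C⟩) →
      Leveled (fun _ => ⟨false, C⟩) (fun _ => some 0) (resetLevels rho) 0 w A →
      Leveled E l rho k (.par (w.subst fun _ => .dpar (.var x))) A.par →
      Leveled E l rho k (.app t (.par (w.subst fun _ => .dpar (.var x)))) B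
  | tlam {E : Env} {l rho : ℕ → Option ℕ} {k : ℕ} {t : PTerm} {A : LinTy} :
      Leveled E.liftTy l (scons (some k) rho) k t A → Leveled E l rho k (.tlam t) A.all
  | tapp {E : Env} {l rho : ℕ → Option ℕ} {k : ℕ} {t : PTerm} {A B : LinTy} :
      Leveled E l rho k t A.all → Scoped rho B → Leveled E l rho k (.tapp t B) (A.inst B)
  | par {E : Env} {l rho : ℕ → Option ℕ} {k : ℕ} {t : PTerm} {A : LinTy} :
      Leveled E l rho (k + 1) t A → Leveled E l rho k (.par t) A.par
  -- A variable bound above `k` is forgotten for good: even if the level rises again, the word from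
  -- its binder has had a prefix of negative sum.
  | dpar {E : Env} {l rho : ℕ → Option ℕ} {k : ℕ} {t : PTerm} {A : LinTy} :
      Leveled E (kill k l) (kill k rho) k t A.par → Leveled E l rho (k + 1) (.dpar t) A

namespace Leveled

variable {E : Env} {l rho : ℕ → Option ℕ} {k : ℕ} {t : PTerm} {A : LinTy}

theorem outTy (h : Leveled E l rho k t A) : OutTy E t A := by
  induction h with
  | var h hs => exact .var _ _
  | lam hs hc h ih => exact .lam ih
  | app h1 h2 ih1 ih2 => exact .app (D := ⟨false, _⟩) ih1 ih2
  | appVar h1 he h2 ih1 ih2 => exact .app (D := ⟨true, _⟩) ih1 ih2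
  | appBox h1 h2 h3 h4 h5 h6 ih1 ih5 ih6 => exact .app (D := ⟨true, _⟩) ih1 ih6
  | tlam h ih => exact .tlam ih
  | tapp h hs ih => exact .tapp _ ih
  | par h ih => exact .par ih
  | dpar h ih => exact .dpar ih

/-- Applied below a `§̄`, where levels have been forgotten, this shows that a piece cut off inside a
`Λ` has a type independent of the bound variable. -/
theorem scoped_type (h : Leveled E l rho k t A) : Scoped rho A := by
  induction h with
  | var h hs => exact hs.out
  | lam hs hc h ih =>
    intro j hj
    rcases hj with hj | hj
    exacts [hs j hj, ih j hj]
  | app h1 h2 ih1 ih2 => exact fun j hj => ih1 j (Or.inr hj)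
  | appVar h1 he h2 ih1 ih2 => exact fun j hj => ih1 j (Or.inr hj)
  | appBox h1 h2 h3 h4 h5 h6 ih1 ih5 ih6 => exact fun j hj => ih1 j (Or.inr hj)
  | tlam h ih => exact fun j hj => ih (j + 1) hj
  | tapp h hs ih => exact ih.inst hs
  | par h ih => exact ih
  | dpar h ih => exact ih.of_kill

theorem level_var {x : ℕ} (h : Leveled E l rho k (.var x) A) : l x = some k := by
  generalize e : PTerm.var x = t at h
  cases h with
  | var h hs =>
    cases e
    exact h
  | _ => cases e

/-- The free term variables have types whose type variables have a level. -/
theorem scoped_of_count (h : Leveled E l rho k t A) {y : ℕ} (hy : 0 < t.count y) :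
    Scoped rho (E y).ty := by
  induction h generalizing y with
  | var h hs => exact PTerm.count_var_pos.1 hy ▸ hs
  | lam hs hc h ih => exact ih (y := y + 1) hy
  | app h1 h2 ih1 ih2 =>
    rcases Nat.add_pos_iff_pos_or_pos.1 hy with h | h
    exacts [ih1 h, ih2 h]
  | appVar h1 he h2 ih1 ih2 =>
    rcases Nat.add_pos_iff_pos_or_pos.1 hy with h | h
    exacts [ih1 h, ih2 h]
  | appBox h1 h2 h3 h4 h5 h6 ih1 ih5 ih6 =>
    rcases Nat.add_pos_iff_pos_or_pos.1 hy with h | h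
    exacts [ih1 h, ih6 h]
  | tlam h ih => exact fun j hj => ih hy (j + 1) (LinTy.hasFree_shift.2 hj)
  | tapp h hs ih => exact ih hy
  | par h ih => exact ih hy
  | dpar h ih => exact (ih hy).of_kill

theorem rename (h : Leveled E l rho k t A) {E' : Env} {l' : ℕ → Option ℕ} {r : ℕ → ℕ}
    (hr : ∀ y, 0 < t.count y → E' (r y) = E y ∧ ∀ n, l y = some n → l' (r y) = some n) :
    Leveled E' l' rho k (t.rename r) A := by
  induction h generalizing E' l' r with
  | @var E l rho k x h hs =>
    obtain ⟨h1, h2⟩ := hr x (PTerm.count_var_pos.2 rfl)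
    rw [← h1] at hs ⊢
    exact .var (h2 _ h) hs
  | lam hs hc h ih =>
    refine .lam hs (by simpa using hc) (ih ?_)
    rintro (_ | y) hy
    · simp
    · simpa using hr y hy
  | app h1 h2 ih1 ih2 =>
    exact .app (ih1 fun y hy => hr y (by simp only [PTerm.count]; omega))
      (ih2 fun y hy => hr y (by simp only [PTerm.count]; omega))
  | @appVar E l rho k x t A B h1 he h2 ih1 ih2 =>
    refine .appVar (ih1 fun y hy => hr y (by simp only [PTerm.count]; omega)) ?_
      (ih2 fun y hy => hr y (by simp only [PTerm.count] at hy ⊢; omega))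
    rw [(hr x (by simp [PTerm.count])).1, he]
  | @appBox E l rho k x t w A B C h1 h2 h3 h4 h5 h6 ih1 ih5 ih6 =>
    have e : (w.subst fun _ => .dpar (.var x)).rename r
        = w.subst fun _ => .dpar (.var (r x)) := by
      rw [PTerm.subst_rename]; rfl
    simp only [PTerm.rename, e]
    refine .appBox (ih1 fun y hy => hr y (by simp only [PTerm.count]; omega)) h2 h3 ?_ h5 ?_
    · intro hw
      obtain ⟨hx1, hx2⟩ := h4 hw
      have := hr x ?_
      · exact ⟨this.2 _ hx1, this.1.trans hx2⟩
      · have : 0 < (w.subst fun _ => .dpar (.var x)).count x :=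
          PTerm.count_subst_pos.2 ⟨0, hw, by simp [PTerm.count]⟩
        simp only [PTerm.count]; omega
    · rw [← e]
      exact ih6 fun y hy => hr y (by simp only [PTerm.count] at hy ⊢; omega)
  | tlam h ih =>
    refine .tlam (ih fun y hy => ?_)
    obtain ⟨h1, h2⟩ := hr y hy
    exact ⟨by simp only [Env.liftTy, h1], h2⟩
  | tapp h hs ih => exact .tapp (ih hr) hs
  | par h ih => exact .par (ih hr)
  | dpar h ih =>
    refine .dpar (ih fun y hy => ?_)
    obtain ⟨h1, h2⟩ := hr y hy
    refine ⟨h1, fun n hn => ?_⟩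
    rw [kill_eq_some] at hn ⊢
    exact ⟨h2 n hn.1, hn.2⟩

theorem congr_env (h : Leveled E l rho k t A) {E' : Env} {l' : ℕ → Option ℕ}
    (hr : ∀ y, 0 < t.count y → E' y = E y ∧ ∀ n, l y = some n → l' y = some n) :
    Leveled E' l' rho k t A := by
  have := h.rename (r := fun n => n) hr
  rwa [PTerm.rename_id] at this

/-- Renaming of type variables, which may lower their levels, and translation of all levels. -/
theorem renameTy_add (h : Leveled E l rho k t A) {l' rho' : ℕ → Option ℕ} {r : ℕ → ℕ} {c : ℕ}
    (hl : ∀ x n, l x = some n → l' x = some (n + c))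
    (hr : ∀ j n, rho j = some n → ∃ m, m ≤ n + c ∧ rho' (r j) = some m) :
    Leveled (fun x => (E x).rename r) l' rho' (k + c) (t.renameTy r) (A.rename r) := by
  have scoped_rename {rho rho' : ℕ → Option ℕ} {r : ℕ → ℕ} {c : ℕ} {B : LinTy}
      (hr : ∀ j n, rho j = some n → ∃ m, m ≤ n + c ∧ rho' (r j) = some m) (hB : Scoped rho B) :
      Scoped rho' (B.rename r) :=
    hB.rename fun j n hn => let ⟨m, hm⟩ := hr j n hn; ⟨m, hm.2⟩
  induction h generalizing l' rho' r c with
  | @var E l rho k x h hs =>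
    rw [← StarTy.out_rename]
    exact .var (E := fun x => (E x).rename r) (hl _ _ h) (scoped_rename hr hs)
  | lam hs hc h ih =>
    refine .lam (scoped_rename hr hs) (fun hb => by simpa using hc hb) ?_
    rw [← comp_scons (StarTy.rename r)]
    refine ih ?_ hr
    rintro (_ | x) n hn
    · simp_all
    · exact hl x n hn
  | app h1 h2 ih1 ih2 => exact .app (ih1 hl hr) (ih2 hl hr)
  | appVar h1 he h2 ih1 ih2 =>
    exact .appVar (ih1 hl hr) (by simp only [he]; rfl) (ih2 hl hr)
  | @appBox E l rho k x t w A B C h1 h2 h3 h4 h5 h6 ih1 ih5 ih6 =>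
    have e : (w.subst fun _ => .dpar (.var x)).renameTy r
        = (w.renameTy r).subst fun _ => .dpar (.var x) := by
      rw [PTerm.subst_renameTy]; rfl
    have h6' := ih6 hl hr
    simp only [PTerm.renameTy, e] at h6' ⊢
    refine .appBox (C := C.rename r) (ih1 hl hr) (by simpa using h2) (by simpa using h3) ?_ ?_ h6'
    · intro hw
      obtain ⟨hx1, hx2⟩ := h4 (by simpa using hw)
      exact ⟨hl _ _ hx1, by simp only [hx2]; rfl⟩
    -- The body of a box counts its levels from 0 wherever the box stands, so the translation does
    -- not reach it.
    · refine ih5 (c := 0) (fun x n hn => hn) fun j n hn => ?_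
      obtain ⟨rfl, m, hm⟩ := resetLevels_eq_some.1 hn
      obtain ⟨m', -, hm'⟩ := hr j m hm
      exact ⟨0, le_rfl, resetLevels_eq_some.2 ⟨rfl, m', hm'⟩⟩
  | @tlam E l rho k t A h ih =>
    refine .tlam ?_
    have e : Env.liftTy (fun x => (E x).rename r) = fun x => (E.liftTy x).rename (upRen r) := by
      funext x
      exact (StarTy.shift_rename _ _).symm
    rw [e]
    refine ih hl ?_
    rintro (_ | j) n hn
    · refine ⟨k + c, ?_, rfl⟩
      simp only [scons_zero, Option.some.injEq] at hn
      omega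
    · exact hr j n hn
  | tapp h hs ih =>
    rw [LinTy.inst_rename]
    exact .tapp (ih hl hr) (scoped_rename hr hs)
  | @par E l rho k t A h ih =>
    refine .par ?_
    have := ih hl hr
    rwa [Nat.add_right_comm] at this
  | @dpar E l rho k t A h ih =>
    rw [Nat.add_right_comm]
    refine .dpar (ih ?_ ?_)
    · intro x n hn
      rw [kill_eq_some] at hn ⊢
      exact ⟨hl _ _ hn.1, by omega⟩
    · intro j n hn
      rw [kill_eq_some] at hn
      obtain ⟨m, hm, e⟩ := hr j n hn.1
      exact ⟨m, hm, kill_eq_some.2 ⟨e, by omega⟩⟩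

theorem renameTy (h : Leveled E l rho k t A) {rho' : ℕ → Option ℕ} {r : ℕ → ℕ}
    (hr : ∀ j n, rho j = some n → ∃ m, m ≤ n ∧ rho' (r j) = some m) :
    Leveled (fun x => (E x).rename r) l rho' k (t.renameTy r) (A.rename r) :=
  h.renameTy_add (c := 0) (fun _ _ h => h) hr

theorem add_level (h : Leveled E l rho k t A) {l' rho' : ℕ → Option ℕ} {c : ℕ}
    (hl : ∀ x n, l x = some n → l' x = some (n + c))
    (hr : ∀ j n, rho j = some n → ∃ m, m ≤ n + c ∧ rho' j = some m) :
    Leveled E l' rho' (k + c) t A := by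
  have := h.renameTy_add (r := fun n => n) hl hr
  simpa only [StarTy.rename_id, PTerm.renameTy_id, LinTy.rename_id] using this

/-- Remembering more variables only permits more occurrences. -/
theorem of_kill {n : ℕ} (h : Leveled E (kill n l) (kill n rho) k t A) : Leveled E l rho k t A :=
  h.add_level (c := 0) (fun _ _ h => (kill_eq_some.1 h).1)
    fun _ m h => ⟨m, le_rfl, (kill_eq_some.1 h).1⟩

/-- A variable of level `n` occurs only at level `n`, so a term leveled at `n` fits there. It must
not use anything bound above `n`, and this makes the hypothesis stable below a `§̄`, since
forgetting above some `k ≥ n` first changes nothing. A bang variable may only be replaced by a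
variable, because the rules for bang arguments mention it as such. -/
theorem subst (h : Leveled E l rho k t A) {E' : Env} {l' : ℕ → Option ℕ} {s : ℕ → PTerm}
    (hs : ∀ y, 0 < t.count y → ∀ n, l y = some n →
      (∃ x, s y = .var x ∧ E' x = E y ∧ l' x = some n) ∨
      ((E y).bang = false ∧ Leveled E' (kill n l') (kill n rho) n (s y) (E y).ty)) :
    Leveled E' l' rho k (t.subst s) A := by
  induction h generalizing E' l' s with
  | @var E l rho k x h hx =>
    rcases hs x (PTerm.count_var_pos.2 rfl) k h with ⟨z, h1, h2, h3⟩ | ⟨h1, h2⟩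
    · rw [← h2] at hx ⊢
      simp only [PTerm.subst, h1]
      exact .var h3 hx
    · have e : (E x).out = (E x).ty := by simp [StarTy.out, h1]
      rw [e]
      exact h2.of_kill
  | @lam E l rho k D t B hD hc h ih =>
    refine .lam hD (by rwa [PTerm.count_subst_lift_zero]) (ih ?_)
    rintro (_ | y) hy n hn
    · exact Or.inl ⟨0, rfl, rfl, hn⟩
    · rcases hs y hy n hn with ⟨z, h1, h2, h3⟩ | ⟨h1, h2⟩
      · exact Or.inl ⟨z + 1, by simp [h1, PTerm.rename], h2, h3⟩
      · refine Or.inr ⟨h1, h2.rename fun z _ => ⟨rfl, fun m hm => hm⟩⟩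
  | app h1 h2 ih1 ih2 =>
    exact .app (ih1 fun y hy => hs y (by simp only [PTerm.count]; omega))
      (ih2 fun y hy => hs y (by simp only [PTerm.count]; omega))
  | @appVar E l rho k x t A B h1 he h2 ih1 ih2 =>
    have h2' := ih2 fun y hy => hs y (by simp only [PTerm.count] at hy ⊢; omega)
    have hx : l x = some k := h2.level_var
    rcases hs x (by simp [PTerm.count]) k hx with ⟨z, hz1, hz2, -⟩ | ⟨hb, -⟩
    · simp only [PTerm.subst, hz1] at h2' ⊢
      exact .appVar (ih1 fun y hy => hs y (by simp only [PTerm.count]; omega)) (hz2.trans he) h2'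
    · simp [he] at hb
  | @appBox E l rho k x t w A B C h1 h2 h3 h4 h5 h6 ih1 ih5 ih6 =>
    have hz : ∃ z, w.subst (fun _ => .dpar (s x)) = w.subst (fun _ => .dpar (.var z)) ∧
        (0 < w.count 0 → l' z = some k ∧ E' z = ⟨true, C⟩) := by
      by_cases hw : 0 < w.count 0
      · obtain ⟨hx1, hx2⟩ := h4 hw
        have hx : 0 < (w.subst fun _ => .dpar (.var x)).count x :=
          PTerm.count_subst_pos.2 ⟨0, hw, by simp [PTerm.count]⟩
        rcases hs x (by simp only [PTerm.count]; omega) k hx1 with ⟨z, hz1, hz2, hz3⟩ | ⟨hb, -⟩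
        · exact ⟨z, by rw [hz1], fun _ => ⟨hz3, hz2.trans hx2⟩⟩
        · simp [hx2] at hb
      -- For a closed body the index of the substituted variable is irrelevant.
      · refine ⟨0, PTerm.subst_congr fun y hy => ?_, fun h => absurd h hw⟩
        obtain rfl := h2 y hy
        exact absurd hy hw
    obtain ⟨z, hz1, hz2⟩ := hz
    have e : (w.subst fun _ => .dpar (.var x)).subst s = w.subst fun _ => .dpar (.var z) := by
      rw [PTerm.subst_subst, ← hz1]; rfl
    have h6' := ih6 fun y hy => hs y (by simp only [PTerm.count] at hy ⊢; omega)
    simp only [PTerm.subst, e] at h6' ⊢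
    exact .appBox (ih1 fun y hy => hs y (by simp only [PTerm.count]; omega)) h2 h3 hz2 h5 h6'
  | @tlam E l rho k t A h ih =>
    refine .tlam (ih fun y hy n hn => ?_)
    rcases hs y hy n hn with ⟨z, h1, h2, h3⟩ | ⟨h1, h2⟩
    · exact Or.inl ⟨z, by simp [h1, PTerm.renameTy], by simp only [Env.liftTy, h2], h3⟩
    · refine Or.inr ⟨h1, h2.renameTy fun j m hm => ⟨m, le_rfl, ?_⟩⟩
      rw [kill_eq_some] at hm ⊢
      exact hm
  | tapp h hB ih => exact .tapp (ih hs) hB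
  | par h ih => exact .par (ih hs)
  | @dpar E l rho k t A h ih =>
    refine .dpar (ih fun y hy n hn => ?_)
    rw [kill_eq_some] at hn
    rcases hs y hy n hn.1 with ⟨z, h1, h2, h3⟩ | ⟨h1, h2⟩
    · exact Or.inl ⟨z, h1, h2, kill_eq_some.2 ⟨h3, hn.2⟩⟩
    · exact Or.inr ⟨h1, by rwa [kill_kill hn.2, kill_kill hn.2]⟩

theorem level_of_count (h : Leveled E l rho k t A) {x : ℕ} (hx : 0 < t.count x) :
    ∃ n, l x = some n := by
  induction h generalizing x with
  | @var E l rho k y h hs => exact ⟨k, PTerm.count_var_pos.1 hx ▸ h⟩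
  | lam hs hc h ih => exact ih hx
  | app h1 h2 ih1 ih2 =>
    rcases Nat.add_pos_iff_pos_or_pos.1 hx with h | h
    exacts [ih1 h, ih2 h]
  | appVar h1 he h2 ih1 ih2 =>
    rcases Nat.add_pos_iff_pos_or_pos.1 hx with h | h
    exacts [ih1 h, ih2 h]
  | appBox h1 h2 h3 h4 h5 h6 ih1 ih5 ih6 =>
    rcases Nat.add_pos_iff_pos_or_pos.1 hx with h | h
    exacts [ih1 h, ih6 h]
  | tlam h ih => exact ih hx
  | tapp h hs ih => exact ih hx
  | par h ih => exact ih hx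
  | dpar h ih =>
    obtain ⟨n, hn⟩ := ih hx
    exact ⟨n, (kill_eq_some.1 hn).1⟩

/-- A type renaming that fixes the type variables that have a level acts trivially. -/
theorem renameTy_eq_self (h : Leveled E l rho k t A) {r : ℕ → ℕ}
    (hr : ∀ j n, rho j = some n → r j = j) : t.renameTy r = t := by
  have aux {rho : ℕ → Option ℕ} {r : ℕ → ℕ} {B : LinTy} (hr : ∀ j n, rho j = some n → r j = j)
      (hB : Scoped rho B) : B.rename r = B := by
    conv_rhs => rw [← LinTy.rename_id B]
    exact LinTy.rename_congr fun j hj => let ⟨n, hn⟩ := hB j hj; hr j n hn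
  induction h generalizing r with
  | var h hs => rfl
  | lam hs hc h ih => simp only [PTerm.renameTy, ih hr, StarTy.rename, aux hr hs]
  | app h1 h2 ih1 ih2 => simp only [PTerm.renameTy, ih1 hr, ih2 hr]
  | appVar h1 he h2 ih1 ih2 => simp only [PTerm.renameTy, ih1 hr]
  | appBox h1 h2 h3 h4 h5 h6 ih1 ih5 ih6 =>
    have := ih6 hr
    simp only [PTerm.renameTy] at this
    simp only [PTerm.renameTy, ih1 hr, this]
  | tlam h ih =>
    simp only [PTerm.renameTy]
    rw [ih]
    rintro (_ | j) n hn
    · rfl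
    · simp [hr j n hn]
  | tapp h hs ih => simp only [PTerm.renameTy, ih hr, aux hr hs]
  | par h ih => simp only [PTerm.renameTy, ih hr]
  | dpar h ih =>
    simp only [PTerm.renameTy]
    rw [ih fun j n hn => hr j n (kill_eq_some.1 hn).1]

/-- The argument built in the rule `Leveled.appBox`. -/
theorem box {w : PTerm} {C : LinTy} {x : ℕ} (hw : ∀ y, 0 < w.count y → y = 0)
    (hx : 0 < w.count 0 → l x = some k ∧ E x = ⟨true, C⟩)
    (hrho : ∀ j n, rho j = some n → n ≤ k)
    (h : Leveled (fun _ => ⟨false, C⟩) (fun _ => some 0) (resetLevels rho) 0 w A) :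
    Leveled E l rho k (.par (w.subst fun _ => .dpar (.var x))) A.par := by
  refine .par ?_
  -- Under the `§` the level is `k + 1`, so the body is translated by `k + 1`. Type variables may be
  -- bound at lower levels than the translation gives; theirs are at most `k`.
  have h' : Leveled (fun _ => ⟨false, C⟩) (fun _ => some (k + 1)) rho (k + 1) w A := by
    have := h.add_level (c := k + 1) (l' := fun _ => some (k + 1)) (rho' := rho)
      (fun x n hn => by simp at hn; simp [← hn])
      (fun j n hn => by
        obtain ⟨rfl, m, hm⟩ := resetLevels_eq_some.1 hn
        exact ⟨m, by have := hrho j m hm; omega, hm⟩)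
    rwa [Nat.zero_add] at this
  -- The linear variable, now of level `k + 1`, makes way for `§̄ x`: that term stands at level `k +
  -- 1` and its variable at level `k`, where `x` is bound.
  refine h'.subst fun y hy n hn => Or.inr ⟨rfl, ?_⟩
  obtain rfl := hw y hy
  obtain ⟨hx1, hx2⟩ := hx hy
  simp only [Option.some.injEq] at hn
  subst hn
  refine .dpar ?_
  rw [kill_kill (Nat.le_succ k), kill_kill (Nat.le_succ k)]
  have hC : Scoped rho C := by
    refine (h.scoped_of_count hy).mono fun j n hn => ?_
    exact (resetLevels_eq_some.1 hn).2
  have : Leveled E (kill k l) (kill k rho) k (.var x) (E x).out := by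
    refine .var (kill_eq_some.2 ⟨hx1, le_rfl⟩) ?_
    rw [hx2]
    intro j hj
    obtain ⟨n, hn⟩ := hC j hj
    exact ⟨n, kill_eq_some.2 ⟨hn, by have := hrho j n hn; omega⟩⟩
  rwa [hx2] at this

end Leveled

/-! ### Cutting a leveled pseudo-term where its level drops -/

/-- All levels decreased by `n`, where levels below `n` become `0`. -/
def lowerLevels (n : ℕ) (l : ℕ → Option ℕ) : ℕ → Option ℕ := fun x => (l x).map (fun m => m - n)

theorem lowerLevels_eq_some {l : ℕ → Option ℕ} {n x m : ℕ} :
    lowerLevels n l x = some m ↔ ∃ i, l x = some i ∧ i - n = m := by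
  simp only [lowerLevels, Option.map_eq_some_iff]

theorem resetLevels_lowerLevels (n : ℕ) (l : ℕ → Option ℕ) :
    resetLevels (lowerLevels n l) = resetLevels l := by
  funext x
  simp [resetLevels, lowerLevels, Function.comp_def]

/-- For truncated subtraction, `i - n ≤ k` is equivalent to `i ≤ n + k`, also when `i < n`. -/
theorem kill_lowerLevels (n k : ℕ) (l : ℕ → Option ℕ) :
    kill k (lowerLevels n l) = lowerLevels n (kill (n + k) l) := by
  funext x
  refine Option.ext fun m => ?_
  simp only [kill_eq_some, lowerLevels_eq_some]
  constructor
  · rintro ⟨⟨i, h1, h2⟩, h3⟩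
    exact ⟨i, ⟨h1, by omega⟩, h2⟩
  · rintro ⟨i, ⟨h1, h3⟩, h2⟩
    exact ⟨⟨i, h1, h2⟩, by omega⟩

theorem Scoped.lowerLevels {rho : ℕ → Option ℕ} {A : LinTy} (h : Scoped rho A) (n : ℕ) :
    Scoped (lowerLevels n rho) A :=
  h.mono fun _ m hm => ⟨m - n, lowerLevels_eq_some.2 ⟨m, hm, rfl⟩⟩

/-- `f 0, g 0, f 1, g 1, …`. -/
def interleave {X : Type} (f g : ℕ → X) (n : ℕ) : X := if n % 2 = 0 then f (n / 2) else g (n / 2)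

@[simp] theorem interleave_even {X : Type} (f g : ℕ → X) (n : ℕ) :
    interleave f g (2 * n) = f n := by
  simp [interleave]

@[simp] theorem interleave_odd {X : Type} (f g : ℕ → X) (n : ℕ) :
    interleave f g (2 * n + 1) = g n := by
  have : (2 * n + 1) / 2 = n := by omega
  simp [interleave, Nat.add_mod, this]

/-- When `t`, below a path of sum `K`, is cut at the places where the sum drops from `c + 1` to `c`,
the result has a free variable with the type `D`, the level `m` and `n` occurrences for which `s` is
to be substituted in order to recover `t`.  Either `s` is a variable whose binder is above level
`c`, or `s` is a subterm at which the sum drops. -/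
def CutVar (E : Env) (l rho : ℕ → Option ℕ) (c K : ℕ) (t : PTerm) (D : StarTy) (m : Option ℕ)
    (n : ℕ) (s : PTerm) : Prop :=
  (∃ x i, s = .var x ∧ D = E x ∧ l x = some (c + 1 + i) ∧ m = some i) ∨
  (∃ v C, s = .dpar v ∧ D = ⟨false, C⟩ ∧ m = some 0 ∧ n ≤ 1 ∧
    Leveled E (kill c l) (kill c rho) c v C.par ∧
    ∃ p w, Occ t p w ∧ (K : ℤ) + sum (word p) = c ∧ ∀ z, w = .var z → ∃ z', v = .var z')

namespace CutVar

variable {E : Env} {l rho : ℕ → Option ℕ} {c K K' : ℕ} {t t' : PTerm} {D : StarTy} {m : Option ℕ}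
  {n n' : ℕ} {s : PTerm}

theorem mono (h : CutVar E l rho c K t D m n s) (hn : n' ≤ n)
    (ht : ∀ p v, Occ t p v → ∃ q, Occ t' q v ∧ (K' : ℤ) + sum (word q) = K + sum (word p)) :
    CutVar E l rho c K' t' D m n' s := by
  rcases h with h | ⟨v, C, h1, h2, h3, h4, h5, p, w, h6, h7, h8⟩
  · exact Or.inl h
  · obtain ⟨q, hq, e⟩ := ht p w h6
    exact Or.inr ⟨v, C, h1, h2, h3, hn.trans h4, h5, q, w, hq, e.trans h7, h8⟩

theorem of_kill {k : ℕ} (hk : c ≤ k) (h : CutVar E (kill k l) (kill k rho) c K t D m n s) :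
    CutVar E l rho c K t D m n s := by
  rcases h with ⟨x, i, h1, h2, h3, h4⟩ | ⟨v, C, h1, h2, h3, h4, h5, h6⟩
  · exact Or.inl ⟨x, i, h1, h2, (kill_eq_some.1 h3).1, h4⟩
  · rw [kill_kill hk, kill_kill hk] at h5
    exact Or.inr ⟨v, C, h1, h2, h3, h4, h5, h6⟩

/-- A piece that starts with a drop to level `c` cannot contain a variable bound at level `K > c`,
because that level has been forgotten. So a fresh variable stands either for the bound variable
itself, or for something that keeps its meaning outside of the abstraction, with indices lowered by
one. -/
theorem of_lam {D' : StarTy} (hK : c < K)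
    (h : CutVar (scons D' E) (scons (some K) l) rho c K t D m n s) :
    (s = .var 0 ∧ D = D' ∧ m = some (K - (c + 1))) ∨
    (s ≠ .var 0 ∧ (s.rename Nat.pred).rename Nat.succ = s ∧
      CutVar E l rho c K (.lam D' t) D m n (s.rename Nat.pred)) := by
  rcases h with ⟨_ | x, i, rfl, h2, h3, h4⟩ | ⟨v, C, rfl, h2, h3, h4, h5, p, w, h6, h7, h8⟩
  · simp only [scons_zero, Option.some.injEq] at h3
    refine Or.inl ⟨rfl, h2, ?_⟩
    rw [h4]; congr 1; omega
  · exact Or.inr ⟨by simp, rfl, Or.inl ⟨x, i, rfl, h2, h3, h4⟩⟩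
  · have hv : ∀ y, 0 < v.count y → ∃ z, y = z + 1 := by
      rintro (_ | y) hy
      · obtain ⟨i, hi⟩ := h5.level_of_count hy
        simp only [kill_eq_some, scons_zero, Option.some.injEq] at hi
        omega
      · exact ⟨y, rfl⟩
    refine Or.inr ⟨by simp, ?_, Or.inr ⟨v.rename Nat.pred, C, rfl, h2, h3, h4, ?_, ?_⟩⟩
    · rw [PTerm.rename_rename]
      conv_rhs => rw [← PTerm.rename_id (PTerm.dpar v)]
      refine PTerm.rename_congr fun y hy => ?_
      obtain ⟨z, rfl⟩ := hv y hy
      rfl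
    · refine h5.rename fun y hy => ?_
      obtain ⟨z, rfl⟩ := hv y hy
      exact ⟨rfl, fun i hi => hi⟩
    · refine ⟨_, w, h6.lam D', h7, fun z hz => ?_⟩
      obtain ⟨z', rfl⟩ := h8 z hz
      exact ⟨_, rfl⟩

/-- The counterpart of `of_lam` for type variables, and the place where the Λ-scope condition is
used: neither a piece nor its type mentions the type variable bound at level `K > c`, so lowering
the type indices is reversible and the piece can be moved out of the `Λ`. -/
theorem of_tlam (hK : c < K)
    (h : CutVar E.liftTy l (scons (some K) rho) c K t D m n s) :
    (D.rename Nat.pred).shift = D ∧ (s.renameTy Nat.pred).renameTy Nat.succ = s ∧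
      CutVar E l rho c K (.tlam t) (D.rename Nat.pred) m n (s.renameTy Nat.pred) := by
  have pred_shift (D : StarTy) : D.shift.rename Nat.pred = D := by
    have : (fun j => Nat.pred (Nat.succ j)) = fun j => j := rfl
    show (D.rename Nat.succ).rename Nat.pred = D
    rw [StarTy.rename_rename, this, StarTy.rename_id]
  rcases h with ⟨x, i, rfl, rfl, h3, h4⟩ | ⟨v, C, rfl, rfl, h3, h4, h5, p, w, h6, h7, h8⟩
  · simp only [Env.liftTy, pred_shift, PTerm.renameTy, true_and]
    exact Or.inl ⟨x, i, rfl, rfl, h3, h4⟩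
  · have hr : ∀ j i, kill c (scons (some K) rho) j = some i → ∃ j', j = j' + 1 := by
      rintro (_ | j) i hi
      · simp only [kill_eq_some, scons_zero, Option.some.injEq] at hi
        omega
      · exact ⟨j, rfl⟩
    refine ⟨?_, ?_, Or.inr ⟨v.renameTy Nat.pred, C.rename Nat.pred, rfl, rfl, h3, h4, ?_, ?_⟩⟩
    · show StarTy.rename _ (StarTy.rename _ _) = _
      rw [StarTy.rename_rename]
      conv_rhs => rw [← StarTy.rename_id ⟨false, C⟩]
      simp only [StarTy.rename, StarTy.mk.injEq, true_and]
      refine LinTy.rename_congr fun j hj => ?_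
      obtain ⟨i, hi⟩ := h5.scoped_type j hj
      obtain ⟨j', rfl⟩ := hr j i hi
      rfl
    · rw [PTerm.renameTy_renameTy]
      simp only [PTerm.renameTy, PTerm.dpar.injEq]
      refine h5.renameTy_eq_self fun j i hi => ?_
      obtain ⟨j', rfl⟩ := hr j i hi
      rfl
    · have := h5.renameTy (rho' := kill c rho) (r := Nat.pred) fun j i hi => by
        obtain ⟨j', rfl⟩ := hr j i hi
        exact ⟨i, le_rfl, hi⟩
      simp only [Env.liftTy, pred_shift] at this
      exact this
    · refine ⟨_, w, h6.tlam, h7, fun z hz => ?_⟩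
      obtain ⟨z', rfl⟩ := h8 z hz
      exact ⟨_, rfl⟩

end CutVar

/-- Each `§̄` at which the level falls from `c + 1` to `c` is replaced, together with all that is
below it, by a fresh linear variable. No binder passed on the way can bind anything in the piece, so
a capture-avoiding substitution puts it back. Every occurrence of an old variable also gets its own
fresh one at first; those that stand for a bound variable are merged when its abstraction is
reached. Boxes are left whole, since their interior never falls below the level of the application.
-/
theorem Leveled.cut {E : Env} {l rho : ℕ → Option ℕ} {K : ℕ} {t : PTerm} {A : LinTy}
    (h : Leveled E l rho K t A) (hrho : ∀ j n, rho j = some n → n ≤ K) {c k : ℕ}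
    (hK : K = c + 1 + k) :
    ∃ (t' : PTerm) (E' : Env) (l' : ℕ → Option ℕ) (s : ℕ → PTerm), t'.subst s = t ∧
      Leveled E' l' (lowerLevels (c + 1) rho) k t' A ∧
      ∀ y, 0 < t'.count y → CutVar E l rho c K t (E' y) (l' y) (t'.count y) (s y) := by
  have even_pos {t₁ : PTerm} {y : ℕ} (hy : 0 < (t₁.rename (fun n => 2 * n)).count y) :
      ∃ z, y = 2 * z ∧ 0 < t₁.count z ∧ (t₁.rename fun n => 2 * n).count (2 * z) = t₁.count z := by
    obtain ⟨z, hz, rfl⟩ := PTerm.count_rename_pos.1 hy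
    exact ⟨z, rfl, hz, PTerm.count_rename fun i _ => by omega⟩
  have odd_pos {t₁ : PTerm} {y : ℕ} (hy : 0 < (t₁.rename (fun n => 2 * n + 1)).count y) :
      ∃ z, y = 2 * z + 1 ∧ 0 < t₁.count z ∧
        (t₁.rename fun n => 2 * n + 1).count (2 * z + 1) = t₁.count z := by
    obtain ⟨z, hz, rfl⟩ := PTerm.count_rename_pos.1 hy
    exact ⟨z, rfl, hz, PTerm.count_rename fun i _ => by omega⟩
  induction h generalizing k with
  | @var E l rho K x h hs =>
    refine ⟨.var 0, fun _ => E x, fun _ => some k, fun _ => .var x, rfl,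
      .var (E := fun _ => E x) rfl (hs.lowerLevels _), fun y _ => Or.inl ⟨x, k, rfl, rfl, ?_, rfl⟩⟩
    rw [h, hK]
  | @lam E l rho K D t B hs hc h ih =>
    obtain ⟨t', E', l', s, rfl, h', hcut⟩ := ih hrho hK
    have hcut' := fun y hy => (hcut y hy).of_lam (by omega)
    -- All fresh variables that stand for occurrences of the bound variable are merged into index 0.
    have hbody : (t'.rename fun y => if s y = .var 0 then 0 else y + 1).subst
        (scons (.var 0) fun y => ((s y).rename Nat.pred).rename Nat.succ) = t'.subst s := by
      rw [PTerm.rename_subst]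
      refine PTerm.subst_congr fun y hy => ?_
      rcases hcut' y hy with ⟨e, -⟩ | ⟨e, e', -⟩
      · simp [e]
      · simp [e, e']
    refine ⟨.lam D (t'.rename fun y => if s y = .var 0 then 0 else y + 1), E', l',
      fun y => (s y).rename Nat.pred, ?_, .lam (hs.lowerLevels _) ?_ (h'.rename ?_), ?_⟩
    · simp only [PTerm.subst, hbody]
    · intro hD
      have := hc hD
      rwa [← hbody, PTerm.count_subst_lift_zero] at this
    · intro y hy
      rcases hcut' y hy with ⟨e, e1, e2⟩ | ⟨e, -⟩
      · simp only [e, ↓reduceIte, scons_zero, e1, true_and, e2]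
        intro n hn
        rw [← hn]; congr 1; omega
      · simp [e]
    · intro y hy
      obtain ⟨z, hz, e⟩ := PTerm.count_rename_pos.1 hy
      rcases hcut' z hz with ⟨e1, -⟩ | ⟨e1, -, e3⟩
      · simp [e1] at e
      · simp only [e1, ↓reduceIte, Nat.add_right_cancel_iff] at e
        subst e
        refine e3.mono ?_ fun p v hp => ⟨p, hp, rfl⟩
        refine (PTerm.count_rename fun i hi => ?_).le
        split_ifs with hi0
        · refine ⟨False.elim, ?_⟩
          rintro rfl
          exact e1 hi0
        · omega
  | @app E l rho K t u A B h1 h2 ih1 ih2 =>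
    obtain ⟨t', E₁, l₁, s₁, rfl, h1', hcut1⟩ := ih1 hrho hK
    obtain ⟨u', E₂, l₂, s₂, rfl, h2', hcut2⟩ := ih2 hrho hK
    -- Even indices for the function and odd ones for the argument: no fresh variable is shared, so
    -- each piece still has at most one place.
    refine ⟨.app (t'.rename fun n => 2 * n) (u'.rename fun n => 2 * n + 1), interleave E₁ E₂,
      interleave l₁ l₂, interleave s₁ s₂, ?_,
      .app (h1'.rename fun y _ => by simp) (h2'.rename fun y _ => by simp), ?_⟩
    · simp only [PTerm.subst, PTerm.rename_subst, interleave_even, interleave_odd]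
    · intro y hy
      have hz : ∀ z, (t'.rename fun n => 2 * n).count (2 * z + 1) = 0 := fun z =>
        PTerm.count_rename_eq_zero fun i _ => by omega
      have hz' : ∀ z, (u'.rename fun n => 2 * n + 1).count (2 * z) = 0 := fun z =>
        PTerm.count_rename_eq_zero fun i _ => by omega
      rcases Nat.add_pos_iff_pos_or_pos.1 hy with hy | hy
      · obtain ⟨z, rfl, hz1, e⟩ := even_pos hy
        simp only [interleave_even, PTerm.count, e, hz', Nat.add_zero]
        exact (hcut1 z hz1).mono le_rfl fun p v hp => ⟨_, hp.fn _, rfl⟩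
      · obtain ⟨z, rfl, hz1, e⟩ := odd_pos hy
        simp only [interleave_odd, PTerm.count, e, hz, Nat.zero_add]
        exact (hcut2 z hz1).mono le_rfl fun p v hp => ⟨_, hp.arg _, rfl⟩
  | @appVar E l rho K x t A B h1 he h2 ih1 ih2 =>
    obtain ⟨t', E₁, l₁, s₁, rfl, h1', hcut1⟩ := ih1 hrho hK
    have hx := h2.level_var
    have hE : (interleave E₁ fun _ => E x) 1 = ⟨true, A⟩ := by simpa [interleave] using he
    refine ⟨.app (t'.rename fun n => 2 * n) (.var 1), interleave E₁ fun _ => E x,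
      interleave l₁ fun _ => some k, interleave s₁ fun _ => .var x, ?_,
      .appVar (h1'.rename fun y _ => by simp) hE ?_, ?_⟩
    · simp only [PTerm.subst, PTerm.rename_subst, interleave_even]
      rfl
    · have : Leveled (interleave E₁ fun _ => E x) (interleave l₁ fun _ => some k)
          (lowerLevels (c + 1) rho) k (.var 1) ((interleave E₁ fun _ => E x) 1).out := by
        refine .var rfl ?_
        rw [hE]
        have := h2.scoped_of_count (PTerm.count_var_pos.2 rfl)
        rw [he] at this
        exact this.lowerLevels _
      rwa [hE] at this
    · intro y hy
      rcases Nat.add_pos_iff_pos_or_pos.1 hy with hy | hy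
      · obtain ⟨z, rfl, hz1, e⟩ := even_pos hy
        have : ¬ (1 = 2 * z) := by omega
        simp only [interleave_even, PTerm.count, e, this, ↓reduceIte, Nat.add_zero]
        exact (hcut1 z hz1).mono le_rfl fun p v hp => ⟨_, hp.fn _, rfl⟩
      · obtain rfl := PTerm.count_var_pos.1 hy
        exact Or.inl ⟨x, k, rfl, rfl, by rw [hx, hK], rfl⟩
  | @appBox E l rho K x t w A B C h1 h2 h3 h4 h5 h6 ih1 ih5 ih6 =>
    obtain ⟨t', E₁, l₁, s₁, rfl, h1', hcut1⟩ := ih1 hrho hK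
    have hw : ∀ y, 0 < (PTerm.par (w.subst fun _ => .dpar (.var 1))).count y →
        y = 1 ∧ 0 < w.count 0 := by
      intro y hy
      obtain ⟨z, hz1, hz2⟩ := PTerm.count_subst_pos.1
        (show 0 < (w.subst fun _ => .dpar (.var 1)).count y from hy)
      obtain rfl := h2 z hz1
      exact ⟨(PTerm.count_var_pos.1 (show 0 < (PTerm.var 1).count y from hz2)).symm, hz1⟩
    have h4' : 0 < w.count 0 → (interleave l₁ fun _ => some k) 1 = some k ∧
        (interleave E₁ fun _ => E x) 1 = ⟨true, C⟩ := fun hw =>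
      ⟨rfl, by simpa [interleave] using (h4 hw).2⟩
    have h5' := h5
    rw [← resetLevels_lowerLevels (c + 1)] at h5'
    -- The box is not cut; only its free variable is exchanged for a fresh one, of the odd index 1.
    refine ⟨.app (t'.rename fun n => 2 * n) (.par (w.subst fun _ => .dpar (.var 1))),
      interleave E₁ fun _ => E x, interleave l₁ fun _ => some k, interleave s₁ fun _ => .var x, ?_,
      .appBox (h1'.rename fun y _ => by simp) h2 h3 h4' h5' (.box h2 h4' ?_ h5'), ?_⟩
    · simp only [PTerm.subst, PTerm.rename_subst, interleave_even, PTerm.subst_subst]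
      rfl
    · intro j n hn
      obtain ⟨i, hi, rfl⟩ := lowerLevels_eq_some.1 hn
      have := hrho j i hi
      omega
    · intro y hy
      rcases Nat.add_pos_iff_pos_or_pos.1 hy with hy | hy
      · obtain ⟨z, rfl, hz1, e⟩ := even_pos hy
        have : (PTerm.par (w.subst fun _ => .dpar (.var 1))).count (2 * z) = 0 := by
          by_contra h0
          have := (hw _ (Nat.pos_of_ne_zero h0)).1
          omega
        rw [PTerm.count, this, interleave_even, interleave_even, interleave_even, e, Nat.add_zero]
        exact (hcut1 z hz1).mono le_rfl fun p v hp => ⟨_, hp.fn _, rfl⟩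
      · obtain ⟨rfl, hw0⟩ := hw y hy
        exact Or.inl ⟨x, k, rfl, rfl, by rw [(h4 hw0).1, hK], rfl⟩
  | @tlam E l rho K t A h ih =>
    obtain ⟨t', E', l', s, rfl, h', hcut⟩ := ih (fun j n hn => by
      rcases j with _ | j
      · simp only [scons_zero, Option.some.injEq] at hn
        omega
      · exact hrho j n hn) hK
    have hcut' := fun y hy => (hcut y hy).of_tlam (by omega)
    refine ⟨.tlam t', fun y => (E' y).rename Nat.pred, l', fun y => (s y).renameTy Nat.pred, ?_,
      .tlam ?_, fun y hy => (hcut' y hy).2.2⟩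
    · simp only [PTerm.subst, PTerm.tlam.injEq]
      exact PTerm.subst_congr fun y hy => (hcut' y hy).2.1
    · have e : lowerLevels (c + 1) (scons (some K) rho)
          = scons (some k) (lowerLevels (c + 1) rho) := by
        funext j
        cases j with
        | zero =>
          simp only [lowerLevels, scons_zero, Option.map_some, Option.some.injEq]
          omega
        | succ j => rfl
      rw [e] at h'
      exact h'.congr_env fun y hy => ⟨(hcut' y hy).1, fun n hn => hn⟩
  | @tapp E l rho K t A B h hs ih =>
    obtain ⟨t', E', l', s, rfl, h', hcut⟩ := ih hrho hK
    exact ⟨.tapp t' B, E', l', s, rfl, .tapp h' (hs.lowerLevels _), fun y hy =>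
      (hcut y hy).mono le_rfl fun p v hp => ⟨_, hp.tapp _, rfl⟩⟩
  | @par E l rho K t A h ih =>
    obtain ⟨t', E', l', s, rfl, h', hcut⟩ := ih (fun j n hn => (hrho j n hn).trans (Nat.le_succ K)) (k := k + 1)
      (by omega)
    refine ⟨.par t', E', l', s, rfl, .par h', fun y hy =>
      (hcut y hy).mono le_rfl fun p v hp => ⟨_, hp.par, ?_⟩⟩
    simp only [word, sum]
    push_cast
    ring
  | @dpar E l rho K t A h ih =>
    cases k with
    | zero =>
      obtain rfl : K = c := by omega
      -- This is a drop from `c + 1` to `c`, so the whole term becomes the piece and a single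
      -- variable remains.
      refine ⟨.var 0, fun _ => ⟨false, A⟩, fun _ => some 0, fun _ => .dpar t, rfl,
        .var (E := fun _ => ⟨false, A⟩) rfl (h.scoped_type.of_kill.lowerLevels _), ?_⟩
      intro y hy
      obtain rfl := PTerm.count_var_pos.1 hy
      refine Or.inr ⟨t, A, rfl, rfl, rfl, le_rfl, h, _, t, (Occ.here t).dpar, ?_,
        fun z hz => ⟨z, hz⟩⟩
      simp [word, sum]
    | succ k =>
      obtain ⟨t', E', l', s, rfl, h', hcut⟩ := ih (fun j n hn => (kill_eq_some.1 hn).2) (k := k) (by omega)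
      obtain rfl : K = c + 1 + k := by omega
      refine ⟨.dpar t', E', l', s, rfl, .dpar ?_, fun y hy =>
        ((hcut y hy).of_kill (by omega)).mono le_rfl fun p v hp => ⟨_, hp.dpar, ?_⟩⟩
      · rw [kill_lowerLevels]
        refine h'.congr_env fun y hy => ⟨rfl, fun n hn => kill_eq_some.2 ⟨hn, ?_⟩⟩
        rcases hcut y hy with ⟨x, i, -, -, h3, h4⟩ | ⟨v, C, -, -, h3, -⟩
        · rw [kill_eq_some] at h3
          rw [h4, Option.some.injEq] at hn
          omega
        · rw [h3, Option.some.injEq] at hn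
          omega
      · simp only [word, sum]
        push_cast
        ring

/-! ### From the conditions to a leveling -/

/-- Below a path of sum `k`, no prefix of the word `w` leads to a sum below `n`. -/
def Above (n : ℕ) (k : ℤ) (w : List Modal) : Prop := ∀ w', w' <+: w → (n : ℤ) ≤ k + sum w'

theorem above_nil {n : ℕ} {k : ℤ} : Above n k [] ↔ (n : ℤ) ≤ k := by
  simp [Above, sum]

theorem above_cons {n : ℕ} {k : ℤ} {m : Modal} {w : List Modal} :
    Above n k (m :: w) ↔ (n : ℤ) ≤ k ∧ Above n (k + sum [m]) w := by
  have e (w' : List Modal) : sum (m :: w') = sum [m] + sum w' := by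
    cases m <;> simp [sum]
  constructor
  · intro h
    refine ⟨by simpa [sum] using h [] (List.nil_prefix), fun w' hw => ?_⟩
    have := h (m :: w') (List.cons_prefix_cons.2 ⟨rfl, hw⟩)
    rw [e] at this
    omega
  · rintro ⟨h1, h2⟩ w' hw
    rcases List.prefix_cons_iff.1 hw with rfl | ⟨w'', rfl, h⟩
    · simpa [sum] using h1
    · have := h2 w'' h
      rw [e]
      omega

theorem above_par {n : ℕ} {k : ℤ} {w : List Modal} :
    Above n k (.par :: w) ↔ (n : ℤ) ≤ k ∧ Above n (k + 1) w := above_cons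

theorem above_dpar {n : ℕ} {k : ℤ} {w : List Modal} :
    Above n k (.dpar :: w) ↔ (n : ℤ) ≤ k ∧ Above n (k - 1) w := above_cons

theorem Above.le {n : ℕ} {k : ℤ} {w : List Modal} (h : Above n k w) : (n : ℤ) ≤ k := by
  simpa [sum] using h [] List.nil_prefix

theorem weaklyWellBracketed_iff (k : ℕ) {w : List Modal} :
    WeaklyWellBracketed w ↔ Above k k w := by
  constructor
  · intro h w' hw
    have := h w' hw
    omega
  · intro h w' hw
    have := h w' hw
    omega

theorem wellBracketed_iff (k : ℕ) {w : List Modal} :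
    WellBracketed w ↔ Above k k w ∧ (k : ℤ) + sum w = k := by
  rw [WellBracketed, weaklyWellBracketed_iff k]
  simp

namespace FreeAt

variable {t u : PTerm} {p : List Step} {x : ℕ}

theorem lam (D : StarTy) (h : FreeAt t p (x + 1)) : FreeAt (.lam D t) (.lam D :: p) x := by
  have : Occ t p (.var (x + 1 + lamDepth p)) := h
  rw [Nat.add_right_comm] at this
  exact this.lam D

theorem fn (s : PTerm) (h : FreeAt t p x) : FreeAt (.app t s) (.fn :: p) x := Occ.fn s h

theorem arg (s : PTerm) (h : FreeAt t p x) : FreeAt (.app s t) (.arg :: p) x := Occ.arg s h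

theorem tlam (h : FreeAt t p x) : FreeAt (.tlam t) (.tlam :: p) x := Occ.tlam h

theorem tapp (A : LinTy) (h : FreeAt t p x) : FreeAt (.tapp t A) (.tapp :: p) x := Occ.tapp A h

theorem par (h : FreeAt t p x) : FreeAt (.par t) (.par :: p) x := Occ.par h

theorem dpar (h : FreeAt t p x) : FreeAt (.dpar t) (.dpar :: p) x := Occ.dpar h

end FreeAt

theorem freeAt_var (x : ℕ) : FreeAt (.var x) [] x := Occ.here _

namespace PTerm

theorem count_pos_iff {t : PTerm} {x : ℕ} : 0 < t.count x ↔ ∃ p, FreeAt t p x := by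
  constructor
  · intro h
    induction t generalizing x with
    | var y => exact count_var_pos.1 h ▸ ⟨[], freeAt_var y⟩
    | lam D t ih => exact let ⟨p, hp⟩ := ih h; ⟨_, hp.lam D⟩
    | app t u iht ihu =>
      rcases Nat.add_pos_iff_pos_or_pos.1 h with h | h
      · exact let ⟨p, hp⟩ := iht h; ⟨_, hp.fn u⟩
      · exact let ⟨p, hp⟩ := ihu h; ⟨_, hp.arg t⟩
    | tlam t ih => exact let ⟨p, hp⟩ := ih h; ⟨_, hp.tlam⟩
    | tapp t A ih => exact let ⟨p, hp⟩ := ih h; ⟨_, hp.tapp A⟩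
    | par t ih => exact let ⟨p, hp⟩ := ih h; ⟨_, hp.par⟩
    | dpar t ih => exact let ⟨p, hp⟩ := ih h; ⟨_, hp.dpar⟩
  · rintro ⟨p, hp⟩
    unfold FreeAt at hp
    generalize e : PTerm.var (x + lamDepth p) = v at hp
    induction hp generalizing x with
    | here t => subst e; simp [count, lamDepth]
    | lam D h ih => exact ih (by rw [← e, lamDepth, Nat.add_right_comm]; rfl)
    | fn s h ih => exact Nat.add_pos_left (ih e) _
    | arg s h ih => exact Nat.add_pos_right _ (ih e)
    | tlam h ih => exact ih e
    | tapp A h ih => exact ih e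
    | par h ih => exact ih e
    | dpar h ih => exact ih e

theorem count_le_one {t : PTerm} {x : ℕ} (h : ∀ p q, FreeAt t p x → FreeAt t q x → p = q) :
    t.count x ≤ 1 := by
  induction t generalizing x with
  | var y => simp only [count]; split_ifs <;> simp
  | lam D t ih => exact ih fun p q hp hq => (List.cons.inj (h _ _ (hp.lam D) (hq.lam D))).2
  | app t u iht ihu =>
    have h1 := iht fun p q hp hq => (List.cons.inj (h _ _ (hp.fn u) (hq.fn u))).2
    have h2 := ihu fun p q hp hq => (List.cons.inj (h _ _ (hp.arg t) (hq.arg t))).2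
    by_contra hc
    simp only [count] at hc
    obtain ⟨p, hp⟩ := count_pos_iff.1 (show 0 < t.count x by omega)
    obtain ⟨q, hq⟩ := count_pos_iff.1 (show 0 < u.count x by omega)
    simpa using h _ _ (hp.fn u) (hq.arg t)
  | tlam t ih => exact ih fun p q hp hq => (List.cons.inj (h _ _ hp.tlam hq.tlam)).2
  | tapp t A ih => exact ih fun p q hp hq => (List.cons.inj (h _ _ (hp.tapp A) (hq.tapp A))).2
  | par t ih => exact ih fun p q hp hq => (List.cons.inj (h _ _ hp.par hq.par)).2
  | dpar t ih => exact ih fun p q hp hq => (List.cons.inj (h _ _ hp.dpar hq.dpar)).2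

/-- Going down, always into the function part of an application, one meets a variable or an
abstraction. The bracketing condition constrains only these, and in this way it controls the sums at
all other positions. -/
theorem exists_freeAt_or_lam (t : PTerm) :
    (∃ p x, FreeAt t p x) ∨ ∃ p D v, Occ t p (.lam D v) := by
  induction t with
  | var y => exact Or.inl ⟨[], y, freeAt_var y⟩
  | lam D t ih => exact Or.inr ⟨[], D, t, .here _⟩
  | app t u iht ihu =>
    rcases iht with ⟨p, x, h⟩ | ⟨p, D, v, h⟩
    exacts [Or.inl ⟨_, x, h.fn u⟩, Or.inr ⟨_, D, v, h.fn u⟩]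
  | tlam t ih =>
    rcases ih with ⟨p, x, h⟩ | ⟨p, D, v, h⟩
    exacts [Or.inl ⟨_, x, h.tlam⟩, Or.inr ⟨_, D, v, h.tlam⟩]
  | tapp t A ih =>
    rcases ih with ⟨p, x, h⟩ | ⟨p, D, v, h⟩
    exacts [Or.inl ⟨_, x, h.tapp A⟩, Or.inr ⟨_, D, v, h.tapp A⟩]
  | par t ih =>
    rcases ih with ⟨p, x, h⟩ | ⟨p, D, v, h⟩
    exacts [Or.inl ⟨_, x, h.par⟩, Or.inr ⟨_, D, v, h.par⟩]
  | dpar t ih =>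
    rcases ih with ⟨p, x, h⟩ | ⟨p, D, v, h⟩
    exacts [Or.inl ⟨_, x, h.dpar⟩, Or.inr ⟨_, D, v, h.dpar⟩]

end PTerm

/-- The conditions on a decoration, for a subterm `t` that stands below a path whose word has sum
`k`; see `Leveled` for the meaning of `l` and `rho`. -/
structure Decorated (E : Env) (l rho : ℕ → Option ℕ) (k : ℕ) (t : PTerm) (A : LinTy) : Prop where
  outTy : OutTy E t A
  linear : ∀ r D v, Occ t r (.lam D v) →
    ∀ p q, FreeAt v p 0 → FreeAt v q 0 → p ≠ q → D.bang = true
  free : ∀ p x, FreeAt t p x → ∃ n, l x = some n ∧ Above n k (word p) ∧ (k : ℤ) + sum (word p) = n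
  lam : ∀ p D v, Occ t p (.lam D v) →
    Above 0 k (word p) ∧ ∀ q, FreeAt v q 0 → WellBracketed (word q)
  scope : ScopeCondition E t
  scopeOuter : ∀ j q v, Occ t q v → DependsOn (envAt E q) v (j + tlamDepth q) →
    ∃ n, rho j = some n ∧ Above n k (word q)
  bang : BangCondition E t

namespace Decorated

variable {E : Env} {l rho : ℕ → Option ℕ} {k : ℕ} {t u : PTerm} {A B : LinTy} {D : StarTy}

theorem scoped_type (h : Decorated E l rho k t A) : Scoped rho A := fun j hj =>
  let ⟨n, hn⟩ := h.scopeOuter j [] t (.here t) (Or.inl ⟨A, h.outTy, hj⟩)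
  ⟨n, hn.1⟩

/-- Bracketing of the bound variable is relative to its binder. Seen from level `k` it says that the
level stays at least `k` and returns to `k`, hence the level `k` for index 0. -/
theorem lam_body (h : Decorated E l rho k (.lam D t) A) (ht : OutTy (scons D E) t B) :
    Decorated (scons D E) (scons (some k) l) rho k t B where
  outTy := ht
  linear r D' v hv := h.linear (.lam D :: r) D' v (hv.lam D)
  free p x hx := by
    cases x with
    | zero => exact ⟨k, rfl, (wellBracketed_iff k).1 ((h.lam [] D t (.here _)).2 p hx)⟩
    | succ x => exact h.free (.lam D :: p) x (hx.lam D)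
  lam p D' v hv := h.lam (.lam D :: p) D' v (hv.lam D)
  scope p v hv := h.scope (.lam D :: p) v (hv.lam D)
  scopeOuter j q v hv := h.scopeOuter j (.lam D :: q) v (hv.lam D)
  bang E' v := fun ⟨p, r, A', B', h1, h2⟩ => h.bang E' v ⟨_, r, A', B', h1.lam D, h2⟩

theorem app_fn (h : Decorated E l rho k (.app t u) A) (ht : OutTy E t B) :
    Decorated E l rho k t B where
  outTy := ht
  linear r D' v hv := h.linear (.fn :: r) D' v (hv.fn u)
  free p x hx := h.free (.fn :: p) x (hx.fn u)
  lam p D' v hv := h.lam (.fn :: p) D' v (hv.fn u)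
  scope p v hv := h.scope (.fn :: p) v (hv.fn u)
  scopeOuter j q v hv := h.scopeOuter j (.fn :: q) v (hv.fn u)
  bang E' v := fun ⟨_, r, A', B', h1, h2⟩ => h.bang E' v ⟨_, r, A', B', h1.fn u, h2⟩

theorem app_arg (h : Decorated E l rho k (.app t u) A) (ht : OutTy E u B) :
    Decorated E l rho k u B where
  outTy := ht
  linear r D' v hv := h.linear (.arg :: r) D' v (hv.arg t)
  free p x hx := h.free (.arg :: p) x (hx.arg t)
  lam p D' v hv := h.lam (.arg :: p) D' v (hv.arg t)
  scope p v hv := h.scope (.arg :: p) v (hv.arg t)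
  scopeOuter j q v hv := h.scopeOuter j (.arg :: q) v (hv.arg t)
  bang E' v := fun ⟨_, r, A', B', h1, h2⟩ => h.bang E' v ⟨_, r, A', B', h1.arg t, h2⟩

theorem tlam_body (h : Decorated E l rho k (.tlam t) A) (ht : OutTy E.liftTy t B) :
    Decorated E.liftTy l (scons (some k) rho) k t B where
  outTy := ht
  linear r D' v hv := h.linear (.tlam :: r) D' v hv.tlam
  free p x hx := h.free (.tlam :: p) x hx.tlam
  lam p D' v hv := h.lam (.tlam :: p) D' v hv.tlam
  scope p v hv := h.scope (.tlam :: p) v hv.tlam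
  scopeOuter j q v hv hd := by
    cases j with
    | zero =>
      rw [Nat.zero_add] at hd
      exact ⟨k, rfl, (weaklyWellBracketed_iff k).1 (h.scope [] t (.here _) q v hv hd)⟩
    | succ j =>
      rw [Nat.add_right_comm] at hd
      exact h.scopeOuter j (.tlam :: q) v hv.tlam hd
  bang E' v := fun ⟨p, r, A', B', h1, h2⟩ => h.bang E' v ⟨_, r, A', B', h1.tlam, h2⟩

theorem tapp_fn (h : Decorated E l rho k (.tapp t B) A) {A' : LinTy} (ht : OutTy E t A') :
    Decorated E l rho k t A' where
  outTy := ht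
  linear r D' v hv := h.linear (.tapp :: r) D' v (hv.tapp B)
  free p x hx := h.free (.tapp :: p) x (hx.tapp B)
  lam p D' v hv := h.lam (.tapp :: p) D' v (hv.tapp B)
  scope p v hv := h.scope (.tapp :: p) v (hv.tapp B)
  scopeOuter j q v hv := h.scopeOuter j (.tapp :: q) v (hv.tapp B)
  bang E' v := fun ⟨_, r, A', B', h1, h2⟩ => h.bang E' v ⟨_, r, A', B', h1.tapp B, h2⟩

theorem par_body (h : Decorated E l rho k (.par t) A) (ht : OutTy E t B) :
    Decorated E l rho (k + 1) t B where
  outTy := ht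
  linear r D' v hv := h.linear (.par :: r) D' v hv.par
  free p x hx := by
    obtain ⟨n, h1, h2, h3⟩ := h.free (.par :: p) x hx.par
    simp only [word, above_par, sum] at h2 h3
    push_cast
    exact ⟨n, h1, h2.2, by omega⟩
  lam p D' v hv := by
    obtain ⟨h1, h2⟩ := h.lam (.par :: p) D' v hv.par
    simp only [word, above_par] at h1
    push_cast
    exact ⟨h1.2, h2⟩
  scope p v hv := h.scope (.par :: p) v hv.par
  scopeOuter j q v hv hd := by
    obtain ⟨n, h1, h2⟩ := h.scopeOuter j (.par :: q) v hv.par hd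
    simp only [word, above_par] at h2
    push_cast
    exact ⟨n, h1, h2.2⟩
  bang E' v := fun ⟨p, r, A', B', h1, h2⟩ => h.bang E' v ⟨_, r, A', B', h1.par, h2⟩

/-- From level 0 a `§̄` would give a negative prefix sum on the way to some variable or abstraction
below it. -/
theorem dpar_pos (h : Decorated E l rho k (.dpar t) A) : 0 < k := by
  rcases t.exists_freeAt_or_lam with ⟨p, x, hx⟩ | ⟨p, D, v, hv⟩
  · obtain ⟨n, -, h2, -⟩ := h.free _ x hx.dpar
    simp only [word, above_dpar] at h2
    have := h2.2.le
    omega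
  · have h2 := (h.lam _ D v hv.dpar).1
    simp only [word, above_dpar] at h2
    have := h2.2.le
    omega

/-- The path to anything below the `§̄` passes through level `k`. If the level must not fall below
`n` on this path, then `n ≤ k`, so whatever is still used survives the forgetting. -/
theorem dpar_body (h : Decorated E l rho (k + 1) (.dpar t) A) (ht : OutTy E t B) :
    Decorated E (kill k l) (kill k rho) k t B where
  outTy := ht
  linear r D' v hv := h.linear (.dpar :: r) D' v hv.dpar
  free p x hx := by
    obtain ⟨n, h1, h2, h3⟩ := h.free (.dpar :: p) x hx.dpar
    simp only [word, above_dpar, sum] at h2 h3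
    push_cast at h2 h3
    rw [add_sub_cancel_right] at h2
    have := h2.2.le
    exact ⟨n, kill_eq_some.2 ⟨h1, by omega⟩, h2.2, by omega⟩
  lam p D' v hv := by
    obtain ⟨h1, h2⟩ := h.lam (.dpar :: p) D' v hv.dpar
    simp only [word, above_dpar] at h1
    push_cast at h1
    rw [add_sub_cancel_right] at h1
    exact ⟨h1.2, h2⟩
  scope p v hv := h.scope (.dpar :: p) v hv.dpar
  scopeOuter j q v hv hd := by
    obtain ⟨n, h1, h2⟩ := h.scopeOuter j (.dpar :: q) v hv.dpar hd
    simp only [word, above_dpar] at h2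
    push_cast at h2
    rw [add_sub_cancel_right] at h2
    have := h2.2.le
    exact ⟨n, kill_eq_some.2 ⟨h1, by omega⟩, h2.2⟩
  bang E' v := fun ⟨p, r, A', B', h1, h2⟩ => h.bang E' v ⟨_, r, A', B', h1.dpar, h2⟩

end Decorated

theorem Occ.unique {t u v : PTerm} {p : List Step} (h : Occ t p u) (h' : Occ t p v) : u = v := by
  induction h with
  | here t => cases h'; rfl
  | lam D h ih => cases h' with | lam _ h' => exact ih h'
  | fn s h ih => cases h' with | fn _ h' => exact ih h'
  | arg s h ih => cases h' with | arg _ h' => exact ih h'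
  | tlam h ih => cases h' with | tlam h' => exact ih h'
  | tapp A h ih => cases h' with | tapp _ h' => exact ih h'
  | par h ih => cases h' with | par h' => exact ih h'
  | dpar h ih => cases h' with | dpar h' => exact ih h'

theorem OutTy.var_eq {E : Env} {x : ℕ} {A : LinTy} (h : OutTy E (.var x) A) : A = (E x).out := by
  generalize e : PTerm.var x = t at h
  cases h with
  | var => cases e; rfl
  | _ => cases e

theorem StarTy.eq_of_out_par {D : StarTy} {A : LinTy} (hb : D.bang = true) (h : D.out = A.par) :
    D = ⟨true, A⟩ := by
  rcases D with ⟨b, B⟩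
  cases hb
  simp only [StarTy.out, ↓reduceIte, LinTy.par.injEq] at h
  rw [h]

/-- A bang subterm of the form `§ u` is closed, or it contains exactly one free variable, below a
single `§̄` that matches the outermost `§`. -/
theorem Leveled.exists_box {E : Env} {l rho : ℕ → Option ℕ} {k : ℕ} {u : PTerm} {A : LinTy}
    (h : Leveled E l rho (k + 1) u A) (hl : ∀ x n, l x = some n → n ≤ k)
    (hrho : ∀ j n, rho j = some n → n ≤ k)
    (hone : ∀ p q x y, FreeAt (.par u) p x → FreeAt (.par u) q y → p = q)
    (hbang : ∀ p x, FreeAt (.par u) p x → (E x).bang = true)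
    (hpos : ∀ p v, Occ (.par u) p v → p ≠ [] → (¬ ∃ x, FreeAt (.par u) p x) →
      1 ≤ sum (word p)) :
    ∃ w x C, u = w.subst (fun _ => .dpar (.var x)) ∧ (∀ y, 0 < w.count y → y = 0) ∧
      w.count 0 ≤ 1 ∧ (0 < w.count 0 → l x = some k ∧ E x = ⟨true, C⟩) ∧
      Leveled (fun _ => ⟨false, C⟩) (fun _ => some 0) (resetLevels rho) 0 w A := by
  -- The cut is made at every place where the outer `§` is undone, that is, where the level returns
  -- from `k + 1` to `k`.
  obtain ⟨w, E', l', s, hu, hw, hcut⟩ :=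
    h.cut (fun j n hn => (hrho j n hn).trans (Nat.le_succ k)) (c := k) (k := 0) rfl
  -- Levels are at most `k`, so lowering by `k + 1` sends all of them to 0.
  have hrho' : lowerLevels (k + 1) rho = resetLevels rho := by
    funext j
    cases e : rho j with
    | none => simp [lowerLevels, resetLevels, e]
    | some n =>
      have := hrho j n e
      simp only [lowerLevels, e, Option.map_some, resetLevels, Option.some.injEq]
      omega
  rw [hrho'] at hw
  have hhole : ∀ y, 0 < w.count y → ∃ z C, s y = .dpar (.var z) ∧ 0 < u.count z ∧
      E z = ⟨true, C⟩ ∧ l z = some k ∧ E' y = ⟨false, C⟩ ∧ l' y = some 0 := by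
    intro y hy
    -- The first alternative would be a free variable bound above level `k`.
    rcases hcut y hy with ⟨x, i, -, -, h3, -⟩ | ⟨v, C, h1, h2, h3, -, h5, p, v', h6, h7, h8⟩
    · have := hl x _ h3
      omega
    -- Relative to the bang subterm the drop has sum 0, less than the required 1, so only the free
    -- variable can stand there.
    · have hfree : ∃ x, FreeAt (.par u) (.par :: p) x := by
        by_contra hc
        have := hpos _ _ h6.par (by simp) hc
        simp only [word, sum] at this
        push_cast at h7
        omega
      obtain ⟨x, hx⟩ := hfree
      obtain ⟨z, rfl⟩ := h8 _ (h6.par.unique hx)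
      have hz : 0 < u.count z := by
        rw [← hu]
        exact PTerm.count_subst_pos.2 ⟨y, hy, by simp [h1, PTerm.count]⟩
      obtain ⟨q, hq⟩ := PTerm.count_pos_iff.1 hz
      exact ⟨z, C, h1, hz, StarTy.eq_of_out_par (hbang _ z hq.par) h5.outTy.var_eq.symm,
        (kill_eq_some.1 h5.level_var).1, h2, h3⟩
  have huniq : ∀ z z', 0 < u.count z → 0 < u.count z' → z = z' := by
    intro z z' hz hz'
    obtain ⟨p, hp⟩ := PTerm.count_pos_iff.1 hz
    obtain ⟨q, hq⟩ := PTerm.count_pos_iff.1 hz'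
    have e := hone _ _ z z' hp.par hq.par
    simp only [List.cons.injEq, true_and] at e
    subst e
    have e := Occ.unique hp hq
    simpa using e
  obtain ⟨x, C, hx⟩ : ∃ x C, ∀ y, 0 < w.count y → s y = .dpar (.var x) ∧ E x = ⟨true, C⟩ ∧
      l x = some k ∧ E' y = ⟨false, C⟩ ∧ l' y = some 0 := by
    by_cases hc : ∃ y, 0 < w.count y
    · obtain ⟨y, hy⟩ := hc
      obtain ⟨x, C, h1, h2, h3, h4, h5, h6⟩ := hhole y hy
      refine ⟨x, C, fun y' hy' => ?_⟩
      obtain ⟨x', C', h1', h2', h3', h4', h5', h6'⟩ := hhole y' hy'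
      obtain rfl := huniq x x' h2 h2'
      have : C' = C := by
        rw [h3] at h3'
        cases h3'
        rfl
      exact ⟨h1', h3, h4, this ▸ h5', h6'⟩
    -- In a closed box the variable and its type are dummies.
    · exact ⟨0, .var 0, fun y hy => absurd ⟨y, hy⟩ hc⟩
  have hzero : ∀ y, 0 < (w.rename fun _ => 0).count y → y = 0 := by
    intro y hy
    obtain ⟨z, -, e⟩ := PTerm.count_rename_pos.1 hy
    exact e.symm
  have e : u = (w.rename fun _ => 0).subst fun _ => .dpar (.var x) := by
    rw [PTerm.rename_subst, ← hu]
    exact PTerm.subst_congr fun y hy => (hx y hy).1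
  refine ⟨w.rename fun _ => 0, x, C, e, hzero, ?_, ?_, hw.rename fun y hy => ?_⟩
  · have : u.count x = (w.rename fun _ => 0).count 0 := by
      rw [e]
      refine PTerm.count_subst fun z hz => ?_
      simp [hzero z hz, PTerm.count]
    rw [← this]
    refine PTerm.count_le_one fun p q hp hq => ?_
    simpa using hone _ _ x x hp.par hq.par
  · intro h0
    obtain ⟨y, hy, -⟩ := PTerm.count_rename_pos.1 h0
    exact ⟨(hx y hy).2.2.1, (hx y hy).2.1⟩
  · obtain ⟨-, -, -, h4, h5⟩ := hx y hy
    exact ⟨h4.symm, fun n hn => hn ▸ h5.symm⟩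

/-- Structural induction; the work is in the shape of a bang argument. Its type `§ A` excludes
abstractions of both kinds. In an application both children would have relative sum 0 and would both
have to be the unique free variable occurrence. In a type application the head would be a bang
variable, whose output type is a `§`-type and not a `∀`-type. A leading `§̄` is forbidden, so a
variable or a `§` remains. -/
theorem Decorated.leveled {E : Env} {l rho : ℕ → Option ℕ} {k : ℕ} {t : PTerm} {A : LinTy}
    (h : Decorated E l rho k t A) (hl : ∀ x n, l x = some n → n ≤ k)
    (hrho : ∀ j n, rho j = some n → n ≤ k) : Leveled E l rho k t A := by
  induction t generalizing E l rho k A with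
  | var x =>
    obtain rfl := h.outTy.var_eq
    obtain ⟨n, h1, -, h3⟩ := h.free [] x (freeAt_var x)
    have : k = n := by simpa [word, sum] using h3
    exact .var (this ▸ h1) fun j hj => h.scoped_type j (StarTy.hasFree_out.2 hj)
  | lam D t ih =>
    cases h.outTy with
    | @lam _ _ _ B ht =>
      refine .lam (fun j hj => h.scoped_type j (Or.inl hj)) ?_ (ih (h.lam_body ht) ?_ hrho)
      · intro hD
        refine PTerm.count_le_one fun p q hp hq => ?_
        by_contra hpq
        have := h.linear [] D t (.here _) p q hp hq hpq
        simp [hD] at this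
      · rintro (_ | x) n hn
        · simp only [scons_zero, Option.some.injEq] at hn
          omega
        · exact hl x n hn
  | app t u iht ihu =>
    cases h.outTy with
    | @app _ _ _ D B ht hu =>
      have h1 := iht (h.app_fn ht) hl hrho
      have h2 := ihu (h.app_arg hu) hl hrho
      rcases D with ⟨_ | _, C⟩
      · exact .app h1 h2
      · obtain ⟨hb1, hb2, hb3, hb4⟩ := h.bang E u ⟨[], t, C, _, .here _, rfl, ht, hu⟩
        -- A child reached without passing a modality has sum 0, and the bang condition allows this
        -- only for the free variable.
        have hchild : ∀ p v, Occ u [p] v → word [p] = [] → ∃ x, FreeAt u [p] x := by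
          intro p v hv hp
          by_contra hc
          have := hb3 _ v hv (by simp) hc
          simp [hp, sum] at this
        cases u with
        | var x =>
          refine .appVar h1 (StarTy.eq_of_out_par (hb2 [] x (freeAt_var x)) ?_) h2
          exact hu.var_eq.symm
        | lam D' t' => cases hu
        | app t' u' =>
          obtain ⟨x, hx⟩ := hchild .fn t' ((Occ.here t').fn u') rfl
          obtain ⟨y, hy⟩ := hchild .arg u' ((Occ.here u').arg t') rfl
          have := hb1 _ _ x y hx hy
          simp at this
        | tlam t' => cases hu
        | tapp t' B' =>
          obtain ⟨x, hx⟩ := hchild .tapp t' ((Occ.here t').tapp B') rfl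
          have hx' : t' = .var x := by
            cases hx with
            | tapp A h => cases h; rfl
          subst hx'
          have hbang := hb2 _ x hx
          generalize hP : (⟨true, C⟩ : StarTy).out = P at hu
          cases hu with
          | tapp B hA =>
            have := hA.var_eq
            simp [StarTy.out, hbang] at this
        | par u =>
          have h2' := h2
          cases h2' with
          | par h2' =>
            obtain ⟨w, x, C', rfl, hw1, hw2, hw3, hw4⟩ := h2'.exists_box hl hrho hb1 hb2 hb3
            exact .appBox h1 hw1 hw2 hw3 hw4 h2
        | dpar w => exact absurd rfl (hb4 w)
  | tlam t ih =>
    cases h.outTy with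
    | tlam ht =>
      refine .tlam (ih (h.tlam_body ht) hl ?_)
      rintro (_ | x) n hn
      · simp only [scons_zero, Option.some.injEq] at hn
        omega
      · exact hrho x n hn
  | tapp t B ih =>
    have ho := h.outTy
    generalize hP : PTerm.tapp t B = P at ho
    cases ho with
    | tapp _ ht =>
      cases hP
      refine .tapp (ih (h.tapp_fn ht) hl hrho) fun j hj => ?_
      obtain ⟨n, hn, -⟩ := h.scopeOuter j [] _ (.here _) (Or.inr ⟨t, B, rfl, hj⟩)
      exact ⟨n, hn⟩
    | _ => cases hP
  | par t ih =>
    cases h.outTy with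
    | par ht =>
      exact .par (ih (h.par_body ht) (fun x n hn => (hl x n hn).trans (Nat.le_succ k))
        fun x n hn => (hrho x n hn).trans (Nat.le_succ k))
  | dpar t ih =>
    obtain ⟨k, rfl⟩ := Nat.exists_eq_succ_of_ne_zero h.dpar_pos.ne'
    cases h.outTy with
    | dpar ht =>
      exact .dpar (ih (h.dpar_body ht) (fun x n hn => (kill_eq_some.1 hn).2)
        fun x n hn => (kill_eq_some.1 hn).2)

/-! ### Contexts, weakening and simultaneous contraction in DLAL -/

namespace Ctx

theorem distinct_iff {Γ Δ : Ctx} : Distinct Γ Δ ↔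
    (Γ.map Prod.fst).Nodup ∧ (Δ.map Prod.fst).Nodup ∧
      ∀ p ∈ Γ, ∀ q ∈ Δ, p.1 ≠ q.1 := by
  rw [Distinct, Multiset.map_add, Multiset.nodup_add, Multiset.disjoint_left]
  refine and_congr_right fun _ => and_congr_right fun _ => ⟨?_, ?_⟩
  · intro h p hp q hq e
    exact h (Multiset.mem_map_of_mem _ hp) (e ▸ Multiset.mem_map_of_mem _ hq)
  · intro h x hx hx'
    obtain ⟨p, hp, rfl⟩ := Multiset.mem_map.1 hx
    obtain ⟨q, hq, e⟩ := Multiset.mem_map.1 hx'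
    exact h p hp q hq e.symm

theorem Distinct.mono {Γ Δ Γ' Δ' : Ctx} (h : Distinct Γ Δ) (hΓ : Γ' ≤ Γ) (hΔ : Δ' ≤ Δ) :
    Distinct Γ' Δ' :=
  Multiset.nodup_of_le (Multiset.map_le_map (add_le_add hΓ hΔ)) h

theorem Distinct.eq_of_mem {Γ Δ : Ctx} (h : Distinct Γ Δ) {p q : ℕ × DType} (hp : p ∈ Γ + Δ)
    (hq : q ∈ Γ + Δ) (e : p.1 = q.1) : p = q :=
  Multiset.inj_on_of_nodup_map h p hp q hq e

theorem nodup_map_of_inj {S : Ctx} (h : (S.map Prod.fst).Nodup) {f : ℕ × DType → ℕ × DType}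
    {g : ℕ → ℕ} (hf : ∀ p, (f p).1 = g p.1) (hg : Function.Injective g) :
    ((S.map f).map Prod.fst).Nodup := by
  have e : (S.map f).map Prod.fst = (S.map Prod.fst).map g := by
    simp only [Multiset.map_map, Function.comp_def, hf]
  rw [e]
  exact h.map hg

theorem Distinct.lift {Γ Δ : Ctx} (h : Distinct Γ Δ) : Distinct Γ.lift Δ.lift := by
  have := nodup_map_of_inj (f := fun p => (p.1 + 1, p.2)) (g := Nat.succ) h (fun _ => rfl)
    Nat.succ_injective
  rwa [Multiset.map_add] at this

theorem Distinct.liftTy {Γ Δ : Ctx} (h : Distinct Γ Δ) : Distinct Γ.liftTy Δ.liftTy := by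
  have := nodup_map_of_inj (f := fun p => (p.1, p.2.shift)) (g := id) h (fun _ => rfl)
    Function.injective_id
  rwa [Multiset.map_add] at this

theorem zero_notMem_lift {S : Ctx} : 0 ∉ (Ctx.lift S).map Prod.fst := by
  simp [Ctx.lift]

theorem lift_add (Γ Δ : Ctx) : Ctx.lift (Γ + Δ) = Γ.lift + Δ.lift := Multiset.map_add _ _ _

theorem Distinct.cons_lift {Γ Δ : Ctx} (h : Distinct Γ Δ) (A : DType) :
    Distinct ((0, A) ::ₘ Γ.lift) Δ.lift := by
  rw [Distinct, Multiset.cons_add, Multiset.map_cons, Multiset.nodup_cons]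
  refine ⟨?_, h.lift⟩
  rw [← lift_add]
  exact zero_notMem_lift

theorem Distinct.lift_cons {Γ Δ : Ctx} (h : Distinct Γ Δ) (A : DType) :
    Distinct Γ.lift ((0, A) ::ₘ Δ.lift) := by
  rw [Distinct, Multiset.add_cons, Multiset.map_cons, Multiset.nodup_cons]
  refine ⟨?_, h.lift⟩
  rw [← lift_add]
  exact zero_notMem_lift

theorem Distinct.of_lift {Γ Δ : Ctx} (h : Distinct Γ.lift Δ.lift) : Distinct Γ Δ := by
  rw [Distinct, ← lift_add, Ctx.lift, Multiset.map_map] at h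
  refine Multiset.Nodup.of_map Nat.succ ?_
  rwa [Multiset.map_map]

theorem Distinct.of_liftTy {Γ Δ : Ctx} (h : Distinct Γ.liftTy Δ.liftTy) : Distinct Γ Δ := by
  rwa [Distinct, Ctx.liftTy, Ctx.liftTy, ← Multiset.map_add, Multiset.map_map] at h

theorem exists_bound (S : Ctx) : ∃ K, ∀ p ∈ S, p.1 < K := by
  refine ⟨(S.map Prod.fst).sum + 1, fun p hp => Nat.lt_succ_of_le ?_⟩
  exact Multiset.le_sum_of_mem (Multiset.mem_map_of_mem _ hp)

/-- The declarations with all variables renamed by adding `K`. -/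
def copy (K : ℕ) (Γ : Ctx) : Ctx := Γ.map (fun p => (p.1 + K, p.2))

theorem mem_copy {K : ℕ} {Γ : Ctx} {x : ℕ} {A : DType} (h : (x, A) ∈ Γ) :
    (x + K, A) ∈ Γ.copy K :=
  Multiset.mem_map_of_mem (fun p : ℕ × DType => (p.1 + K, p.2)) h

theorem Distinct.copy_add {Γ Δ : Ctx} (h : Distinct Γ Δ) {K : ℕ} (hK : ∀ p ∈ Γ + Δ, p.1 < K) :
    Distinct (Γ.copy K + Γ) Δ := by
  rw [Distinct, add_assoc, Multiset.map_add, Multiset.nodup_add]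
  refine ⟨?_, h, ?_⟩
  · exact nodup_map_of_inj (g := fun x => x + K) (distinct_iff.1 h).1 (fun _ => rfl)
      (add_left_injective K)
  · rw [Multiset.disjoint_left]
    intro x hx hx'
    simp only [Ctx.copy, Multiset.map_map, Multiset.mem_map, Function.comp_apply] at hx hx'
    obtain ⟨p, -, rfl⟩ := hx
    obtain ⟨q, hq, e⟩ := hx'
    have := hK q hq
    omega

end Ctx

theorem mem_starCtx {Γ Δ : Ctx} {x : ℕ} {D : StarTy} :
    (x, D) ∈ starCtx Γ Δ ↔ (x, D.ty.unstar) ∈ if D.bang then Γ else Δ := by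
  rcases D with ⟨b, B⟩
  simp only [starCtx, Multiset.mem_add, Multiset.mem_map, Prod.mk.injEq, StarTy.mk.injEq,
    Prod.exists]
  cases b
  · simp only [Bool.true_eq_false, false_and, and_false, exists_false, true_and, false_or,
      Bool.false_eq_true, ↓reduceIte]
    constructor
    · rintro ⟨y, A, h, rfl, rfl⟩
      simpa using h
    · exact fun h => ⟨x, _, h, rfl, by simp⟩
  · simp only [Bool.false_eq_true, false_and, and_false, exists_false, true_and, or_false,
      ↓reduceIte]
    constructor
    · rintro ⟨y, A, h, rfl, rfl⟩
      simpa using h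
    · exact fun h => ⟨x, _, h, rfl, by simp⟩

namespace Derives

theorem distinct {Γ Δ : Ctx} {M : FTerm} {A : DType} (h : Derives Γ Δ M A) :
    Ctx.Distinct Γ Δ := by
  induction h with
  | id x A => simp [Ctx.Distinct]
  | lolliI h ih => exact (ih.mono le_rfl (Multiset.le_cons_self _ _)).of_lift
  | lolliE hd h1 h2 ih1 ih2 => exact hd
  | implI h ih => exact (ih.mono (Multiset.le_cons_self _ _) le_rfl).of_lift
  | implE hd h1 h2 ih1 ih2 => exact hd
  | implE_closed h1 h2 ih1 ih2 => exact ih1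
  | weak hd h ih => exact hd
  | cntr hd h ih => exact hd
  | parI h ih =>
    simpa [Ctx.Distinct, Ctx.par, Function.comp_def] using ih
  | parE hd h1 h2 ih1 ih2 => exact hd
  | allI h ih => exact ih.of_liftTy
  | allE B h ih => exact ih

theorem weaken {Γ Δ Γ' Δ' : Ctx} {M : FTerm} {A : DType} (h : Derives Γ Δ M A) (hΓ : Γ ≤ Γ')
    (hΔ : Δ ≤ Δ') (hd : Ctx.Distinct Γ' Δ') : Derives Γ' Δ' M A := by
  obtain ⟨Γ₂, rfl⟩ := Multiset.le_iff_exists_add.1 hΓ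
  obtain ⟨Δ₂, rfl⟩ := Multiset.le_iff_exists_add.1 hΔ
  exact h.weak hd

/-- One contraction for each declaration of `Γ`, which identifies it with its copy `K` places
higher. The context `Γ₀` collects what has been contracted already; `K` exceeds all original names,
so these stay fixed. -/
theorem contract {Γ Γ₀ Δ : Ctx} {t : PTerm} {A : DType} {K : ℕ} (hK : ∀ p ∈ Γ + Γ₀, p.1 < K)
    (h : Derives (Γ.copy K + (Γ + Γ₀)) Δ t.erase A) :
    ∃ g : ℕ → ℕ, (∀ p ∈ Γ, g (p.1 + K) = p.1) ∧ (∀ y < K, g y = y) ∧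
      Derives (Γ + Γ₀) Δ (t.rename g).erase A := by
  induction Γ using Multiset.induction generalizing Γ₀ t with
  | empty =>
    refine ⟨fun n => n, by simp, fun y _ => rfl, ?_⟩
    simpa [Ctx.copy, PTerm.rename_id] using h
  | cons a Γ ih =>
    have e : Ctx.copy K (a ::ₘ Γ) + (a ::ₘ Γ + Γ₀)
        = (a.1 + K, a.2) ::ₘ (a.1, a.2) ::ₘ (Ctx.copy K Γ + (Γ + Γ₀)) := by
      simp only [Ctx.copy, Multiset.map_cons, Multiset.cons_add, Multiset.add_cons]
      exact Multiset.cons_swap _ _ _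
    rw [e] at h
    have h1 := h.cntr (h.distinct.mono (Multiset.le_cons_self _ _) le_rfl)
    rw [FTerm.merge, ← PTerm.erase_rename] at h1
    have e' : a ::ₘ Γ + Γ₀ = Γ + (a ::ₘ Γ₀) := by
      rw [Multiset.cons_add, Multiset.add_cons]
    have e'' : (a.1, a.2) ::ₘ (Ctx.copy K Γ + (Γ + Γ₀)) = Ctx.copy K Γ + (Γ + (a ::ₘ Γ₀)) := by
      simp only [Multiset.add_cons]
    rw [e''] at h1
    rw [e'] at hK ⊢
    obtain ⟨g, hg1, hg2, hg3⟩ := ih hK h1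
    rw [PTerm.rename_rename] at hg3
    have ha : a.1 < K := hK a (by simp)
    refine ⟨_, ?_, ?_, hg3⟩
    · intro p hp
      rcases Multiset.mem_cons.1 hp with rfl | hp
      · simp [hg2 _ ha]
      · have hpK : p.1 < K := hK p (by simp [hp])
        split_ifs with hif
        · have : p.1 = a.1 := by omega
          rw [hg2 _ ha, this]
        · exact hg1 p hp
    · intro y hy
      split_ifs with hif
      · rw [hg2 _ ha]; omega
      · exact hg2 y hy

end Derives

/-! ### From a leveling to a derivation -/

/-- The erasure of `t` has the type of `t` in DLAL, whatever names are given to the free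
variables. -/
def Der (E : Env) (t : PTerm) (A : LinTy) : Prop :=
  ∀ (f : ℕ → ℕ) (Γ Δ : Ctx), Ctx.Distinct Γ Δ →
    (∀ x, 0 < t.count x → (f x, E x) ∈ starCtx Γ Δ) →
    (∀ x y, 0 < t.count x → 0 < t.count y → (E x).bang = false → f x = f y → x = y) →
    Derives Γ Δ (t.rename f).erase A.unstar

namespace Der

variable {E E' : Env} {t u : PTerm} {A B : LinTy}

/-- A variable of type `!B` has the output type `§ B`: after (Id), rule (`§`i) moves a linear
declaration `x : B` to the nonlinear zone. -/
theorem var (E : Env) (x : ℕ) : Der E (.var x) (E x).out := by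
  intro f Γ Δ hd hm _
  have hx := mem_starCtx.1 (hm x (PTerm.count_var_pos.2 rfl))
  rcases hE : E x with ⟨_ | _, B⟩
  · simp only [hE, Bool.false_eq_true, ↓reduceIte] at hx
    exact (Derives.id (f x) B.unstar).weaken (Multiset.zero_le _) (Multiset.singleton_le.2 hx) hd
  · simp only [hE, ↓reduceIte] at hx
    have h : Derives {(f x, B.unstar)} (Ctx.par 0) (.var (f x)) B.unstar.par :=
      .parI (by simpa using Derives.id (f x) B.unstar)
    exact h.weaken (Multiset.singleton_le.2 hx) (Multiset.zero_le _) hd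

theorem lam {D : StarTy} (h : Der (scons D E) t B) : Der E (.lam D t) (D.lolli B) := by
  intro f Γ Δ hd hm hi
  have hm' : ∀ x, 0 < t.count (x + 1) → ∀ {Γ' Δ' : Ctx}, Γ.lift ≤ Γ' → Δ.lift ≤ Δ' →
      (f x + 1, E x) ∈ starCtx Γ' Δ' := by
    intro x hx Γ' Δ' hΓ hΔ
    have := mem_starCtx.1 (hm x hx)
    refine mem_starCtx.2 ?_
    split_ifs with hb
    · rw [if_pos hb] at this
      exact Multiset.mem_of_le hΓ
        (Multiset.mem_map_of_mem (fun p : ℕ × DType => (p.1 + 1, p.2)) this)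
    · rw [if_neg hb] at this
      exact Multiset.mem_of_le hΔ
        (Multiset.mem_map_of_mem (fun p : ℕ × DType => (p.1 + 1, p.2)) this)
  have hi' : ∀ x y, 0 < t.count x → 0 < t.count y → (scons D E x).bang = false →
      upRen f x = upRen f y → x = y := by
    rintro (_ | x) (_ | y) hx hy hb e
    · rfl
    · simp at e
    · simp at e
    · simp only [upRen_succ, Nat.add_right_cancel_iff] at e
      rw [hi x y hx hy hb e]
  rcases D with ⟨_ | _, A⟩
  · have := h (upRen f) Γ.lift ((0, A.unstar) ::ₘ Δ.lift) (hd.lift_cons _) ?_ hi'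
    · have h2 := this.lolliI
      rwa [LinTy.erase_unstar] at h2
    · rintro (_ | x) hx
      · simp [mem_starCtx]
      · exact hm' x hx le_rfl (Multiset.le_cons_self _ _)
  · have := h (upRen f) ((0, A.unstar) ::ₘ Γ.lift) Δ.lift (hd.cons_lift _) ?_ hi'
    · have h2 := this.implI
      rwa [LinTy.erase_unstar] at h2
    · rintro (_ | x) hx
      · simp [mem_starCtx]
      · exact hm' x hx (Multiset.le_cons_self _ _) le_rfl

theorem tlam (h : Der E.liftTy t A) : Der E (.tlam t) A.all := by
  intro f Γ Δ hd hm hi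
  refine .allI (h f _ _ hd.liftTy (fun x hx => ?_) hi)
  have := mem_starCtx.1 (hm x hx)
  have e : E.liftTy x = ⟨(E x).bang, (E x).ty.shift⟩ := rfl
  rw [e, mem_starCtx]
  simp only [LinTy.unstar_shift]
  by_cases hb : (E x).bang = true
  · rw [if_pos hb] at this ⊢
    exact Multiset.mem_map_of_mem (fun p : ℕ × DType => (p.1, p.2.shift)) this
  · rw [if_neg hb] at this ⊢
    exact Multiset.mem_map_of_mem (fun p : ℕ × DType => (p.1, p.2.shift)) this

theorem tapp (h : Der E t A.all) (B : LinTy) : Der E (.tapp t B) (A.inst B) := by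
  intro f Γ Δ hd hm hi
  have := (h f Γ Δ hd hm hi).allE B.unstar
  rwa [LinTy.erase_unstar, ← LinTy.unstar_inst] at this

theorem rename (h : Der E t A) {r : ℕ → ℕ} (hr : Function.Injective r)
    (hE : ∀ x, E' (r x) = E x) : Der E' (t.rename r) A := by
  intro f Γ Δ hd hm hi
  rw [PTerm.rename_rename]
  have hp : ∀ x, 0 < t.count x → 0 < (t.rename r).count (r x) := fun x hx =>
    PTerm.count_rename_pos.2 ⟨x, hx, rfl⟩
  refine h _ Γ Δ hd (fun x hx => ?_) fun x y hx hy hb e => ?_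
  · rw [← hE]
    exact hm _ (hp x hx)
  · exact hr (hi _ _ (hp x hx) (hp y hy) (by rwa [hE]) e)

theorem of_rename {r q : ℕ → ℕ} (h : Der E' (t.rename r) A) (hr : ∀ x, q (r x) = x)
    (hE : ∀ x, E' (r x) = E x) : Der E t A := by
  intro f Γ Δ hd hm hi
  have e : (t.rename r).rename (fun x => f (q x)) = t.rename f := by
    simp only [PTerm.rename_rename, hr]
  rw [← e]
  refine h _ Γ Δ hd (fun x hx => ?_) fun x y hx hy hb e => ?_
  · obtain ⟨z, hz, rfl⟩ := PTerm.count_rename_pos.1 hx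
    rw [hr, hE]
    exact hm z hz
  · obtain ⟨z, hz, rfl⟩ := PTerm.count_rename_pos.1 hx
    obtain ⟨z', hz', rfl⟩ := PTerm.count_rename_pos.1 hy
    rw [hr, hr] at e
    rw [hE] at hb
    rw [hi z z' hz hz' hb e]

open Classical in
/-- The names of a renaming with the bang variables moved to a copy. -/
theorem copy_spec {f : ℕ → ℕ} {Γ Δ : Ctx} {K : ℕ} (hK : ∀ p ∈ Γ + Δ, p.1 < K)
    (hm : ∀ x, 0 < t.count x → (f x, E x) ∈ starCtx Γ Δ) {Δ₁ : Ctx}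
    (hΔ : ∀ x, 0 < t.count x → ∀ p ∈ Δ, p.1 = f x → p ∈ Δ₁) :
    (∀ x, 0 < t.count x → f x < K) ∧
    ∀ x, 0 < t.count x → ((if (E x).bang then f x + K else f x), E x) ∈ starCtx (Γ.copy K) Δ₁ := by
  constructor
  · intro x hx
    have := mem_starCtx.1 (hm x hx)
    split_ifs at this
    · exact hK _ (Multiset.mem_add.2 (Or.inl this))
    · exact hK _ (Multiset.mem_add.2 (Or.inr this))
  · intro x hx
    have := mem_starCtx.1 (hm x hx)
    refine mem_starCtx.2 ?_
    split_ifs with hb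
    · rw [if_pos hb] at this
      exact Ctx.mem_copy this
    · rw [if_neg hb] at this
      exact hΔ x hx _ this rfl

theorem copy_inj {f : ℕ → ℕ} {K : ℕ} (hK : ∀ x, 0 < t.count x → f x < K)
    (hi : ∀ x y, 0 < t.count x → 0 < t.count y → (E x).bang = false → f x = f y → x = y) :
    ∀ x y, 0 < t.count x → 0 < t.count y → (E x).bang = false →
      (if (E x).bang then f x + K else f x) = (if (E y).bang then f y + K else f y) → x = y := by
  intro x y hx hy hb e
  simp only [hb, Bool.false_eq_true, ↓reduceIte] at e
  have := hK x hx
  split_ifs at e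
  · omega
  · exact hi x y hx hy hb e

open Classical in
-- Both premises may need all of `Γ`, while (`⊸`e) wants disjoint contexts. The function is derived
-- over a copy of `Γ`, and the copy is contracted afterwards. The linear zone is split into the
-- names that occur in the function and the others; a linear variable cannot occur on both sides.
theorem app (h1 : Der E t (.arrow false A B)) (h2 : Der E u A)
    (hlin : ∀ x, (E x).bang = false → (PTerm.app t u).count x ≤ 1) : Der E (.app t u) B := by
  intro f Γ Δ hd hm hi
  obtain ⟨K, hK⟩ := Ctx.exists_bound (Γ + Δ)
  have ht : ∀ x, 0 < t.count x → 0 < (PTerm.app t u).count x := fun x hx => by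
    simp only [PTerm.count]; omega
  have hu : ∀ x, 0 < u.count x → 0 < (PTerm.app t u).count x := fun x hx => by
    simp only [PTerm.count]; omega
  set P : ℕ × DType → Prop := fun p => ∃ x, 0 < t.count x ∧ p.1 = f x with hP
  obtain ⟨hK', hmem⟩ := copy_spec (Δ₁ := Δ.filter P) hK (fun x hx => hm x (ht x hx))
    (fun x hx p hp e => Multiset.mem_filter.2 ⟨hp, x, hx, e⟩)
  have hd' := hd.copy_add hK
  have d1 := h1 _ _ _ (hd'.mono (Multiset.le_add_right _ _) (Multiset.filter_le P Δ)) hmem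
    (copy_inj hK' fun x y hx hy => hi x y (ht x hx) (ht y hy))
  have d2 := h2 f Γ (Δ.filter fun p => ¬ P p)
    (hd.mono le_rfl (Multiset.filter_le _ Δ)) ?_ fun x y hx hy => hi x y (hu x hx) (hu y hy)
  · have hΔ := Multiset.filter_add_not P Δ
    have d := Derives.lolliE (by rwa [hΔ]) d1 d2
    rw [hΔ] at d
    have d' : Derives (Γ.copy K + (Γ + 0)) Δ
        (PTerm.app (t.rename fun x => if (E x).bang then f x + K else f x) (u.rename f)).erase
        B.unstar := by
      rw [add_zero]; exact d
    obtain ⟨g, hg1, hg2, hg⟩ := d'.contract fun p hp => hK p (by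
      simp only [add_zero] at hp
      exact Multiset.mem_add.2 (Or.inl hp))
    rw [add_zero] at hg
    have e1 : (t.rename fun x => if (E x).bang then f x + K else f x).rename g = t.rename f := by
      rw [PTerm.rename_rename]
      refine PTerm.rename_congr fun x hx => ?_
      have := mem_starCtx.1 (hm x (ht x hx))
      split_ifs with hb
      · rw [if_pos hb] at this
        exact hg1 _ this
      · exact hg2 _ (hK' x hx)
    have e2 : (u.rename f).rename g = u.rename f := by
      rw [PTerm.rename_rename]
      refine PTerm.rename_congr fun x hx => hg2 _ ?_
      exact (copy_spec (t := u) hK (fun x hx => hm x (hu x hx)) (fun x hx p hp e => hp)).1 x hx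
    simpa only [PTerm.rename, e1, e2] using hg
  · intro x hx
    have := mem_starCtx.1 (hm x (hu x hx))
    refine mem_starCtx.2 ?_
    split_ifs with hb
    · rwa [if_pos hb] at this
    · rw [if_neg hb] at this
      refine Multiset.mem_filter.2 ⟨this, ?_⟩
      rintro ⟨y, hy, e⟩
      have hb' : (E x).bang = false := by simpa using hb
      obtain rfl := hi x y (hu x hx) (ht y hy) hb' e
      have := hlin x hb'
      simp only [PTerm.count] at this
      omega

/-- Rule (`⇒`e) takes an argument over one linear declaration and makes that declaration nonlinear.
This name may already be used by the function, which is therefore derived over a copy of `Γ` first.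
Of the decorated argument `u` only the erasure matters: it is the erasure of `w` with `x` for its
variable. -/
theorem appBang {w : PTerm} {C : LinTy} {x : ℕ} (h1 : Der E t (.arrow true A B))
    (hw : ∀ y, 0 < w.count y → y = 0) (hx : 0 < w.count 0 → E x = ⟨true, C⟩)
    (h2 : Der (fun _ => ⟨false, C⟩) w A) (hu : u.erase = (w.rename fun _ => x).erase)
    (hux : 0 < w.count 0 → 0 < u.count x) : Der E (.app t u) B := by
  intro f Γ Δ hd hm hi
  have ht : ∀ x, 0 < t.count x → 0 < (PTerm.app t u).count x := fun x hx => by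
    simp only [PTerm.count]; omega
  have hu' : (u.rename f).erase = (w.rename fun _ => f x).erase := by
    rw [PTerm.erase_rename, hu, ← PTerm.erase_rename, PTerm.rename_rename]
  have hinj : ∀ y z, 0 < w.count y → 0 < w.count z →
      ((fun _ => ⟨false, C⟩ : Env) y).bang = false → f x = f x → y = z := fun y z hy hz _ _ => by
    rw [hw y hy, hw z hz]
  by_cases h0 : 0 < w.count 0
  · obtain ⟨K, hK⟩ := Ctx.exists_bound (Γ + Δ)
    obtain ⟨hK', hmem⟩ := copy_spec (Δ₁ := Δ) hK (fun x hx => hm x (ht x hx))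
      (fun x hx p hp e => hp)
    have hd' := hd.copy_add hK
    have hxΓ : (f x, C.unstar) ∈ Γ := by
      have := mem_starCtx.1 (hm x (by have := hux h0; simp only [PTerm.count]; omega))
      simpa [hx h0] using this
    have hxK : f x < K := hK _ (Multiset.mem_add.2 (Or.inl hxΓ))
    have d1 := h1 _ _ _ (hd'.mono (Multiset.le_add_right _ _) le_rfl) hmem
      (copy_inj hK' fun x y hx hy => hi x y (ht x hx) (ht y hy))
    have d2 := h2 (fun _ => f x) 0 {(f x, C.unstar)} (by simp [Ctx.Distinct])
      (fun y hy => by simp [mem_starCtx]) hinj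
    have hle : (f x, C.unstar) ::ₘ Γ.copy K ≤ Γ.copy K + Γ := by
      rw [← Multiset.singleton_add, add_comm]
      exact add_le_add le_rfl (Multiset.singleton_le.2 hxΓ)
    have d := (Derives.implE (hd'.mono hle le_rfl) d1 d2).weaken hle le_rfl hd'
    have d' : Derives (Γ.copy K + (Γ + 0)) Δ
        (PTerm.app (t.rename fun x => if (E x).bang then f x + K else f x)
          (w.rename fun _ => f x)).erase B.unstar := by
      rw [add_zero]; exact d
    obtain ⟨g, hg1, hg2, hg⟩ := d'.contract fun p hp => hK p (by
      simp only [add_zero] at hp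
      exact Multiset.mem_add.2 (Or.inl hp))
    rw [add_zero] at hg
    have e1 : (t.rename fun x => if (E x).bang then f x + K else f x).rename g = t.rename f := by
      rw [PTerm.rename_rename]
      refine PTerm.rename_congr fun x hx => ?_
      have := mem_starCtx.1 (hm x (ht x hx))
      split_ifs with hb
      · rw [if_pos hb] at this
        exact hg1 _ this
      · exact hg2 _ (hK' x hx)
    simp only [PTerm.rename, e1, PTerm.rename_rename, hg2 _ hxK, PTerm.erase] at hg
    simpa only [PTerm.rename, PTerm.erase, hu'] using hg
  · have d1 := h1 f Γ Δ hd (fun x hx => hm x (ht x hx))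
      fun x y hx hy => hi x y (ht x hx) (ht y hy)
    have hc : ∀ y, 0 < w.count y → False := fun y hy => h0 (hw y hy ▸ hy)
    have d2 := h2 (fun _ => f x) 0 0 (by simp [Ctx.Distinct]) (fun y hy => (hc y hy).elim) hinj
    simpa only [PTerm.rename, PTerm.erase, hu'] using d1.implE_closed d2

open Classical in
-- Rule (`§`e) for the linear variable `p`, with the nonlinear zone doubled and the linear zone
-- split as for an application.
theorem cut {p : ℕ} {C : LinTy} (h1 : Der E t B) (hp : E p = ⟨false, C.par⟩) (hpt : 0 < t.count p)
    (h2 : Der E u C.par) (hpu : u.count p = 0)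
    (hlin : ∀ x, (E x).bang = false →
      (t.subst fun z => if z = p then u else .var z).count x ≤ 1) :
    Der E (t.subst fun z => if z = p then u else .var z) B := by
  intro f Γ Δ hd hm hi
  obtain ⟨K, hK⟩ := Ctx.exists_bound (Γ + Δ)
  have ht : ∀ x, x ≠ p → 0 < t.count x →
      0 < (t.subst fun z => if z = p then u else .var z).count x := fun x hxp hx =>
    PTerm.count_subst_pos.2 ⟨x, hx, by simp [hxp, PTerm.count]⟩
  have hu : ∀ x, 0 < u.count x →
      0 < (t.subst fun z => if z = p then u else .var z).count x := fun x hx =>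
    PTerm.count_subst_pos.2 ⟨p, hpt, by simpa using hx⟩
  -- A variable common to `t` and `u` occurs at least twice after the substitution, so it cannot be
  -- linear.
  have htu : ∀ x, 0 < u.count x → 0 < t.count x →
      1 < (t.subst fun z => if z = p then u else .var z).count x := by
    intro x hxu hxt
    have hxp : x ≠ p := by
      rintro rfl
      omega
    rw [PTerm.count_subst_two (p := x) (q := p) (a := 1) (b := u.count x)]
    · have : 0 < t.count p * u.count x := Nat.mul_pos hpt hxu
      omega
    · intro z _
      by_cases hz : z = p
      · simp [hz, hxp.symm]
      · simp [hz, PTerm.count]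
  set P : ℕ × DType → Prop := fun q => ∃ x, x ≠ p ∧ 0 < t.count x ∧ q.1 = f x with hP
  have hmt : ∀ x, x ≠ p → 0 < t.count x → (f x, E x) ∈ starCtx Γ Δ := fun x hxp hx =>
    hm x (ht x hxp hx)
  have hfK : ∀ x, (f x, E x) ∈ starCtx Γ Δ → f x < K := by
    intro x hx
    have := mem_starCtx.1 hx
    split_ifs at this
    · exact hK _ (Multiset.mem_add.2 (Or.inl this))
    · exact hK _ (Multiset.mem_add.2 (Or.inr this))
  have hd' := hd.copy_add hK
  -- The original names are below `K` and their copies below `2 * K`, so `2 * K` is a fresh name for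
  -- `p`.
  set F : ℕ → ℕ := fun z => if z = p then 2 * K else if (E z).bang then f z + K else f z with hF
  have hΔ := Multiset.filter_add_not P Δ
  have hd1 : Ctx.Distinct (Γ.copy K) ((2 * K, C.par.unstar) ::ₘ Δ.filter P) := by
    rw [Ctx.Distinct, Multiset.add_cons, Multiset.map_cons, Multiset.nodup_cons]
    refine ⟨?_, hd'.mono (Multiset.le_add_right _ _) (Multiset.filter_le P Δ)⟩
    intro hmem
    obtain ⟨q, hq, e⟩ := Multiset.mem_map.1 hmem
    rcases Multiset.mem_add.1 hq with hq | hq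
    · obtain ⟨q', hq', rfl⟩ := Multiset.mem_map.1 hq
      have := hK q' (Multiset.mem_add.2 (Or.inl hq'))
      simp only at e
      omega
    · have := hK q (Multiset.mem_add.2 (Or.inr (Multiset.mem_of_mem_filter hq)))
      omega
  have d1 := h1 F _ _ hd1 ?_ ?_
  · have d2 := h2 f Γ (Δ.filter fun q => ¬ P q) (hd.mono le_rfl (Multiset.filter_le _ Δ)) ?_
      fun x y hx hy => hi x y (hu x hx) (hu y hy)
    · have d := Derives.parE (by rw [add_comm, add_comm (Multiset.filter _ _), hΔ]; exact hd') d2 d1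
      have e0 : (t.rename F).erase.substVar (2 * K) (u.rename f).erase =
          ((t.rename F).subst fun z => if z = 2 * K then u.rename f else .var z).erase := by
        rw [PTerm.erase_subst, FTerm.substVar]
        congr 1
        funext z
        split_ifs <;> rfl
      rw [e0, add_comm Γ, add_comm (Multiset.filter _ _), hΔ, ← add_zero (_ + Γ), add_assoc] at d
      obtain ⟨g, hg1, hg2, hg⟩ := d.contract fun q hq => hK q (by
        simp only [add_zero] at hq
        exact Multiset.mem_add.2 (Or.inl hq))
      rw [add_zero, PTerm.subst_rename, PTerm.rename_subst] at hg
      rw [PTerm.subst_rename]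
      refine (congrArg (fun v : PTerm => Derives Γ Δ v.erase B.unstar)
        (PTerm.subst_congr fun z hz => ?_)).mp hg
      by_cases hzp : z = p
      · simp only [hF, hzp, ↓reduceIte, PTerm.rename_rename]
        refine PTerm.rename_congr fun x hx => hg2 _ (hfK x (hm x (hu x hx)))
      · have hz1 := hmt z hzp hz
        have hz2 := hfK z hz1
        have hz3 := mem_starCtx.1 hz1
        have hz4 : F z ≠ 2 * K := by
          simp only [hF, hzp, ↓reduceIte]
          split_ifs <;> omega
        simp only [hz4, hzp, ↓reduceIte, PTerm.rename, PTerm.var.injEq]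
        simp only [hF, hzp, ↓reduceIte]
        split_ifs with hb
        · rw [if_pos hb] at hz3
          exact hg1 _ hz3
        · exact hg2 _ hz2
    · intro x hx
      have := mem_starCtx.1 (hm x (hu x hx))
      refine mem_starCtx.2 ?_
      split_ifs with hb
      · rwa [if_pos hb] at this
      · rw [if_neg hb] at this
        refine Multiset.mem_filter.2 ⟨this, ?_⟩
        rintro ⟨y, hyp, hy, e⟩
        have hb' : (E x).bang = false := by simpa using hb
        obtain rfl := hi x y (hu x hx) (ht y hyp hy) hb' e
        have := hlin x hb'
        have := htu x hx hy
        omega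
  · intro x hx
    refine mem_starCtx.2 ?_
    by_cases hxp : x = p
    · simp [hF, hxp, hp]
    · have := mem_starCtx.1 (hmt x hxp hx)
      simp only [hF, hxp, ↓reduceIte]
      split_ifs with hb
      · rw [if_pos hb] at this
        exact Ctx.mem_copy this
      · rw [if_neg hb] at this
        exact Multiset.mem_cons_of_mem (Multiset.mem_filter.2 ⟨this, x, hxp, hx, rfl⟩)
  · intro x y hx hy hb e
    simp only [hF] at e
    by_cases hxp : x = p
    · by_cases hyp : y = p
      · rw [hxp, hyp]
      · have := hfK y (hmt y hyp hy)
        simp only [hxp, hyp, ↓reduceIte] at e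
        split_ifs at e <;> omega
    · have hxK := hfK x (hmt x hxp hx)
      simp only [hxp, hb, ↓reduceIte, Bool.false_eq_true] at e
      by_cases hyp : y = p
      · simp only [hyp, ↓reduceIte] at e
        omega
      · simp only [hyp, ↓reduceIte] at e
        split_ifs at e
        · omega
        · exact hi x y (ht x hxp hx) (ht y hyp hy) hb e

/-- The rule for `§` applied to a term whose variables are all linear. -/
theorem par_of_linear {r : ℕ → ℕ} (h : Der E' t A) (hr : Function.Injective r)
    (hE : ∀ y, 0 < t.count y → (E' y).bang = false ∧ E (r y) = ⟨false, (E' y).ty.par⟩) :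
    Der E (t.rename r) A.par := by
  intro f Γ Δ hd hm hi
  obtain ⟨R, hR⟩ := t.exists_finset_count_pos
  have hp : ∀ x, 0 < t.count x → 0 < (t.rename r).count (r x) := fun x hx =>
    PTerm.count_rename_pos.2 ⟨x, hx, rfl⟩
  have hinj : ∀ x y, 0 < t.count x → 0 < t.count y → f (r x) = f (r y) → x = y := by
    intro x y hx hy e
    refine hr (hi _ _ (hp x hx) (hp y hy) ?_ e)
    rw [(hE x hx).2]
  -- The linear zone is reduced to the variables that occur, since (`§`i) puts `§` on all of it and
  -- `Δ` may contain other types. The rest comes back by weakening.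
  set Δ₀ : Ctx := R.val.map fun y => (f (r y), (E' y).ty.unstar) with hΔ₀
  have hnd : (Δ₀.map Prod.fst).Nodup := by
    rw [hΔ₀, Multiset.map_map]
    exact Multiset.Nodup.map_on (fun x hx y hy e => hinj x y ((hR x).1 hx) ((hR y).1 hy) e) R.nodup
  rw [PTerm.rename_rename]
  have d := h (fun y => f (r y)) 0 Δ₀ (by simpa [Ctx.Distinct] using hnd) ?_
    fun x y hx hy _ e => hinj x y hx hy e
  · have d' := Derives.parI (Γ := 0) (Δ := Δ₀) (by rwa [zero_add])
    refine d'.weaken (Multiset.zero_le _) ?_ hd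
    refine (Multiset.le_iff_subset ?_).2 ?_
    · have : ((Ctx.par Δ₀).map Prod.fst).Nodup := by
        simpa [Ctx.par, Multiset.map_map, Function.comp_def] using hnd
      exact this.of_map
    · intro q hq
      obtain ⟨q', hq', rfl⟩ := Multiset.mem_map.1 hq
      obtain ⟨y, hy, rfl⟩ := Multiset.mem_map.1 hq'
      have hy' := (hR y).1 hy
      have := mem_starCtx.1 (hm _ (hp y hy'))
      simpa [(hE y hy').2, LinTy.unstar] using this
  · intro x hx
    refine mem_starCtx.2 ?_
    simp only [(hE x hx).1, Bool.false_eq_true, ↓reduceIte]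
    exact Multiset.mem_map_of_mem _ ((hR x).2 hx)

/-- The rule for `§` followed by the elimination of `§` for each variable. -/
theorem box {s : ℕ → PTerm} (h : Der E' t A) (hcount : ∀ y, t.count y ≤ 1)
    (hs : ∀ y, 0 < t.count y → (E' y).bang = false ∧ Der E (s y) (E' y).ty.par)
    (hlin : ∀ x, (E x).bang = false → (t.subst s).count x ≤ 1) : Der E (t.subst s) A.par := by
  -- Even indices are the variables of `t`, now of type `§ C`; odd indices are the variables of the
  -- terms to be substituted.
  set F : Env := interleave (fun y => ⟨false, (E' y).ty.par⟩) E with hF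
  -- Induction on the set `R` of variables already substituted: it starts with (`§`i) and each
  -- further element costs one (`§`e).
  have key : ∀ R : Finset ℕ, Der F (t.subst fun y =>
      if y ∈ R then (s y).rename (fun n => 2 * n + 1) else .var (2 * y)) A.par := by
    intro R
    induction R using Finset.induction_on with
    | empty =>
      simp only [Finset.notMem_empty, ↓reduceIte, PTerm.subst_var t fun y => 2 * y]
      refine h.par_of_linear (fun x y (e : 2 * x = 2 * y) => by omega) fun y hy => ⟨(hs y hy).1, ?_⟩
      simp [hF]
    | insert a R ha ih =>
      by_cases hat : 0 < t.count a
      · have e : (t.subst fun y => if y ∈ insert a R then (s y).rename (fun n => 2 * n + 1)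
            else .var (2 * y)) = (t.subst fun y =>
            if y ∈ R then (s y).rename (fun n => 2 * n + 1) else .var (2 * y)).subst
              fun z => if z = 2 * a then (s a).rename (fun n => 2 * n + 1) else .var z := by
          rw [PTerm.subst_subst]
          congr 1
          funext y
          by_cases hy : y ∈ R
          · simp only [Finset.mem_insert, hy, or_true, ↓reduceIte]
            rw [PTerm.rename_subst]
            conv_lhs => rw [← PTerm.subst_var]
            congr 1
            funext n
            rw [if_neg (by omega)]
          · by_cases hya : y = a
            · simp [hya, ha, PTerm.subst]
            · simp [hy, hya, PTerm.subst]
        rw [e]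
        refine ih.cut (C := (E' a).ty) (by simp [hF]) ?_ ?_ ?_ ?_
        · refine PTerm.count_subst_pos.2 ⟨a, hat, by simp [ha, PTerm.count]⟩
        · exact (hs a hat).2.rename (fun x y (e : 2 * x + 1 = 2 * y + 1) => by omega) (by simp [hF])
        · exact PTerm.count_rename_eq_zero fun z _ => by omega
        · rw [← e]
          intro x hx
          obtain ⟨y, rfl | rfl⟩ := Nat.even_or_odd' x
          · refine le_trans ?_ (hcount y)
            conv_rhs => rw [← t.rename_id, ← PTerm.subst_var]
            refine PTerm.count_subst_mono fun z => ?_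
            split_ifs
            · rw [PTerm.count_rename_eq_zero fun z _ => by omega]
              exact Nat.zero_le _
            · simp [PTerm.count]
          · simp only [hF, interleave_odd] at hx
            refine le_trans ?_ (hlin y hx)
            refine PTerm.count_subst_mono fun z => ?_
            split_ifs
            · rw [PTerm.count_rename (y := y) fun i _ => by omega]
            · have : ¬ (2 * z = 2 * y + 1) := by omega
              simp [PTerm.count, this]
      · have e : (t.subst fun y => if y ∈ insert a R then (s y).rename (fun n => 2 * n + 1)
            else .var (2 * y)) = (t.subst fun y =>
            if y ∈ R then (s y).rename (fun n => 2 * n + 1) else .var (2 * y)) := by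
          refine PTerm.subst_congr fun y hy => ?_
          have : y ≠ a := by
            rintro rfl
            exact hat hy
          simp [this]
        rw [e]
        exact ih
  obtain ⟨R, hR⟩ := t.exists_finset_count_pos
  have hfin := key R
  have e : (t.subst fun y => if y ∈ R then (s y).rename (fun n => 2 * n + 1) else .var (2 * y))
      = (t.subst s).rename fun n => 2 * n + 1 := by
    rw [PTerm.subst_rename]
    exact PTerm.subst_congr fun y hy => if_pos ((hR y).2 hy)
  rw [e] at hfin
  exact hfin.of_rename (q := fun n => n / 2) (fun x => by omega) (by simp [hF])

end Der

/-- The induction is on the size because the case of `§` passes to a term that is not a subterm. At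
level 0 there is no leading `§̄`. All rules except that of `§` correspond directly to rules of DLAL;
boxes use the separate leveling of their bodies, in which the variable is linear. -/
theorem Leveled.der {E : Env} {l rho : ℕ → Option ℕ} {t : PTerm} {A : LinTy}
    (h : Leveled E l rho 0 t A) (hl : ∀ x n, l x = some n → n = 0)
    (hrho : ∀ j n, rho j = some n → n = 0)
    (hlin : ∀ x, (E x).bang = false → t.count x ≤ 1) : Der E t A := by
  induction hn : t.size using Nat.strong_induction_on generalizing E l rho t A with
  | _ n ih =>
  subst hn
  cases h with
  | var h hs => exact .var _ _
  | @lam _ _ _ _ D t B hs hc h =>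
    refine .lam (ih _ (by simp [PTerm.size]) h ?_ hrho ?_ rfl)
    · rintro (_ | x) n hn
      · simpa using hn.symm
      · exact hl x n hn
    · rintro (_ | x) hx
      · exact hc hx
      · exact hlin x hx
  | @app _ _ _ _ t u A _ h1 h2 =>
    refine .app (ih _ ?_ h1 hl hrho ?_ rfl) (ih _ ?_ h2 hl hrho ?_ rfl) hlin
    · simp only [PTerm.size]; omega
    · exact fun x hx => le_trans (Nat.le_add_right _ _) (hlin x hx)
    · simp only [PTerm.size]; omega
    · exact fun x hx => le_trans (Nat.le_add_left _ _) (hlin x hx)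
  | @appVar _ _ _ _ x t A _ h1 he h2 =>
    refine .appBang (w := .var 0) (C := A) (x := x) (ih _ ?_ h1 hl hrho ?_ rfl)
      (fun y hy => (PTerm.count_var_pos.1 hy).symm) (fun _ => he)
      (Der.var (fun _ => ⟨false, A⟩) 0) rfl fun _ => PTerm.count_var_pos.2 rfl
    · simp only [PTerm.size]; omega
    · exact fun x hx => le_trans (Nat.le_add_right _ _) (hlin x hx)
  | @appBox _ _ _ _ x t w A _ C h1 h2 h3 h4 h5 h6 =>
    have hsize := w.size_le_size_subst fun _ => .dpar (.var x)
    refine .appBang (ih _ ?_ h1 hl hrho ?_ rfl) h2 (fun hw => (h4 hw).2) (ih _ ?_ h5 ?_ ?_ ?_ rfl)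
      ?_ ?_
    · simp only [PTerm.size]; omega
    · exact fun x hx => le_trans (Nat.le_add_right _ _) (hlin x hx)
    · simp only [PTerm.size]; omega
    · intro y n hn
      simpa using hn.symm
    · exact fun j n hn => (resetLevels_eq_some.1 hn).1
    · intro y _
      by_contra hy
      obtain rfl := h2 y (by omega)
      omega
    · rw [PTerm.erase, PTerm.erase_subst, ← PTerm.subst_var, PTerm.erase_subst]
      rfl
    · exact fun hw => PTerm.count_subst_pos.2 ⟨0, hw, by simp [PTerm.count]⟩
  | tlam h =>
    refine .tlam (ih _ (by simp [PTerm.size]) h hl ?_ hlin rfl)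
    rintro (_ | x) n hn
    · simpa using hn.symm
    · exact hrho x n hn
  | tapp h hs => exact .tapp (ih _ (by simp [PTerm.size]) h hl hrho hlin rfl) _
  | @par _ _ _ _ t A h =>
    -- The cut is where the level falls from 1 back to 0. Free variables have level 0, so every
    -- variable of `t'` stands for a piece `§̄ v` and occurs once. Both `t'` and `v` are smaller
    -- than `§ t` and are leveled at 0.
    obtain ⟨t', E', l', s, rfl, h', hcut⟩ :=
      h.cut (fun j n hn => by have := hrho j n hn; omega) (c := 0) (k := 0) rfl
    have hhole : ∀ y, 0 < t'.count y → (E' y).bang = false ∧ l' y = some 0 ∧ t'.count y ≤ 1 ∧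
        Der E (s y) (E' y).ty.par := by
      intro y hy
      rcases hcut y hy with ⟨x, i, -, -, h3, -⟩ | ⟨v, C, h1, h2, h3, h4, h5, -⟩
      · have := hl x _ h3
        omega
      · refine ⟨by rw [h2], h3, h4, ?_⟩
        have hsize := PTerm.size_le_size_subst_of_count (s := s) hy
        have hv : Der E v C.par := by
          refine ih _ ?_ h5 (fun x n hn => hl x n (kill_eq_some.1 hn).1)
            (fun x n hn => hrho x n (kill_eq_some.1 hn).1) (fun x hx => ?_) rfl
          · rw [h1] at hsize
            simp only [PTerm.size] at hsize ⊢
            omega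
          · refine le_trans ?_ (hlin x hx)
            have := PTerm.count_le_count_subst (s := s) (x := x) hy
            rwa [h1] at this
        rw [h1, h2]
        exact hv
    refine Der.box (t := t') (s := s) (E' := E') (A := A) ?_ ?_
      (fun y hy => ⟨(hhole y hy).1, (hhole y hy).2.2.2⟩) hlin
    · have hsize := t'.size_le_size_subst s
      refine ih _ ?_ (h'.congr_env (l' := fun _ => some 0) fun y hy => ⟨rfl, fun n hn => ?_⟩) ?_ ?_ ?_
        rfl
      · simp only [PTerm.size]; omega
      · rw [← hn, (hhole y hy).2.1]
      · exact fun x n hn => by simpa using hn.symm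
      · intro j n hn
        obtain ⟨i, hi, rfl⟩ := lowerLevels_eq_some.1 hn
        have := hrho j i hi
        omega
      · intro y _
        by_contra hy
        have := (hhole y (by omega)).2.2.1
        omega
    · intro y
      by_contra hy
      have := (hhole y (by omega)).2.2.1
      omega

/-! ### From a leveling to the conditions, and regularity -/

/-- Dependence on a type variable and bang subterms are defined through the existence of some output
type; uniqueness identifies it with the type in the leveling. -/
theorem OutTy.unique {E : Env} {t : PTerm} {A B : LinTy} (h : OutTy E t A) (h' : OutTy E t B) :
    A = B := by
  induction h generalizing B with
  | var E x => exact h'.var_eq.symm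
  | par h ih => cases h' with | par h' => rw [ih h']
  | dpar h ih => cases h' with | dpar h' => exact (LinTy.par.inj (ih h'))
  | @lam E D t B h ih => cases h' with | lam h' => rw [ih h']
  | app h1 h2 ih1 ih2 =>
    cases h' with
    | app h1' h2' => exact (LinTy.arrow.inj (ih1 h1')).2.2
  | tlam h ih => cases h' with | tlam h' => rw [ih h']
  | @tapp E t A C h ih =>
    generalize e : PTerm.tapp t C = u at h'
    cases h' with
    | tapp C' h' =>
      cases e
      rw [LinTy.all.inj (ih h')]
    | _ => cases e

namespace PTerm

/-- Regularity, by recursion on the pseudo-term. -/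
def Reg : PTerm → Prop
  | var _ => True
  | lam _ t => Reg t
  | app t u => Reg t ∧ Reg u
  | tlam t => Reg t
  | tapp t _ => Reg t
  | par t => (∀ u, t ≠ dpar u) ∧ Reg t
  | dpar t => (∀ u, t ≠ par u) ∧ Reg t

theorem Reg.of_occ {t u : PTerm} {p : List Step} (h : t.Reg) (ho : Occ t p u) : u.Reg := by
  induction ho with
  | here t => exact h
  | lam D ho ih => exact ih h
  | fn s ho ih => exact ih h.1
  | arg s ho ih => exact ih h.2
  | tlam ho ih => exact ih h
  | tapp A ho ih => exact ih h
  | par ho ih => exact ih h.2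
  | dpar ho ih => exact ih h.2

theorem Reg.regular {t : PTerm} (h : t.Reg) : Regular t := fun _ u =>
  ⟨fun ho => (h.of_occ ho).1 u rfl, fun ho => (h.of_occ ho).1 u rfl⟩

theorem eq_of_count_le_one {t : PTerm} {x : ℕ} (h : t.count x ≤ 1) {p q : List Step}
    (hp : FreeAt t p x) (hq : FreeAt t q x) : p = q := by
  induction t generalizing x p q with
  | var y => cases hp; cases hq; rfl
  | lam D t ih =>
    unfold FreeAt at hp hq
    cases hp with
    | @lam _ _ p _ hp =>
      cases hq with
      | @lam _ _ q _ hq =>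
        rw [lamDepth, Nat.add_comm (lamDepth _), ← Nat.add_assoc] at hp hq
        rw [ih h hp hq]
  | app t u iht ihu =>
    simp only [count] at h
    cases hp with
    | fn _ hp =>
      cases hq with
      | fn _ hq => rw [iht (by omega) hp hq]
      | arg _ hq =>
        have h1 := count_pos_iff.2 ⟨_, hp⟩
        have h2 := count_pos_iff.2 ⟨_, hq⟩
        omega
    | arg _ hp =>
      cases hq with
      | fn _ hq =>
        have h1 := count_pos_iff.2 ⟨_, hp⟩
        have h2 := count_pos_iff.2 ⟨_, hq⟩
        omega
      | arg _ hq => rw [ihu (by omega) hp hq]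
  | tlam t ih => cases hp with | tlam hp => cases hq with | tlam hq => rw [ih h hp hq]
  | tapp t A ih => cases hp with | tapp _ hp => cases hq with | tapp _ hq => rw [ih h hp hq]
  | par t ih => cases hp with | par hp => cases hq with | par hq => rw [ih h hp hq]
  | dpar t ih => cases hp with | dpar hp => cases hq with | dpar hq => rw [ih h hp hq]

theorem count_subst_dpar {w : PTerm} (hw : ∀ y, 0 < w.count y → y = 0) (x z : ℕ) :
    (w.subst fun _ => .dpar (.var x)).count z = if z = x then w.count 0 else 0 := by
  split_ifs with h
  · subst h
    refine count_subst fun y hy => ?_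
    simp [hw y hy, count]
  · by_contra hc
    obtain ⟨y, -, hy⟩ := count_subst_pos.1 (Nat.pos_of_ne_zero hc)
    exact h (count_var_pos.1 (show 0 < (PTerm.var x).count z from hy)).symm

/-- A subterm of `w.subst s` either stands where there is a subterm of `w`, or it is a variable that
was introduced by `s`. -/
theorem occ_of_occ_subst {w v : PTerm} {s : ℕ → PTerm} {x : ℕ} {p : List Step}
    (hs : ∀ y, (∃ z, s y = .var z) ∨ s y = .dpar (.var x)) (h : Occ (w.subst s) p v) :
    (∃ v', Occ w p v') ∨ FreeAt (w.subst s) p x := by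
  induction w generalizing s x p v with
  | var y =>
    simp only [subst] at h ⊢
    rcases hs y with ⟨z, e⟩ | e
    · rw [e] at h
      cases h
      exact Or.inl ⟨_, .here _⟩
    · rw [e] at h ⊢
      cases h with
      | here => exact Or.inl ⟨_, .here _⟩
      | dpar h =>
        cases h
        exact Or.inr (freeAt_var x).dpar
  | lam D t ih =>
    simp only [subst] at h ⊢
    cases h with
    | here => exact Or.inl ⟨_, .here _⟩
    | lam _ h =>
      have hs' : ∀ y, (∃ z, scons (var 0) (fun n => (s n).rename Nat.succ) y = .var z) ∨
          scons (var 0) (fun n => (s n).rename Nat.succ) y = .dpar (.var (x + 1)) := by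
        rintro (_ | y)
        · exact Or.inl ⟨0, rfl⟩
        · rcases hs y with ⟨z, e⟩ | e
          · exact Or.inl ⟨z + 1, by simp [e, rename]⟩
          · exact Or.inr (by simp [e, rename])
      rcases ih hs' h with ⟨v', h'⟩ | h'
      exacts [Or.inl ⟨v', h'.lam D⟩, Or.inr (h'.lam D)]
  | app t u iht ihu =>
    simp only [subst] at h ⊢
    cases h with
    | here => exact Or.inl ⟨_, .here _⟩
    | fn _ h =>
      rcases iht hs h with ⟨v', h'⟩ | h'
      exacts [Or.inl ⟨v', h'.fn u⟩, Or.inr (h'.fn _)]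
    | arg _ h =>
      rcases ihu hs h with ⟨v', h'⟩ | h'
      exacts [Or.inl ⟨v', h'.arg t⟩, Or.inr (h'.arg _)]
  | tlam t ih =>
    simp only [subst] at h ⊢
    cases h with
    | here => exact Or.inl ⟨_, .here _⟩
    | tlam h =>
      have hs' : ∀ y, (∃ z, (s y).renameTy Nat.succ = .var z) ∨
          (s y).renameTy Nat.succ = .dpar (.var x) := by
        intro y
        rcases hs y with ⟨z, e⟩ | e
        · exact Or.inl ⟨z, by simp [e, renameTy]⟩
        · exact Or.inr (by simp [e, renameTy])
      rcases ih hs' h with ⟨v', h'⟩ | h'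
      exacts [Or.inl ⟨v', h'.tlam⟩, Or.inr h'.tlam]
  | tapp t A ih =>
    simp only [subst] at h ⊢
    cases h with
    | here => exact Or.inl ⟨_, .here _⟩
    | tapp _ h =>
      rcases ih hs h with ⟨v', h'⟩ | h'
      exacts [Or.inl ⟨v', h'.tapp A⟩, Or.inr (h'.tapp A)]
  | par t ih =>
    simp only [subst] at h ⊢
    cases h with
    | here => exact Or.inl ⟨_, .here _⟩
    | par h =>
      rcases ih hs h with ⟨v', h'⟩ | h'
      exacts [Or.inl ⟨v', h'.par⟩, Or.inr h'.par]
  | dpar t ih =>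
    simp only [subst] at h ⊢
    cases h with
    | here => exact Or.inl ⟨_, .here _⟩
    | dpar h =>
      rcases ih hs h with ⟨v', h'⟩ | h'
      exacts [Or.inl ⟨v', h'.dpar⟩, Or.inr h'.dpar]

end PTerm

namespace Leveled

variable {E : Env} {l rho : ℕ → Option ℕ} {k : ℕ} {t u : PTerm} {A B : LinTy}

theorem app_inv (h : Leveled E l rho k (.app t u) B) :
    (∃ A, Leveled E l rho k t A) ∧ ∃ A, Leveled E l rho k u A := by
  cases h with
  | app h1 h2 => exact ⟨⟨_, h1⟩, _, h2⟩
  | appVar h1 he h2 => exact ⟨⟨_, h1⟩, _, h2⟩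
  | appBox h1 h2 h3 h4 h5 h6 => exact ⟨⟨_, h1⟩, _, h6⟩

theorem tapp_inv {C : LinTy} (h : Leveled E l rho k (.tapp t C) B) :
    Scoped rho C ∧ ∃ A, Leveled E l rho k t A := by
  generalize e : PTerm.tapp t C = u at h
  cases h with
  | tapp h hs =>
    cases e
    exact ⟨hs, _, h⟩
  | _ => cases e

theorem le_of_scons {l : ℕ → Option ℕ} {k : ℕ} (hl : ∀ x n, l x = some n → n ≤ k)
    (x n : ℕ) (hn : scons (some k) l x = some n) : n ≤ k := by
  cases x with
  | zero =>
    simp only [scons_zero, Option.some.injEq] at hn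
    omega
  | succ x => exact hl x n hn

/-- How a subterm of a leveled pseudo-term is leveled. -/
theorem occ {p : List Step} {v : PTerm} (h : Leveled E l rho k t A)
    (hl : ∀ x n, l x = some n → n ≤ k) (hrho : ∀ j n, rho j = some n → n ≤ k) (ho : Occ t p v) :
    ∃ l' rho' k' A', Leveled (envAt E p) l' rho' k' v A' ∧ (k' : ℤ) = k + sum (word p) ∧
      Above 0 k (word p) ∧
      ((∀ x n, l' x = some n → n ≤ k') ∧ (∀ j n, rho' j = some n → n ≤ k')) ∧
      (∀ x n, l' (x + lamDepth p) = some n → l x = some n ∧ Above n k (word p)) ∧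
      (∀ j n, rho' (j + tlamDepth p) = some n → rho j = some n ∧ Above n k (word p)) := by
  induction ho generalizing E l rho k A with
  | here t =>
    refine ⟨l, rho, k, A, h, by simp [word, sum], ?_, ⟨hl, hrho⟩, fun x n hn => ⟨hn, ?_⟩, fun x n hn => ⟨hn, ?_⟩⟩
    · simp [word, above_nil]
    · simpa [word, above_nil] using hl x n hn
    · simpa [word, above_nil] using hrho x n hn
  | lam D ho ih =>
    cases h with
    | lam hs hc h =>
      obtain ⟨l', rho', k', A', h1, h2, h3, hb, h4, h5⟩ := ih h (le_of_scons hl) hrho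
      refine ⟨l', rho', k', A', h1, h2, h3, hb, fun x n hn => h4 (x + 1) n ?_, h5⟩
      rw [← hn, lamDepth, Nat.add_right_comm, Nat.add_assoc]
  | fn s ho ih =>
    obtain ⟨A', h⟩ := h.app_inv.1
    exact ih h hl hrho
  | arg s ho ih =>
    obtain ⟨A', h⟩ := h.app_inv.2
    exact ih h hl hrho
  | tlam ho ih =>
    cases h with
    | tlam h =>
      obtain ⟨l', rho', k', A', h1, h2, h3, hb, h4, h5⟩ := ih h hl (le_of_scons hrho)
      refine ⟨l', rho', k', A', h1, h2, h3, hb, h4, fun x n hn => h5 (x + 1) n ?_⟩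
      rw [← hn, tlamDepth, Nat.add_right_comm, Nat.add_assoc]
  | tapp A ho ih =>
    obtain ⟨-, A', h⟩ := h.tapp_inv
    exact ih h hl hrho
  | par ho ih =>
    cases h with
    | par h =>
      obtain ⟨l', rho', k', A', h1, h2, h3, hb, h4, h5⟩ :=
        ih h (fun x n hn => (hl x n hn).trans (Nat.le_succ k))
          fun x n hn => (hrho x n hn).trans (Nat.le_succ k)
      push_cast at h2 h3 h4 h5
      refine ⟨l', rho', k', A', h1, ?_, ?_, hb, fun x n hn => ?_, fun x n hn => ?_⟩
      · simp only [word, sum]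
        omega
      · exact above_par.2 ⟨by omega, h3⟩
      · obtain ⟨h6, h7⟩ := h4 x n hn
        have := hl x n h6
        exact ⟨h6, above_par.2 ⟨by omega, h7⟩⟩
      · obtain ⟨h6, h7⟩ := h5 x n hn
        have := hrho x n h6
        exact ⟨h6, above_par.2 ⟨by omega, h7⟩⟩
  | dpar ho ih =>
    cases h with
    | @dpar _ _ _ k _ _ h =>
      obtain ⟨l', rho', k', A', h1, h2, h3, hb, h4, h5⟩ :=
        ih h (fun x n hn => (kill_eq_some.1 hn).2) fun x n hn => (kill_eq_some.1 hn).2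
      refine ⟨l', rho', k', A', h1, ?_, ?_, hb, fun x n hn => ?_, fun x n hn => ?_⟩
      · simp only [word, sum]
        push_cast
        omega
      · refine above_dpar.2 ⟨by omega, ?_⟩
        push_cast
        rwa [add_sub_cancel_right]
      · obtain ⟨h6, h7⟩ := h4 x n hn
        refine ⟨(kill_eq_some.1 h6).1, above_dpar.2 ⟨?_, ?_⟩⟩
        · have := hl x n (kill_eq_some.1 h6).1
          omega
        · push_cast
          rwa [add_sub_cancel_right]
      · obtain ⟨h6, h7⟩ := h5 x n hn
        refine ⟨(kill_eq_some.1 h6).1, above_dpar.2 ⟨?_, ?_⟩⟩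
        · have := hrho x n (kill_eq_some.1 h6).1
          omega
        · push_cast
          rwa [add_sub_cancel_right]

theorem free {p : List Step} {x : ℕ} (h : Leveled E l rho k t A)
    (hl : ∀ x n, l x = some n → n ≤ k) (hrho : ∀ j n, rho j = some n → n ≤ k)
    (hx : FreeAt t p x) :
    ∃ n, l x = some n ∧ Above n k (word p) ∧ (k : ℤ) + sum (word p) = n := by
  obtain ⟨l', rho', k', A', h1, h2, h3, -, h4, h5⟩ := h.occ hl hrho hx
  obtain ⟨h6, h7⟩ := h4 x k' h1.level_var
  exact ⟨k', h6, h7, h2.symm⟩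

theorem exists_level_of_dependsOn {j : ℕ} (h : Leveled E l rho k t A) (hd : DependsOn E t j) :
    ∃ n, rho j = some n := by
  rcases hd with ⟨A', h1, h2⟩ | ⟨w, B, rfl, h2⟩
  · rw [h1.unique h.outTy] at h2
    exact h.scoped_type j h2
  · exact h.tapp_inv.1 j h2

/-- As output types are unique, the application was formed by one of the two bang rules. For a
variable everything is immediate, and a box has at most one free occurrence because its body has. -/
theorem bangCondition_of_arg {r u : PTerm} {C : LinTy} (h : Leveled E l rho k (.app r u) B)
    (hr : OutTy E r (.arrow true A C)) :
    (∀ p q x y, FreeAt u p x → FreeAt u q y → p = q) ∧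
    (∀ p x, FreeAt u p x → (E x).bang = true) ∧
    (∀ p v, Occ u p v → p ≠ [] → (¬ ∃ x, FreeAt u p x) → 1 ≤ sum (word p)) ∧
    (∀ w, u ≠ .dpar w) := by
  cases h with
  | app h1 h2 => cases hr.unique h1.outTy
  | @appVar _ _ _ _ x _ A _ h1 he h2 =>
    refine ⟨?_, ?_, ?_, by simp⟩
    · intro p q y z hp hq
      cases hp; cases hq; rfl
    · intro p y hp
      obtain rfl := PTerm.count_var_pos.1 (PTerm.count_pos_iff.2 ⟨p, hp⟩)
      rw [he]
    · intro p v hp hne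
      cases hp
      exact absurd rfl hne
  | @appBox _ _ _ _ x _ w A _ C h1 h2 h3 h4 h5 h6 =>
    have hfree : ∀ p y, FreeAt (.par (w.subst fun _ => .dpar (.var x))) p y →
        y = x ∧ 0 < w.count 0 := by
      intro p y hp
      have : 0 < (PTerm.par (w.subst fun _ => .dpar (.var x))).count y :=
        PTerm.count_pos_iff.2 ⟨p, hp⟩
      change 0 < (w.subst fun _ => .dpar (.var x)).count y at this
      rw [PTerm.count_subst_dpar h2] at this
      split_ifs at this with e
      · exact ⟨e, this⟩
      · exact absurd this (lt_irrefl 0)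
    refine ⟨?_, ?_, ?_, by simp⟩
    · intro p q y z hp hq
      obtain ⟨rfl, -⟩ := hfree p y hp
      obtain ⟨rfl, -⟩ := hfree q z hq
      refine PTerm.eq_of_count_le_one ?_ hp hq
      show (w.subst fun _ => .dpar (.var _)).count _ ≤ 1
      rw [PTerm.count_subst_dpar h2, if_pos rfl]
      exact h3
    · intro p y hp
      obtain ⟨rfl, h0⟩ := hfree p y hp
      rw [(h4 h0).2]
    · intro p v hp hne hnf
      cases hp with
      | here => exact absurd rfl hne
      | @par _ _ p hp =>
        -- Each position inside is either a position of the body, whose level is a natural number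
        -- and to which the outer `§` adds 1, or the free variable itself, which is exempt.
        rcases PTerm.occ_of_occ_subst (fun _ => Or.inr rfl) hp with ⟨v', hv'⟩ | hx
        · obtain ⟨-, -, k', -, -, hk', -⟩ := h5.occ (fun x n hn => by simpa using hn.symm)
            (fun j n hn => (resetLevels_eq_some.1 hn).1.le) hv'
          simp only [word, sum]
          omega
        · exact absurd ⟨x, hx.par⟩ hnf

end Leveled

/-- A leveled pseudo-term satisfies the conditions on decorations. -/
theorem Leveled.conditions {E : Env} {t : PTerm} {A : LinTy}
    (h : Leveled E (fun _ => some 0) (fun _ => some 0) 0 t A)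
    (hlin : ∀ x, (E x).bang = false → t.count x ≤ 1) :
    LocalTyping E t A ∧ Bracketing t ∧ BangCondition E t ∧ ScopeCondition E t := by
  have hz : ∀ x n : ℕ, (fun _ => some 0 : ℕ → Option ℕ) x = some n → n ≤ 0 := by
    intro x n hn
    simp only [Option.some.injEq] at hn
    exact hn.ge
  have hocc {p v} (ho : Occ t p v) : ∃ l' rho' k' A', Leveled (envAt E p) l' rho' k' v A' ∧
      Above 0 0 (word p) ∧ (∀ x n, l' x = some n → n ≤ k') ∧
      (∀ j n, rho' j = some n → n ≤ k') := by
    obtain ⟨l', rho', k', A', h1, -, h3, h4, -⟩ := h.occ hz hz ho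
    exact ⟨l', rho', k', A', h1, h3, h4⟩
  have hlam {p D v} (ho : Occ t p (.lam D v)) : (D.bang = false → v.count 0 ≤ 1) ∧
      Above 0 0 (word p) ∧ ∀ q, FreeAt v q 0 → WellBracketed (word q) := by
    obtain ⟨l', rho', k', A', h1, h2, hl', hrho'⟩ := hocc ho
    cases h1 with
    | lam hs hc h1 =>
      refine ⟨hc, h2, fun q hq => ?_⟩
      obtain ⟨n, hn, h3, h4⟩ := h1.free (le_of_scons hl') hrho' hq
      obtain rfl : k' = n := by simpa using hn
      exact (wellBracketed_iff k').2 ⟨h3, h4⟩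
  refine ⟨⟨h.outTy, ?_, ?_⟩, ⟨?_, ?_⟩, ?_, ?_⟩
  · intro p q x hp hq hpq
    by_contra hb
    exact hpq (PTerm.eq_of_count_le_one (hlin x (by simpa using hb)) hp hq)
  · intro r D v hv p q hp hq hpq
    by_contra hb
    exact hpq (PTerm.eq_of_count_le_one ((hlam hv).1 (by simpa using hb)) hp hq)
  · intro p x hx
    obtain ⟨n, hn, h3, h4⟩ := h.free hz hz hx
    simp only [Option.some.injEq] at hn
    subst hn
    exact (wellBracketed_iff 0).2 ⟨h3, h4⟩
  · intro p D v hv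
    obtain ⟨-, h1, h2⟩ := hlam hv
    exact ⟨(weaklyWellBracketed_iff 0).2 h1, h2⟩
  · rintro E' u ⟨p, r, B, C, ho, rfl, hr, hu⟩
    obtain ⟨l', rho', k', A', h1, -⟩ := hocc ho
    exact h1.bangCondition_of_arg hr
  · intro p u hu q v hv hd
    obtain ⟨l', rho', k', A', h1, -, hl', hrho'⟩ := hocc hu
    cases h1 with
    | tlam h1 =>
      obtain ⟨l'', rho'', k'', A'', h2, -, -, -, -, h3⟩ := h1.occ hl' (le_of_scons hrho') hv
      obtain ⟨n, hn⟩ := h2.exists_level_of_dependsOn hd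
      obtain ⟨h4, h5⟩ := h3 0 n (by rwa [Nat.zero_add])
      obtain rfl : k' = n := by simpa using h4
      exact (weaklyWellBracketed_iff k').2 h5

namespace Leveled

/-- A new pair `§ §̄` needs a replaced variable directly below a `§`. The level there is at least 1,
but replaced variables have level 0. -/
theorem reg_subst_dpar {E : Env} {l rho : ℕ → Option ℕ} {k : ℕ} {w : PTerm} {A : LinTy}
    (h : Leveled E l rho k w A) (hw : w.Reg) {s : ℕ → PTerm}
    (hs : ∀ y, (∃ z, s y = .var z) ∨
      ((∃ z, s y = .dpar (.var z)) ∧ ∀ n, l y = some n → n = 0)) :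
    (w.subst s).Reg := by
  induction h generalizing s with
  | @var E l rho k x h hx =>
    rcases hs x with ⟨z, e⟩ | ⟨⟨z, e⟩, -⟩
    · simp [PTerm.subst, e, PTerm.Reg]
    · simp [PTerm.subst, e, PTerm.Reg]
  | lam hD hc h ih =>
    refine ih hw ?_
    rintro (_ | y)
    · exact Or.inl ⟨0, rfl⟩
    · rcases hs y with ⟨z, e⟩ | ⟨⟨z, e⟩, h0⟩
      · exact Or.inl ⟨z + 1, by simp [e, PTerm.rename]⟩
      · exact Or.inr ⟨⟨z + 1, by simp [e, PTerm.rename]⟩, h0⟩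
  | app h1 h2 ih1 ih2 => exact ⟨ih1 hw.1 hs, ih2 hw.2 hs⟩
  | appVar h1 he h2 ih1 ih2 => exact ⟨ih1 hw.1 hs, ih2 hw.2 hs⟩
  | appBox h1 h2 h3 h4 h5 h6 ih1 ih5 ih6 => exact ⟨ih1 hw.1 hs, ih6 hw.2 hs⟩
  | tlam h ih =>
    refine ih hw fun y => ?_
    rcases hs y with ⟨z, e⟩ | ⟨⟨z, e⟩, h0⟩
    · exact Or.inl ⟨z, by simp [e, PTerm.renameTy]⟩
    · exact Or.inr ⟨⟨z, by simp [e, PTerm.renameTy]⟩, h0⟩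
  | tapp h hB ih => exact ih hw hs
  | @par E l rho k t A h ih =>
    refine ⟨fun u e => ?_, ih hw.2 hs⟩
    cases t with
    | var y =>
      rcases hs y with ⟨z, e'⟩ | ⟨-, h0⟩
      · simp [PTerm.subst, e'] at e
      · have := h0 _ h.level_var
        omega
    | dpar t => exact hw.1 t rfl
    | _ => simp [PTerm.subst] at e
  | @dpar E l rho k t A h ih =>
    refine ⟨fun u e => ?_, ih hw.2 fun y => (hs y).imp_right fun h0 =>
      ⟨h0.1, fun n hn => h0.2 n (kill_eq_some.1 hn).1⟩⟩
    cases t with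
    | var y => rcases hs y with ⟨z, e'⟩ | ⟨⟨z, e'⟩, -⟩ <;> simp [PTerm.subst, e'] at e
    | par t => exact hw.1 t rfl
    | _ => simp [PTerm.subst] at e

/-- A leveled pseudo-term can be made regular by deleting `§ §̄` and `§̄ §`. -/
theorem exists_reg {E : Env} {l rho : ℕ → Option ℕ} {k : ℕ} {t : PTerm} {A : LinTy}
    (h : Leveled E l rho k t A) (hrho : ∀ j n, rho j = some n → n ≤ k) :
    ∃ t' : PTerm, t'.Reg ∧ t'.erase = t.erase ∧ (∀ x, t'.count x = t.count x) ∧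
      Leveled E l rho k t' A := by
  induction h with
  | @var E l rho k x h hx => exact ⟨.var x, trivial, rfl, fun _ => rfl, .var h hx⟩
  | @lam E l rho k D t B hD hc h ih =>
    obtain ⟨t', h1, h2, h3, h4⟩ := ih hrho
    exact ⟨.lam D t', h1, by simp only [PTerm.erase, h2], fun x => h3 (x + 1),
      .lam hD (by rwa [h3]) h4⟩
  | app h1 h2 ih1 ih2 =>
    obtain ⟨t', ht1, ht2, ht3, ht4⟩ := ih1 hrho
    obtain ⟨u', hu1, hu2, hu3, hu4⟩ := ih2 hrho
    exact ⟨.app t' u', ⟨ht1, hu1⟩, by simp only [PTerm.erase, ht2, hu2],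
      fun x => by simp only [PTerm.count, ht3, hu3], .app ht4 hu4⟩
  | @appVar E l rho k x t A B h1 he h2 ih1 ih2 =>
    obtain ⟨t', ht1, ht2, ht3, ht4⟩ := ih1 hrho
    exact ⟨.app t' (.var x), ⟨ht1, trivial⟩, by simp only [PTerm.erase, ht2],
      fun x => by simp only [PTerm.count, ht3], .appVar ht4 he h2⟩
  | @appBox E l rho k x t w A B C h1 h2 h3 h4 h5 h6 ih1 ih5 ih6 =>
    obtain ⟨t', ht1, ht2, ht3, ht4⟩ := ih1 hrho
    -- The body of the box is made regular, not the argument as a whole, so that the argument keeps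
    -- the form of a box.
    obtain ⟨w', hw1, hw2, hw3, hw4⟩ := ih5 fun j n hn => (resetLevels_eq_some.1 hn).1.le
    have h2' : ∀ y, 0 < w'.count y → y = 0 := fun y hy => h2 y (by rwa [← hw3])
    have hbox : ∃ u : PTerm, u.Reg ∧ u.erase = w.erase.subst (fun _ => .var x) ∧
        (∀ z, u.count z = if z = x then w.count 0 else 0) ∧
        Leveled E l rho k (.app t' u) B := by
      have hpar : (∀ y, w' ≠ .var y) →
          ∃ u : PTerm, u.Reg ∧ u.erase = w.erase.subst (fun _ => .var x) ∧
          (∀ z, u.count z = if z = x then w.count 0 else 0) ∧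
          Leveled E l rho k (.app t' u) B := by
        intro hvar
        have h4' : 0 < w'.count 0 → l x = some k ∧ E x = ⟨true, C⟩ := by rwa [hw3]
        refine ⟨.par (w'.subst fun _ => .dpar (.var x)), ⟨fun u e => ?_, ?_⟩, ?_, fun z => ?_,
          .appBox ht4 h2' (by rwa [hw3]) h4' hw4 (.box h2' h4' hrho hw4)⟩
        · cases w' with
          | var y => exact hvar y rfl
          -- The body is leveled at 0, hence does not begin with `§̄`.
          | dpar w' => cases hw4
          | _ => simp [PTerm.subst] at e
        · refine hw4.reg_subst_dpar hw1 fun y => Or.inr ⟨⟨x, rfl⟩, fun n hn => ?_⟩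
          simpa using hn.symm
        · rw [PTerm.erase, PTerm.erase_subst, hw2]
          rfl
        · rw [PTerm.count, PTerm.count_subst_dpar h2', hw3]
      -- If the body is a mere variable, the box is `§ §̄ x`; it is replaced by `x`, which is a bang
      -- argument by the rule for variables.
      by_cases hvar : ∃ y, w' = .var y
      · obtain ⟨y, rfl⟩ := hvar
        obtain rfl := h2' y (PTerm.count_var_pos.2 rfl)
        have hwc : w.count 0 = 1 := by rw [← hw3]; simp [PTerm.count]
        obtain rfl : A = C := hw4.outTy.var_eq
        obtain ⟨hx1, hx2⟩ := h4 (by omega)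
        refine ⟨.var x, trivial, by rw [← hw2]; rfl, fun z => ?_, .appVar ht4 hx2 ?_⟩
        · simp only [PTerm.count, hwc, eq_comm]
        · have : Leveled E l rho k (.var x) (E x).out := by
            refine .var hx1 (h6.scoped_of_count ?_)
            show 0 < (w.subst fun _ => .dpar (.var x)).count x
            rw [PTerm.count_subst_dpar h2]
            simp [hwc]
          rwa [hx2] at this
      · exact hpar fun y e => hvar ⟨y, e⟩
    obtain ⟨u, hu1, hu2, hu3, hu4⟩ := hbox
    refine ⟨.app t' u, ⟨ht1, hu1⟩, ?_, fun z => ?_, hu4⟩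
    · simp only [PTerm.erase, ht2, hu2, PTerm.erase_subst]
    · simp only [PTerm.count, ht3, hu3, PTerm.count_subst_dpar h2]
  | tlam h ih =>
    obtain ⟨t', h1, h2, h3, h4⟩ := ih (le_of_scons hrho)
    exact ⟨.tlam t', h1, by simp only [PTerm.erase, h2], h3, .tlam h4⟩
  | @tapp E l rho k t A B h hs ih =>
    obtain ⟨t', h1, h2, h3, h4⟩ := ih hrho
    exact ⟨.tapp t' B, h1, by simp only [PTerm.erase, h2], h3, .tapp h4 hs⟩
  | @par E l rho k t A h ih =>
    obtain ⟨t', h1, h2, h3, h4⟩ := ih fun j n hn => (hrho j n hn).trans (Nat.le_succ k)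
    by_cases hd : ∃ u, t' = .dpar u
    · obtain ⟨u, rfl⟩ := hd
      refine ⟨u, h1.2, h2, h3, ?_⟩
      cases h4 with
      | dpar h4 => exact h4.of_kill
    · exact ⟨.par t', ⟨fun u e => hd ⟨u, e⟩, h1⟩, h2, h3, .par h4⟩
  | @dpar E l rho k t A h ih =>
    obtain ⟨t', h1, h2, h3, h4⟩ := ih fun j n hn => (kill_eq_some.1 hn).2
    by_cases hd : ∃ u, t' = .par u
    · obtain ⟨u, rfl⟩ := hd
      refine ⟨u, h1.2, h2, h3, ?_⟩
      cases h4 with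
      | par h4 => exact h4.of_kill
    · exact ⟨.dpar t', ⟨fun u e => hd ⟨u, e⟩, h1⟩, h2, h3, .dpar h4⟩

end Leveled

/-- If the sums stay nonnegative on the way to all leaves and abstractions, then they are
nonnegative everywhere. -/
theorem above_zero_of_occ {t v : PTerm} {q : List Step} (hv : Occ t q v) {k : ℤ}
    (hfree : ∀ p x, FreeAt t p x → Above 0 k (word p))
    (hlam : ∀ p D v, Occ t p (.lam D v) →
      Above 0 k (word p) ∧ ∀ q, FreeAt v q 0 → WellBracketed (word q)) : Above 0 k (word q) := by
  have hk : (0 : ℤ) ≤ k := by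
    rcases t.exists_freeAt_or_lam with ⟨p, x, hx⟩ | ⟨p, D, v, hv⟩
    exacts [(hfree p x hx).le, (hlam p D v hv).1.le]
  induction hv generalizing k with
  | here => exact above_nil.2 hk
  | lam D hv ih =>
    refine ih (fun p x hx => ?_) (fun p D' v hv => hlam (.lam D :: p) D' v (hv.lam D)) hk
    cases x with
    | zero =>
      intro w' hw'
      have := ((hlam [] D _ (.here _)).2 p hx).1 w' hw'
      push_cast
      omega
    | succ x => exact hfree (.lam D :: p) x (hx.lam D)
  | fn s hv ih =>
    exact ih (fun p x hx => hfree (.fn :: p) x (hx.fn s))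
      (fun p D v hv => hlam (.fn :: p) D v (hv.fn s)) hk
  | arg s hv ih =>
    exact ih (fun p x hx => hfree (.arg :: p) x (hx.arg s))
      (fun p D v hv => hlam (.arg :: p) D v (hv.arg s)) hk
  | tlam hv ih =>
    exact ih (fun p x hx => hfree (.tlam :: p) x hx.tlam)
      (fun p D v hv => hlam (.tlam :: p) D v hv.tlam) hk
  | tapp A hv ih =>
    exact ih (fun p x hx => hfree (.tapp :: p) x (hx.tapp A))
      (fun p D v hv => hlam (.tapp :: p) D v (hv.tapp A)) hk
  | par hv ih =>
    exact above_par.2 ⟨hk, ih (fun p x hx => (above_par.1 (hfree _ x hx.par)).2)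
      (fun p D v hv => ⟨(above_par.1 (hlam _ D v hv.par).1).2, (hlam _ D v hv.par).2⟩) (by omega)⟩
  | @dpar t u p hv ih =>
    have hfree' : ∀ p x, FreeAt t p x → Above 0 (k - 1) (word p) := fun p x hx =>
      (above_dpar.1 (hfree _ x hx.dpar)).2
    have hlam' : ∀ p D v, Occ t p (.lam D v) →
        Above 0 (k - 1) (word p) ∧ ∀ q, FreeAt v q 0 → WellBracketed (word q) := fun p D v hv =>
      ⟨(above_dpar.1 (hlam _ D v hv.dpar).1).2, (hlam _ D v hv.dpar).2⟩
    -- A negative sum at the body would already show at some variable or abstraction inside it.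
    refine above_dpar.2 ⟨hk, ih hfree' hlam' ?_⟩
    rcases t.exists_freeAt_or_lam with ⟨p, x, hx⟩ | ⟨p, D, v, hv⟩
    exacts [(hfree' p x hx).le, (hlam' p D v hv).1.le]

/-! ### From a derivation to a leveling -/

section StarCtx

variable {Γ Δ Γ' Δ' : Ctx} {x : ℕ} {D D' : StarTy}

theorem mem_starCtx_mono (hΓ : Γ ≤ Γ') (hΔ : Δ ≤ Δ') (h : (x, D) ∈ starCtx Γ Δ) :
    (x, D) ∈ starCtx Γ' Δ' := by
  rw [mem_starCtx] at h ⊢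
  split_ifs at h ⊢
  exacts [Multiset.mem_of_le hΓ h, Multiset.mem_of_le hΔ h]

theorem mem_add_of_mem_starCtx (h : (x, D) ∈ starCtx Γ Δ) : (x, D.ty.unstar) ∈ Γ + Δ := by
  rw [mem_starCtx] at h
  split_ifs at h
  exacts [Multiset.mem_add.2 (Or.inl h), Multiset.mem_add.2 (Or.inr h)]

theorem starCtx_disjoint (hd : Ctx.Distinct (Γ + Γ') (Δ + Δ')) (h : (x, D) ∈ starCtx Γ Δ)
    (h' : (x, D') ∈ starCtx Γ' Δ') : False := by
  rw [Ctx.Distinct, add_add_add_comm, Multiset.map_add, Multiset.nodup_add] at hd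
  have h1 : x ∈ (Γ + Δ).map Prod.fst :=
    Multiset.mem_map_of_mem Prod.fst (mem_add_of_mem_starCtx h)
  have h2 : x ∈ (Γ' + Δ').map Prod.fst :=
    Multiset.mem_map_of_mem Prod.fst (mem_add_of_mem_starCtx h')
  exact Multiset.disjoint_left.1 hd.2.2 h1 h2

theorem starCtx_unique (hd : Ctx.Distinct Γ Δ) (h : (x, D) ∈ starCtx Γ Δ)
    (h' : (x, D') ∈ starCtx Γ Δ) : D = D' := by
  have e := hd.eq_of_mem (mem_add_of_mem_starCtx h) (mem_add_of_mem_starCtx h') rfl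
  have e' : D.ty = D'.ty := by
    rw [← LinTy.star_unstar D.ty, (Prod.mk.inj e).2, LinTy.star_unstar]
  have hdis := (Ctx.distinct_iff.1 hd).2.2
  rw [mem_starCtx] at h h'
  rcases D with ⟨b, A⟩
  rcases D' with ⟨b', A'⟩
  obtain rfl : A = A' := e'
  cases b <;> cases b'
  · rfl
  · exact absurd rfl (hdis _ (by simpa using h') _ (by simpa using h))
  · exact absurd rfl (hdis _ (by simpa using h) _ (by simpa using h'))
  · rfl

theorem mem_lift {S : Ctx} {A : DType} : (x + 1, A) ∈ Ctx.lift S ↔ (x, A) ∈ S := by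
  simp [Ctx.lift]

end StarCtx

theorem scons_const {X : Type} (a : X) : scons a (fun _ => a) = fun _ => a := by
  funext n; cases n <;> rfl

/-- A pseudo-term of sum `0` all whose variables are bound or free at sum `0`. -/
abbrev Leveled₀ (E : Env) (t : PTerm) (A : LinTy) : Prop :=
  Leveled E (fun _ => some 0) (fun _ => some 0) 0 t A

theorem scoped_const (A : LinTy) : Scoped (fun _ => some 0) A := fun _ _ => ⟨0, rfl⟩

/-- Variables bound at level 0 are never forgotten, so free variables put no restriction on the
levels below them. -/
theorem kill_const (k : ℕ) : kill k (fun _ => some 0) = fun _ => some 0 := by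
  funext x
  exact kill_eq_some.2 ⟨rfl, Nat.zero_le k⟩

namespace Leveled₀

variable {E E' : Env} {t u : PTerm} {A B C : LinTy}

theorem congr_env (h : Leveled₀ E t A) (hE : ∀ y, 0 < t.count y → E' y = E y) : Leveled₀ E' t A :=
  Leveled.congr_env h fun y hy => ⟨hE y hy, fun _ hn => hn⟩

theorem lam {D : StarTy} (h : Leveled₀ E t B) (hE : 0 < t.count 0 → E 0 = D)
    (hc : D.bang = false → t.count 0 ≤ 1) :
    Leveled₀ (fun x => E (x + 1)) (.lam D t) (D.lolli B) := by
  refine Leveled.lam (scoped_const _) hc ?_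
  rw [scons_const]
  refine h.congr_env ?_
  rintro (_ | y) hy
  · exact (hE hy).symm
  · rfl

/-- The application of a function to a boxed argument. -/
theorem appBox {z : ℕ} (h1 : Leveled₀ E t (.arrow true A B)) (h2 : Leveled₀ E' u A)
    (hu : ∀ y, 0 < u.count y → y = z) (hc : u.count z ≤ 1)
    (hz : 0 < u.count z → E' z = ⟨false, C⟩ ∧ E z = ⟨true, C⟩) :
    ∃ a : PTerm, a.erase = u.erase ∧ (∀ y, 0 < a.count y → y = z ∧ 0 < u.count z) ∧
      Leveled₀ E (.app t a) B := by
  have hcount : (u.rename fun _ => 0).count 0 = u.count z :=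
    PTerm.count_rename fun y hy => by simp [hu y hy]
  have hw : ∀ y, 0 < (u.rename fun _ => 0).count y → y = 0 := fun y hy =>
    let ⟨_, _, e⟩ := PTerm.count_rename_pos.1 hy
    e.symm
  have hx : 0 < (u.rename fun _ => 0).count 0 →
      (fun _ => some 0 : ℕ → Option ℕ) z = some 0 ∧ E z = ⟨true, C⟩ := fun h =>
    ⟨rfl, (hz (by rwa [← hcount])).2⟩
  have h5 : Leveled (fun _ => ⟨false, C⟩) (fun _ => some 0) (resetLevels fun _ => some 0) 0
      (u.rename fun _ => 0) A := by
    refine h2.rename fun y hy => ⟨?_, fun n hn => hn⟩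
    obtain rfl := hu y hy
    exact (hz hy).1.symm
  refine ⟨_, ?_, ?_, Leveled.appBox h1 hw (by rwa [hcount]) hx h5 (Leveled.box hw hx ?_ h5)⟩
  · rw [PTerm.rename_subst, PTerm.erase, PTerm.erase_subst]
    conv_rhs => rw [← u.rename_id, ← PTerm.subst_var]
    have e : (u.subst fun n => .var n) = u.subst fun _ => .var z :=
      PTerm.subst_congr fun y hy => by rw [hu y hy]
    rw [e, PTerm.erase_subst]
    rfl
  · intro y hy
    change 0 < ((u.rename fun _ => 0).subst fun _ => .dpar (.var z)).count y at hy
    rw [PTerm.count_subst_dpar hw] at hy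
    split_ifs at hy with e
    · exact ⟨e, by rwa [← hcount]⟩
    · exact absurd hy (lt_irrefl 0)
  · intro j n hn
    simp only [Option.some.injEq] at hn
    exact hn.ge

/-- The image of (`§`i). In the new environment a variable may be declared as `!A` or as `§ A`: both
have the output type `§ A`, so the same `§̄` serves for the nonlinear zone and for the zone `§ Δ`.
-/
theorem box (h : Leveled₀ E t A) (hE : ∀ y, 0 < t.count y → (E y).bang = false)
    (hE' : ∀ y, 0 < t.count y → (E' y).out = (E y).ty.par) :
    Leveled₀ E' (.par (t.subst fun y => .dpar (.var y))) A.par := by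
  have h1 : Leveled E (fun _ => some 1) (fun _ => some 0) 1 t A :=
    Leveled.add_level h (c := 1) (fun x n hn => by
      simp only [Option.some.injEq] at hn
      simp [← hn]) fun j n hn => ⟨0, Nat.zero_le _, rfl⟩
  refine .par (h1.subst fun y hy n hn => Or.inr ⟨hE y hy, ?_⟩)
  obtain rfl : 1 = n := by simpa using hn
  refine .dpar ?_
  simp only [kill_const]
  rw [← hE' y hy]
  exact .var rfl (scoped_const _)

end Leveled₀

open Classical in
/-- Every derivation of DLAL gives a decoration. -/
theorem Derives.exists_leveled {Γ Δ : Ctx} {M : FTerm} {A : DType} (h : Derives Γ Δ M A) :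
    ∃ (t : PTerm) (E : Env), t.erase = M ∧ (∀ x, 0 < t.count x → (x, E x) ∈ starCtx Γ Δ) ∧
      (∀ x, (E x).bang = false → t.count x ≤ 1) ∧ Leveled₀ E t A.star := by
  induction h with
  | id x A =>
    refine ⟨.var x, fun _ => ⟨false, A.star⟩, rfl, fun y hy => ?_, fun y _ => ?_,
      .var (E := fun _ => ⟨false, A.star⟩) rfl (scoped_const _)⟩
    · obtain rfl := PTerm.count_var_pos.1 hy
      simp [mem_starCtx]
    · simp only [PTerm.count]; split_ifs <;> simp
  | @lolliI Γ Δ M A B h ih =>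
    obtain ⟨t, E, rfl, hm, hc, ht⟩ := ih
    have h0 : 0 < t.count 0 → E 0 = ⟨false, A.star⟩ := fun h0 =>
      starCtx_unique h.distinct (hm 0 h0) (by simp [mem_starCtx])
    refine ⟨.lam ⟨false, A.star⟩ t, fun x => E (x + 1), ?_, fun x hx => ?_, fun x => hc (x + 1),
      ht.lam h0 fun _ => ?_⟩
    · simp [PTerm.erase, StarTy.erase]
    · have := mem_starCtx.1 (hm (x + 1) hx)
      rw [mem_starCtx]
      split_ifs at this ⊢
      · exact mem_lift.1 this
      · simpa [mem_lift] using this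
    · by_contra hc0
      exact hc0 (hc 0 (by rw [h0 (by omega)]))
  | @lolliE Γ₁ Γ₂ Δ₁ Δ₂ M N A B hd h1 h2 ih1 ih2 =>
    obtain ⟨t, E₁, rfl, hm1, hc1, ht⟩ := ih1
    obtain ⟨u, E₂, rfl, hm2, hc2, hu⟩ := ih2
    have hdis : ∀ x, 0 < t.count x → 0 < u.count x → False := fun x hx hx' =>
      starCtx_disjoint hd (hm1 x hx) (hm2 x hx')
    have e2 : ∀ x, 0 < u.count x → (if 0 < t.count x then E₁ x else E₂ x) = E₂ x := fun x hx =>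
      if_neg fun hx' => hdis x hx' hx
    -- The contexts are disjoint, so each variable that occurs belongs to one premise only and takes
    -- its type from there.
    refine ⟨.app t u, fun x => if 0 < t.count x then E₁ x else E₂ x, rfl, fun x hx => ?_,
      fun x hx => ?_, .app (ht.congr_env fun y hy => if_pos hy) (hu.congr_env e2)⟩
    · rcases Nat.add_pos_iff_pos_or_pos.1 hx with hx | hx
      · simp only [if_pos hx]
        exact mem_starCtx_mono (Multiset.le_add_right _ _) (Multiset.le_add_right _ _) (hm1 x hx)
      · simp only [e2 x hx]
        exact mem_starCtx_mono (Multiset.le_add_left _ _) (Multiset.le_add_left _ _) (hm2 x hx)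
    · simp only [PTerm.count]
      by_cases hxt : 0 < t.count x
      · simp only [if_pos hxt] at hx
        have := hc1 x hx
        have : ¬ 0 < u.count x := hdis x hxt
        omega
      · simp only [if_neg hxt] at hx
        have := hc2 x hx
        omega
  | @implI Γ Δ M A B h ih =>
    obtain ⟨t, E, rfl, hm, hc, ht⟩ := ih
    have h0 : 0 < t.count 0 → E 0 = ⟨true, A.star⟩ := fun h0 =>
      starCtx_unique h.distinct (hm 0 h0) (by simp [mem_starCtx])
    refine ⟨.lam ⟨true, A.star⟩ t, fun x => E (x + 1), ?_, fun x hx => ?_, fun x => hc (x + 1),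
      ht.lam h0 fun hb => by simp at hb⟩
    · simp [PTerm.erase, StarTy.erase]
    · have := mem_starCtx.1 (hm (x + 1) hx)
      rw [mem_starCtx]
      split_ifs at this ⊢
      · simpa [mem_lift] using this
      · exact mem_lift.1 this
  | @implE Γ Δ M N A B C z hd h1 h2 ih1 ih2 =>
    obtain ⟨t, E₁, rfl, hm1, hc1, ht⟩ := ih1
    obtain ⟨u, E₂, rfl, hm2, hc2, hu⟩ := ih2
    have hz : ∀ y, 0 < u.count y → y = z ∧ E₂ y = ⟨false, C.star⟩ := by
      intro y hy
      have hy' := hm2 y hy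
      have e := mem_add_of_mem_starCtx hy'
      simp only [zero_add, Multiset.mem_singleton, Prod.mk.injEq] at e
      obtain rfl := e.1
      exact ⟨rfl, starCtx_unique h2.distinct hy' (by simp [mem_starCtx])⟩
    have hzt : t.count z = 0 := by
      by_contra hc
      rw [← Multiset.singleton_add, ← zero_add Δ] at hd
      exact starCtx_disjoint (D := ⟨true, C.star⟩) hd (by simp [mem_starCtx])
        (hm1 z (Nat.pos_of_ne_zero hc))
    have hE : ∀ y, 0 < t.count y → (if y = z then ⟨true, C.star⟩ else E₁ y) = E₁ y := by
      intro y hy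
      refine if_neg ?_
      rintro rfl
      omega
    have hcz : u.count z ≤ 1 := by
      by_contra hc
      exact hc (hc2 z (by rw [(hz z (by omega)).2]))
    obtain ⟨a, ha1, ha2, ha3⟩ := Leveled₀.appBox (ht.congr_env hE) hu (fun y hy => (hz y hy).1) hcz
      fun h0 => ⟨(hz z h0).2, by simp⟩
    refine ⟨.app t a, _, by simp only [PTerm.erase, ha1], fun x hx => ?_, fun x hx => ?_, ha3⟩
    · rcases Nat.add_pos_iff_pos_or_pos.1 hx with hx | hx
      · rw [hE x hx]
        exact mem_starCtx_mono (Multiset.le_cons_self _ _) le_rfl (hm1 x hx)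
      · rw [(ha2 x hx).1]
        simp [mem_starCtx]
    · split_ifs at hx with hxz
      · have := hc1 x hx
        have h0 : ¬ 0 < a.count x := fun h0 => hxz (ha2 x h0).1
        simp only [PTerm.count]; omega
  | @implE_closed Γ Δ M N A B h1 h2 ih1 ih2 =>
    obtain ⟨t, E₁, rfl, hm1, hc1, ht⟩ := ih1
    obtain ⟨u, E₂, rfl, hm2, hc2, hu⟩ := ih2
    have hz : ∀ y, ¬ 0 < u.count y := fun y hy => by
      simpa using mem_add_of_mem_starCtx (hm2 y hy)
    -- The argument is closed, so the index `0` and the type variable are dummies.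
    obtain ⟨a, ha1, ha2, ha3⟩ := Leveled₀.appBox (z := 0) (C := .var 0) ht hu
      (fun y hy => absurd hy (hz y)) (by have := hz 0; omega) fun h0 => absurd h0 (hz 0)
    have ha : ∀ y, a.count y = 0 := fun y => by
      by_contra hy
      exact hz 0 (ha2 y (Nat.pos_of_ne_zero hy)).2
    refine ⟨.app t a, E₁, by simp only [PTerm.erase, ha1], fun x hx => hm1 x ?_, fun x hx => ?_, ha3⟩
    · simpa only [PTerm.count, ha, add_zero] using hx
    · simpa only [PTerm.count, ha, add_zero] using hc1 x hx
  | weak hd h ih =>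
    obtain ⟨t, E, rfl, hm, hc, ht⟩ := ih
    exact ⟨t, E, rfl, fun x hx => mem_starCtx_mono (Multiset.le_add_right _ _)
      (Multiset.le_add_right _ _) (hm x hx), hc, ht⟩
  | @cntr Γ Δ M A B x₁ x₂ x hd h ih =>
    obtain ⟨t, E, rfl, hm, hc, ht⟩ := ih
    have hmem : ∀ y, 0 < t.count y → ((y = x₁ ∨ y = x₂) ∧ E y = ⟨true, A.star⟩) ∨
        (¬ (y = x₁ ∨ y = x₂) ∧ y ≠ x ∧ (y, E y) ∈ starCtx Γ Δ) := by
      intro y hy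
      by_cases hyx : y = x₁ ∨ y = x₂
      · refine Or.inl ⟨hyx, starCtx_unique h.distinct (hm y hy) ?_⟩
        rcases hyx with rfl | rfl <;> simp [mem_starCtx]
      · have hy' : (y, E y) ∈ starCtx Γ Δ := by
          have := mem_starCtx.1 (hm y hy)
          rw [mem_starCtx]
          push Not at hyx
          split_ifs at this ⊢
          · simpa [hyx] using this
          · exact this
        refine Or.inr ⟨hyx, ?_, hy'⟩
        rintro rfl
        rw [← Multiset.singleton_add, ← zero_add Δ] at hd
        exact starCtx_disjoint (D := ⟨true, A.star⟩) hd (by simp [mem_starCtx]) hy'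
    refine ⟨t.rename fun y => if y = x₁ ∨ y = x₂ then x else y,
      fun y => if y = x then ⟨true, A.star⟩ else E y, PTerm.erase_rename _ _, fun y hy => ?_,
      fun y hy => ?_, ht.rename fun y hy => ⟨?_, fun n hn => hn⟩⟩
    · obtain ⟨z, hz, rfl⟩ := PTerm.count_rename_pos.1 hy
      rcases hmem z hz with ⟨h1, -⟩ | ⟨h1, h2, h3⟩
      · simp [h1, mem_starCtx]
      · simp only [h1, h2, ↓reduceIte]
        exact mem_starCtx_mono (Multiset.le_cons_self _ _) le_rfl h3
    · dsimp only at hy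
      split_ifs at hy with hyx
      refine le_trans (le_of_eq ?_) (hc y hy)
      refine PTerm.count_rename fun z hz => ?_
      rcases hmem z hz with ⟨h1, h2⟩ | ⟨h1, h2, h3⟩
      · rw [if_pos h1]
        refine ⟨fun e => absurd e.symm hyx, ?_⟩
        rintro rfl
        rw [h2] at hy
        simp at hy
      · rw [if_neg h1]
    · rcases hmem y hy with ⟨h1, h2⟩ | ⟨h1, h2, h3⟩
      · simp [h1, h2]
      · simp [h1, h2]
  | @parI Γ Δ M A h ih =>
    obtain ⟨t, E, rfl, hm, hc, ht⟩ := ih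
    have hb : ∀ y, 0 < t.count y → (E y).bang = false ∧ (y, (E y).ty.unstar) ∈ Γ + Δ := by
      intro y hy
      have := mem_starCtx.1 (hm y hy)
      split_ifs at this with hb
      · simp at this
      · exact ⟨by simpa using hb, this⟩
    have hcount : ∀ x, (PTerm.par (t.subst fun y => .dpar (.var y))).count x = t.count x := fun x =>
      PTerm.count_subst fun z _ => by simp [PTerm.count]
    -- A variable is made a bang variable if its declaration lies in `Γ`, and gets a `§`-type
    -- otherwise.
    refine ⟨.par (t.subst fun y => .dpar (.var y)),
      fun y => if (y, (E y).ty.unstar) ∈ Γ then ⟨true, (E y).ty⟩ else ⟨false, (E y).ty.par⟩,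
      ?_, fun x hx => ?_, fun x _ => ?_, ht.box (fun y hy => (hb y hy).1) fun y hy => ?_⟩
    · rw [PTerm.erase, PTerm.erase_subst]
      conv_rhs => rw [← t.rename_id, ← PTerm.subst_var, PTerm.erase_subst]
      rfl
    · rw [hcount] at hx
      rw [mem_starCtx]
      by_cases hxΓ : (x, (E x).ty.unstar) ∈ Γ
      · simp [hxΓ]
      · have := (Multiset.mem_add.1 (hb x hx).2).resolve_left hxΓ
        simp only [hxΓ, ↓reduceIte, Bool.false_eq_true]
        exact Multiset.mem_map_of_mem (fun p : ℕ × DType => (p.1, p.2.par)) this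
    · rw [hcount]
      by_contra hx
      exact hx (hc x (hb x (by omega)).1)
    · split_ifs <;> rfl
  | @parE Γ₁ Γ₂ Δ₁ Δ₂ M N A B x hd h1 h2 ih1 ih2 =>
    obtain ⟨u, E₁, rfl, hm1, hc1, hu⟩ := ih1
    obtain ⟨t, E₂, rfl, hm2, hc2, ht⟩ := ih2
    have hx2 : 0 < t.count x → E₂ x = ⟨false, A.star.par⟩ := fun h0 =>
      starCtx_unique h2.distinct (hm2 x h0) (by simp [mem_starCtx, LinTy.unstar])
    have hm2' : ∀ y, y ≠ x → 0 < t.count y → (y, E₂ y) ∈ starCtx Γ₂ Δ₂ := by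
      intro y hyx hy
      have := mem_starCtx.1 (hm2 y hy)
      rw [mem_starCtx]
      split_ifs at this ⊢
      · exact this
      · simpa [hyx] using this
    have hE : ∀ y, y ≠ x → 0 < t.count y →
        u.count y = 0 ∧ (if 0 < u.count y then E₁ y else E₂ y) = E₂ y := by
      intro y hyx hy
      have : ¬ 0 < u.count y := fun hy' => starCtx_disjoint hd (hm1 y hy') (hm2' y hyx hy)
      exact ⟨by omega, if_neg this⟩
    -- The variable `x` is linear of level 0, so `Leveled.subst` admits any term leveled at 0 in its
    -- place.
    refine ⟨t.subst fun y => if y = x then u else .var y,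
      fun y => if 0 < u.count y then E₁ y else E₂ y, ?_, fun y hy => ?_, fun y hy => ?_,
      ht.subst fun y hy n hn => ?_⟩
    · rw [PTerm.erase_subst, FTerm.substVar]
      congr 1
      funext z
      split_ifs <;> rfl
    · obtain ⟨z, hz1, hz2⟩ := PTerm.count_subst_pos.1 hy
      dsimp only at hz2 ⊢
      split_ifs at hz2 with hzx
      · rw [if_pos hz2]
        exact mem_starCtx_mono (Multiset.le_add_right _ _) (Multiset.le_add_right _ _) (hm1 y hz2)
      · obtain rfl := PTerm.count_var_pos.1 hz2
        rw [(hE z hzx hz1).2]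
        exact mem_starCtx_mono (Multiset.le_add_left _ _) (Multiset.le_add_left _ _)
          (hm2' z hzx hz1)
    · have hxc : t.count x ≤ 1 := by
        by_contra hc
        exact hc (hc2 x (by rw [hx2 (by omega)]))
      -- Occurrences of `y` come from `t`, unless `y = x`, and from the copies of `u`. There is at
      -- most one copy, and the contexts are disjoint, so only one source contributes.
      rw [PTerm.count_subst_two (p := y) (q := x) (a := if y = x then 0 else 1) (b := u.count y)]
      · by_cases hyu : 0 < u.count y
        · simp only [if_pos hyu] at hy
          have hle := hc1 y hy
          have h0 : t.count y * (if y = x then 0 else 1) = 0 := by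
            split_ifs with hyx
            · rfl
            · by_contra hc
              have := (hE y hyx (by omega)).1
              omega
          have := Nat.mul_le_mul hxc hle
          omega
        · simp only [if_neg hyu] at hy
          have hle := hc2 y hy
          have h0 : u.count y = 0 := by omega
          rw [h0, mul_zero, add_zero]
          split_ifs <;> omega
      · intro z _
        by_cases hzx : z = x
        · subst hzx
          by_cases hzy : z = y
          · simp [hzy]
          · simp [hzy]
        · by_cases hzy : z = y
          · subst hzy
            simp [hzx, PTerm.count]
          · simp [hzx, hzy, PTerm.count]
    · obtain rfl : 0 = n := by simpa using hn
      by_cases hyx : y = x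
      · subst hyx
        rw [hx2 hy]
        simp only [↓reduceIte, kill_const, true_and]
        exact Or.inr (hu.congr_env fun z hz => if_pos hz)
      · exact Or.inl ⟨y, if_neg hyx, (hE y hyx hy).2, rfl⟩
  | @allI Γ Δ M A h ih =>
    obtain ⟨t, E, rfl, hm, hc, ht⟩ := ih
    -- The eigenvariable condition: the declared types are weakenings, so they can be lowered and
    -- shifted back without loss.
    have hE : ∀ y, 0 < t.count y → ((E y).rename Nat.pred).shift = E y ∧
        (y, (E y).rename Nat.pred) ∈ starCtx Γ Δ := by
      intro y hy
      have key : ∀ S : Ctx, (y, (E y).ty.unstar) ∈ Ctx.liftTy S →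
          ((E y).rename Nat.pred).shift = E y ∧ (y, ((E y).ty.rename Nat.pred).unstar) ∈ S := by
        intro S hS
        obtain ⟨⟨z, B⟩, hB, e⟩ := Multiset.mem_map.1 hS
        obtain ⟨rfl, e⟩ := Prod.mk.inj e
        have e' : (E z).ty = B.star.shift := by
          rw [← LinTy.star_unstar (E z).ty, ← e, DType.star_shift]
        have e'' : (E z).ty.rename Nat.pred = B.star := by
          rw [e', LinTy.shift, LinTy.rename_rename]
          exact LinTy.rename_id _
        refine ⟨?_, by simpa [e''] using hB⟩
        simp only [StarTy.rename, StarTy.shift, e'', ← e']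
      have := mem_starCtx.1 (hm y hy)
      rw [mem_starCtx]
      by_cases hb : (E y).bang = true
      · rw [if_pos hb] at this
        refine ⟨(key Γ this).1, ?_⟩
        rw [if_pos (show ((E y).rename Nat.pred).bang = true from hb)]
        exact (key Γ this).2
      · rw [if_neg hb] at this
        refine ⟨(key Δ this).1, ?_⟩
        rw [if_neg (show ¬ ((E y).rename Nat.pred).bang = true from hb)]
        exact (key Δ this).2
    refine ⟨.tlam t, fun y => (E y).rename Nat.pred, rfl, fun x hx => (hE x hx).2, fun x => hc x,
      .tlam ?_⟩
    rw [scons_const]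
    exact ht.congr_env fun y hy => (hE y hy).1
  | @allE Γ Δ M A B h ih =>
    obtain ⟨t, E, rfl, hm, hc, ht⟩ := ih
    refine ⟨.tapp t B.star, E, by simp [PTerm.erase], hm, hc, ?_⟩
    rw [DType.star_inst]
    exact .tapp ht (scoped_const _)

end DLAL

/-! ### The equivalence -/

theorem mainTheorem2 (S : ℕ → DLAL.FType) (M : DLAL.FTerm) (T : DLAL.FType)
    (hM : DLAL.FTerm.HasType S M T)
    (Γ Δ : DLAL.Ctx) (hdistinct : DLAL.Ctx.Distinct Γ Δ)
    (hdecl : ∀ x A, (x, A) ∈ Γ + Δ → A.erase = S x) (C : DLAL.DType) :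
    DLAL.Derives Γ Δ M C ↔
      ∃ (t : DLAL.PTerm) (E : DLAL.Env),
        t.erase = M ∧
        (∀ p x, DLAL.FreeAt t p x → (x, E x) ∈ DLAL.starCtx Γ Δ) ∧
        DLAL.Regular t ∧
        DLAL.LocalTyping E t C.star ∧
        DLAL.Bracketing t ∧
        DLAL.BangCondition E t ∧
        DLAL.ScopeCondition E t := by
  have hzero : ∀ x n : ℕ, (fun _ => some 0 : ℕ → Option ℕ) x = some n → n = 0 := fun x n hn => by
    simpa using hn.symm
  constructor
  · intro h
    obtain ⟨t, E, ht, hm, hc, hl⟩ := h.exists_leveled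
    obtain ⟨t', h1, h2, h3, h4⟩ := hl.exists_reg fun j n hn => (hzero j n hn).le
    obtain ⟨h5, h6, h7, h8⟩ := h4.conditions fun x hx => by rw [h3]; exact hc x hx
    refine ⟨t', E, h2.trans ht, fun p x hx => hm x ?_, h1.regular, h5, h6, h7, h8⟩
    rw [← h3]
    exact DLAL.PTerm.count_pos_iff.2 ⟨p, hx⟩
  · rintro ⟨t, E, rfl, hm, -, ⟨hout, hlin, hlin'⟩, ⟨hfree, hlam⟩, hbang, hscope⟩
    have hd : DLAL.Decorated E (fun _ => some 0) (fun _ => some 0) 0 t C.star :=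
      { outTy := hout
        linear := hlin'
        free := fun p x hx => ⟨0, rfl, (DLAL.wellBracketed_iff 0).1 (hfree p x hx)⟩
        lam := fun p D v hv =>
          ⟨(DLAL.weaklyWellBracketed_iff 0).1 (hlam p D v hv).1, (hlam p D v hv).2⟩
        scope := hscope
        -- A free type variable has level 0, and no sum is negative anywhere in a bracketed term, so
        -- dependence on it is unrestricted.
        scopeOuter := fun _ q v hv _ => ⟨0, rfl, DLAL.above_zero_of_occ hv
          (fun p x hx => (DLAL.weaklyWellBracketed_iff 0).1 (hfree p x hx).1) fun p D v hv =>
            ⟨(DLAL.weaklyWellBracketed_iff 0).1 (hlam p D v hv).1, (hlam p D v hv).2⟩⟩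
        bang := hbang }
    have hder := (hd.leveled (fun x n hn => (hzero x n hn).le)
      fun x n hn => (hzero x n hn).le).der hzero hzero fun x hx => by
        refine DLAL.PTerm.count_le_one fun p q hp hq => ?_
        by_contra hpq
        have := hlin p q x hp hq hpq
        simp [hx] at this
    -- The identity naming identifies no variables.
    have := hder (fun x => x) Γ Δ hdistinct
      (fun x hx => let ⟨p, hp⟩ := DLAL.PTerm.count_pos_iff.1 hx; hm p x hp) fun x y _ _ _ e => e
    rwa [DLAL.PTerm.rename_id, DLAL.DType.unstar_star] at this
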